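/- Let $M$ be a Riemann surface and $y:M\to S^3\subset\mathbb{R}^4$ a smooth conformal immersion. Let $\langle v,w\rangle=-v_0w_0+\sum_{i=1}^4v_iw_i$ be the Lorentz form on $\mathbb{R}^{4,1}$, extended complex bilinearly. For a local complex coordinate $z$ of $M$ let $Y$ be the canonical lift of $y$, i.e. the positive multiple of $(1,y)$ with $|dY|^2=|dz|^2$, let $V=\mathrm{span}\{Y,\mathrm{Re}\,Y_z,\mathrm{Im}\,Y_z,Y_{z\bar z}\}$, let $D$ be the connection on $V^\perp$ induced by orthogonal projection, and write $Y_{zz}=-\tfrac{s}{2}Y+\kappa$ with $\kappa$ a section of $V^\perp\otimes\mathbb{C}$ and $s$ a complex function. Assume that $y$ has no umbilic points, i.e. $\kappa\neq 0$ everywhere, and that $y$ is a Willmore surface, i.e. it satisfies the Willmore equation (the Euler--Lagrange equation of the Willmore functional) $$D_{\bar z}D_{\bar z}\kappa+\tfrac{\bar s}{2}\kappa=0 .$$ Define $\mu$ by $D_{\bar z}\kappa+\tfrac{\bar\mu}{2}\kappa=0$, put $\rho=\bar\mu_z-2\langle\kappa,\bar\kappa\rangle$, and let $$\mathcal{P}=\frac{\rho}{\langle\kappa,\bar\kappa\rangle}:M\to\mathbb{C},$$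 which does not depend on the coordinate. Let $\mathcal{K}:M\to\mathbb{R}$ be the Gaussian curvature of the Möbius metric $g=4\langle\kappa,\bar\kappa\rangle|dz|^2$. Then the following three conditions are equivalent: 1. $|\mathcal{P}|$ is a nonzero constant on $M$; 2. $\mathcal{K}\equiv 0$ on $M$; 3. $y$ is locally Möbius equivalent to the Clifford torus: every point of $M$ has an open neighbourhood $U$ and a Möbius transformation $T$ of $S^3$ (one induced by the projective action of the Lorentz group $O(4,1)$ on the light cone) such that $T(y(U))$ is contained in the Clifford torus $\{x\in S^3: x_1^2+x_2^2=x_3^2+x_4^2=\tfrac12\}$. Moreover, in this case $\mathcal{P}\equiv-2$ on $M$. -/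

import Mathlib

open scoped Manifold ContDiff

noncomputable section

namespace WillmoreS3

/-- The ambient Euclidean space `ℝ⁴` of the unit sphere `S³`. -/
abbrev E4 : Type := EuclideanSpace ℝ (Fin 4)

/-- The unit sphere `S³ ⊂ ℝ⁴`. -/
abbrev S3 : Type := Metric.sphere (0 : E4) 1

/-! ### Wirtinger derivatives -/

/-- `∂_z = (∂_x - i ∂_y) / 2`. -/
def dz {F : Type*} [NormedAddCommGroup F] [NormedSpace ℂ F] (g : ℂ → F) (z : ℂ) : F :=
  (1 / 2 : ℂ) • (fderiv ℝ g z 1 - Complex.I • fderiv ℝ g z Complex.I)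

/-- `∂_z̄ = (∂_x + i ∂_y) / 2`. -/
def dzbar {F : Type*} [NormedAddCommGroup F] [NormedSpace ℂ F] (g : ℂ → F) (z : ℂ) : F :=
  (1 / 2 : ℂ) • (fderiv ℝ g z 1 + Complex.I • fderiv ℝ g z Complex.I)

/-! ### Minkowski space `ℝ^{4,1}` and its complexification -/

/-- The complex bilinear extension to `ℂ⁵` of the Lorentz form
`⟨v, w⟩ = -v₀ w₀ + v₁ w₁ + v₂ w₂ + v₃ w₃ + v₄ w₄`. -/
def form (v w : Fin 5 → ℂ) : ℂ := -(v 0 * w 0) + ∑ i : Fin 4, v i.succ * w i.succ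

/-- The light-like vector `(1, x) ∈ ℝ^{4,1}` representing `x ∈ S³`. -/
def lightVec (x : E4) : Fin 5 → ℝ := Fin.cons 1 (fun i => x i)

/-! ### Invariants of a conformal map `f` from an open set of `ℂ` to `S³ ⊂ ℝ⁴` -/

/-- The canonical lift `Y`: the forward light-cone lift of `f` with `|dY|² = |dz|²`. For conformal
`f` it is `(1, f) / |f_x|`. -/
def lift (f : ℂ → E4) (z : ℂ) : Fin 5 → ℂ :=
  fun i => (((‖fderiv ℝ f z 1‖)⁻¹ * lightVec (f z) i : ℝ) : ℂ)

/-- `Y_{z z̄}`. -/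
def liftZZbar (f : ℂ → E4) : ℂ → Fin 5 → ℂ := dz (dzbar (lift f))

/-- The section `N` of the mean curvature sphere bundle
`V = span {Y, Re Y_z, Im Y_z, Y_{z z̄}}` determined by
`⟨N, N⟩ = 0`, `⟨N, Y⟩ = -1`, `⟨N, Y_z⟩ = 0`; explicitly `N = 2 Y_{z z̄} + 2 ⟨Y_{z z̄}, Y_{z z̄}⟩ Y`. -/
def frameN (f : ℂ → E4) (z : ℂ) : Fin 5 → ℂ :=
  (2 : ℂ) • liftZZbar f z
    + (2 * form (liftZZbar f z) (liftZZbar f z)) • lift f z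

/-- The orthogonal projection of `v ∈ ℂ⁵` onto `V^⊥ ⊗ ℂ` at the point `z`, written in the frame
`Y, Y_z, Y_z̄, N`, whose only nonzero products are `⟨Y_z, Y_z̄⟩ = 1/2`, `⟨Y, N⟩ = -1`. -/
def normalPart (f : ℂ → E4) (z : ℂ) (v : Fin 5 → ℂ) : Fin 5 → ℂ :=
  v + form v (frameN f z) • lift f z + form v (lift f z) • frameN f z
    - (2 * form v (dzbar (lift f) z)) • dz (lift f) z
    - (2 * form v (dz (lift f) z)) • dzbar (lift f) z

/-- The normal derivative `D_z̄ ξ` of a section `ξ` of `V^⊥ ⊗ ℂ`. -/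
def normalDzbar (f : ℂ → E4) (ξ : ℂ → Fin 5 → ℂ) (z : ℂ) : Fin 5 → ℂ :=
  normalPart f z (dzbar ξ z)

/-- The Hopfian `κ`, the `V^⊥ ⊗ ℂ`-component of `Y_{zz}`. -/
def hopf (f : ℂ → E4) (z : ℂ) : Fin 5 → ℂ := normalPart f z (dz (dz (lift f)) z)

/-- The Schwarzian `s`, determined by `Y_{zz} = -(s/2) Y + κ`. -/
def schwarzian (f : ℂ → E4) (z : ℂ) : ℂ := 2 * form (dz (dz (lift f)) z) (frameN f z)

/-- `⟨κ, κ̄⟩`. -/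
def hopfSq (f : ℂ → E4) (z : ℂ) : ℂ := form (hopf f z) (star (hopf f z))

/-- `μ̄`, determined by `D_z̄ κ + (μ̄/2) κ = 0` where `κ ≠ 0` (as `V^⊥` has rank one). -/
def muBar (f : ℂ → E4) (z : ℂ) : ℂ :=
  -2 * form (normalDzbar f (hopf f) z) (star (hopf f z)) / hopfSq f z

/-- `ρ = ∂_z μ̄ - 2 ⟨κ, κ̄⟩`. -/
def rho (f : ℂ → E4) (z : ℂ) : ℂ := dz (muBar f) z - 2 * hopfSq f z

/-- The invariant `𝒫 = ρ / ⟨κ, κ̄⟩` in the coordinate `z`. -/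
def localP (f : ℂ → E4) (z : ℂ) : ℂ := rho f z / hopfSq f z

/-- The conformal factor of the Möbius metric `e^{2ω} |dz|² = 4 ⟨κ, κ̄⟩ |dz|²`. -/
def mobiusFactor (f : ℂ → E4) (z : ℂ) : ℝ := 4 * (hopfSq f z).re

/-- The Gaussian curvature `-e^{-2ω} (ω_xx + ω_yy) = -4 e^{-2ω} ω_{z z̄}` of the Möbius metric. -/
def localK (f : ℂ → E4) (z : ℂ) : ℝ :=
  -(Laplacian.laplacian (fun w : ℂ => Real.log (mobiusFactor f w) / 2) z) / mobiusFactor f z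

/-! ### Surfaces `y : M → S³` on a Riemann surface `M` -/

section Surface

variable {M : Type*} [TopologicalSpace M]

/-- The expression of `y` in the complex coordinate `φ`. -/
def inCoord (y : M → S3) (φ : OpenPartialHomeomorph M ℂ) (z : ℂ) : E4 := (y (φ.symm z) : E4)

variable [ChartedSpace ℂ M]

/-- `y : M → S³` is a smooth conformal immersion of the Riemann surface `M`. -/
structure IsConformalImmersion (y : M → S3) : Prop where
  smooth : ContMDiff 𝓘(ℝ, ℂ) 𝓘(ℝ, E4) ∞ (fun p => (y p : E4))
  conformal : ∀ φ ∈ atlas ℂ M, ∀ z ∈ φ.target, ConformalAt (inCoord y φ) z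

/-- `y` has no umbilic points: `κ` vanishes nowhere. -/
def HasNoUmbilics (y : M → S3) : Prop :=
  ∀ φ ∈ atlas ℂ M, ∀ z ∈ φ.target, hopf (inCoord y φ) z ≠ 0

/-- `y` is a Willmore surface: it satisfies the Willmore equation
`D_z̄ D_z̄ κ + (s̄/2) κ = 0`, the Euler-Lagrange equation of the Willmore functional. -/
def IsWillmore (y : M → S3) : Prop :=
  ∀ φ ∈ atlas ℂ M, ∀ z ∈ φ.target,
    normalDzbar (inCoord y φ) (normalDzbar (inCoord y φ) (hopf (inCoord y φ))) z
      + (star (schwarzian (inCoord y φ) z) / 2) • hopf (inCoord y φ) z = 0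

/-- The invariant function `𝒫 : M → ℂ`, computed at each point in the preferred complex coordinate
there (its value does not depend on the coordinate). -/
def invP (y : M → S3) (p : M) : ℂ := localP (inCoord y (chartAt ℂ p)) (chartAt ℂ p p)

/-- The Möbius curvature `𝒦 : M → ℝ`, computed at each point in the preferred complex coordinate
there (its value does not depend on the coordinate). -/
def mobiusCurvature (y : M → S3) (p : M) : ℝ :=
  localK (inCoord y (chartAt ℂ p)) (chartAt ℂ p p)

end Surface

/-! ### Möbius transformations and the Clifford torus -/

/-- The Gram matrix `diag(-1, 1, 1, 1, 1)` of the Lorentz form on `ℝ^{4,1}`. -/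
def lorentzMatrix : Matrix (Fin 5) (Fin 5) ℝ :=
  Matrix.diagonal (Fin.cons (-1) (fun _ : Fin 4 => 1))

/-- `T` is a Möbius transformation of `S³`: it is induced by the action of an element of the
Lorentz group `O(4,1)` on the null lines `[1, x]`, `x ∈ S³`. -/
def IsMobiusTransformation (T : S3 → S3) : Prop :=
  ∃ A : Matrix (Fin 5) (Fin 5) ℝ, A.transpose * lorentzMatrix * A = lorentzMatrix ∧
    ∀ x : S3, ∃ c : ℝ, c ≠ 0 ∧ A.mulVec (lightVec (x : E4)) = c • lightVec (T x : E4)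

/-- The Clifford torus `{x₁² + x₂² = x₃² + x₄² = 1/2} ⊂ S³`. -/
def cliffordTorus : Set S3 :=
  {x | (x : E4) 0 ^ 2 + (x : E4) 1 ^ 2 = 1 / 2 ∧ (x : E4) 2 ^ 2 + (x : E4) 3 ^ 2 = 1 / 2}

/-- `y` is locally Möbius equivalent to the Clifford torus: near every point, a Möbius
transformation carries the surface into the Clifford torus (the image of an immersion of a small
surface piece is then an open piece of the torus). -/
def LocallyMobiusEquivClifford {M : Type*} [TopologicalSpace M] (y : M → S3) : Prop :=
  ∀ p : M, ∃ U : Set M, IsOpen U ∧ p ∈ U ∧ ∃ T : S3 → S3, IsMobiusTransformation T ∧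
    ∀ q ∈ U, T (y q) ∈ cliffordTorus

end WillmoreS3

end

/-! Near a point the problem becomes scalar. The normal bundle has rank one, so `κ = k n` with `n` a
real unit normal. With `θ = k_z̄ / k`, that is `μ̄ = -2θ`, the two invariants are `𝒫 = -2 θ_z / |k|²
- 2` and `𝒦 = -Re θ_z / |k|²` (`Frame.localP_eq`, `Frame.localK_eq`). The Willmore equation and the
conformal Gauss equation together give `ρ_z̄ = μ̄ ρ` (`LogDeriv.D'_rho`).

If `|𝒫|` is a nonzero constant, then `|ρ|²` is a constant multiple of `|k|⁴`. This determines `ρ_z /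
ρ`, and equality of the mixed derivatives of `ρ` forces `Re θ_z = 0`
(`LogDeriv.re_D_theta_eq_zero`).

If `𝒦 = 0`, then `t = θ_z` is imaginary and both of its derivatives are known. Their compatibility,
differentiated twice more, gives `t = 0` and `k_z / k = -3 θ̄` (`LogDeriv.flat`), so `|k| k` is
holomorphic. In a coordinate with `dw = q dz`, `q² = |k| k`, the frame of `|k| Y` obeys a linear
system with constant coefficients (`IsFrame.exists_flatFrame`). This system is not solved: it has
the constant vector `L + 2Y` and two quadratic first integrals, and these already place the surface
in a Clifford torus (`FlatFrame.exists_clifford`).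

Conversely, for a piece of a Clifford torus `k = -u α²` with `α` holomorphic, `u` real and `u² |α|²`
constant. Hence `θ_z = 0` and `𝒫 = -2` (`exists_frame_of_clifford`,
`IsConformalOn.localP_eq_neg_two`).

The differential geometry takes place in a commutative ring with involution and two commuting
derivations (`Wirtinger`), where each identity is polynomial; `Smooth` is the ring to which it is
applied. As `invP` and `mobiusCurvature` use a chart that varies with the point, independence of the
coordinate (`invariants_eq`) is needed to pass from charts to the surface. -/

noncomputable section

namespace WillmoreS3

/-! ### Moving frames and structure equations of a conformal surface, algebraically -/

section

/-! ### The Lorentz form over a commutative ring -/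

section BilinearForm

variable {R : Type*} [CommRing R]

/-- The Lorentz form on `R⁵`. -/
def bform (v w : Fin 5 → R) : R := -(v 0 * w 0) + ∑ i : Fin 4, v i.succ * w i.succ

lemma bform_eq (v w : Fin 5 → R) :
    bform v w = -(v 0 * w 0) + (v 1 * w 1 + v 2 * w 2 + v 3 * w 3 + v 4 * w 4) := by
  simp only [bform, Fin.sum_univ_four]; rfl

lemma bform_comm (v w : Fin 5 → R) : bform v w = bform w v := by
  simp only [bform_eq]; ring

lemma bform_add_left (u v w : Fin 5 → R) : bform (u + v) w = bform u w + bform v w := by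
  simp only [bform_eq, Pi.add_apply]; ring

lemma bform_add_right (u v w : Fin 5 → R) : bform w (u + v) = bform w u + bform w v := by
  simp only [bform_eq, Pi.add_apply]; ring

lemma bform_sub_left (u v w : Fin 5 → R) : bform (u - v) w = bform u w - bform v w := by
  simp only [bform_eq, Pi.sub_apply]; ring

lemma bform_sub_right (u v w : Fin 5 → R) : bform w (u - v) = bform w u - bform w v := by
  simp only [bform_eq, Pi.sub_apply]; ring

lemma bform_smul_left (a : R) (v w : Fin 5 → R) : bform (a • v) w = a * bform v w := by
  simp only [bform_eq, Pi.smul_apply, smul_eq_mul]; ring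

lemma bform_smul_right (a : R) (v w : Fin 5 → R) : bform v (a • w) = a * bform v w := by
  simp only [bform_eq, Pi.smul_apply, smul_eq_mul]; ring

lemma bform_neg_left (v w : Fin 5 → R) : bform (-v) w = -bform v w := by
  simp only [bform_eq, Pi.neg_apply]; ring

lemma bform_neg_right (v w : Fin 5 → R) : bform v (-w) = -bform v w := by
  simp only [bform_eq, Pi.neg_apply]; ring

lemma star_bform [StarRing R] (v w : Fin 5 → R) :
    star (bform v w) = bform (star v) (star w) := by
  simp only [bform_eq, star_add, star_neg, star_mul', Pi.star_apply]

/-- Expansion of a vector in a frame `Y, N, Z, Z'`, `n` whose only nonzero products are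
`⟨Y, N⟩ = -1`, `⟨Z, Z'⟩ = 1/2`, `⟨n, n⟩ = 1`. -/
lemma expand_in_frame {Y N Z Z' n : Fin 5 → R} (hYY : bform Y Y = 0) (hNN : bform N N = 0)
    (hYN : bform Y N = -1) (hYZ : bform Y Z = 0) (hYZ' : bform Y Z' = 0) (hNZ : bform N Z = 0)
    (hNZ' : bform N Z' = 0) (hZZ : bform Z Z = 0) (hZZ' : 2 * bform Z Z' = 1)
    (hZ'Z' : bform Z' Z' = 0) (hnn : bform n n = 1) (hnY : bform n Y = 0) (hnN : bform n N = 0)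
    (hnZ : bform n Z = 0) (hnZ' : bform n Z' = 0) (v : Fin 5 → R) :
    v = -(bform v N • Y) - bform v Y • N + (2 * bform v Z') • Z + (2 * bform v Z) • Z'
      + bform v n • n := by
  let E : Matrix (Fin 5) (Fin 5) R := Matrix.of ![Y, N, Z, Z', n]
  let J : Fin 5 → R := ![-1, 1, 1, 1, 1]
  -- The rows of `E'` are the dual frame, lowered by the form. A one-sided inverse of a square
  -- matrix is two-sided, so the frame spans without any dimension count.
  let E' : Matrix (Fin 5) (Fin 5) R :=
    Matrix.of fun a i => ![-N, -Y, (2 : R) • Z', (2 : R) • Z, n] a i * J i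
  have key : ∀ u w : Fin 5 → R, (∑ i, u i * J i * w i) = bform u w := by
    intro u w; simp only [Fin.sum_univ_five, bform_eq, J]; simp; ring
  have h1 : E' * E.transpose = 1 := by
    ext a b
    have : (E' * E.transpose) a b
        = bform (![-N, -Y, (2 : R) • Z', (2 : R) • Z, n] a) (![Y, N, Z, Z', n] b) := by
      rw [← key]; simp [Matrix.mul_apply, E, E']
    rw [this]
    have c1 := bform_comm N Y
    have c2 := bform_comm Z Y
    have c3 := bform_comm Z' Y
    have c4 := bform_comm Z N
    have c5 := bform_comm Z' N
    have c6 := bform_comm Z' Z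
    have c7 := bform_comm Y n
    have c8 := bform_comm N n
    have c9 := bform_comm Z n
    have c10 := bform_comm Z' n
    fin_cases a <;> fin_cases b <;>
      simp [bform_neg_left, bform_smul_left, *]
  have h2 : E.transpose * E' = 1 := mul_eq_one_comm.mp h1
  have h3 : (E.transpose * E').mulVec v = v := by rw [h2, Matrix.one_mulVec]
  rw [← Matrix.mulVec_mulVec] at h3
  have h4 : E'.mulVec v
      = ![-bform v N, -bform v Y, 2 * bform v Z', 2 * bform v Z, bform v n] := by
    ext a
    have : E'.mulVec v a = bform (![-N, -Y, (2 : R) • Z', (2 : R) • Z, n] a) v := by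
      rw [← key]; simp [Matrix.mulVec, dotProduct, E']
    rw [this, bform_comm]
    fin_cases a <;> simp [bform_neg_right, bform_smul_right]
  rw [h4] at h3
  conv_lhs => rw [← h3]
  ext i
  simp [Matrix.mulVec, dotProduct, Fin.sum_univ_five, E]
  ring

end BilinearForm

/-! ### Rings with Wirtinger derivations -/

/-- The number 2 is a unit because `R` is a `ℂ`-algebra. This stands in for division in a ring that
may have zero divisors. -/
lemma two_cancel {R : Type*} [CommRing R] [Algebra ℂ R] {a b : R} (h : 2 * a = 2 * b) : a = b := by
  have h2 : algebraMap ℂ R (1 / 2) * 2 = 1 := by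
    rw [← map_ofNat (algebraMap ℂ R) 2, ← map_mul]; norm_num
  calc a = algebraMap ℂ R (1 / 2) * (2 * a) := by rw [← mul_assoc, h2, one_mul]
    _ = algebraMap ℂ R (1 / 2) * (2 * b) := by rw [h]
    _ = b := by rw [← mul_assoc, h2, one_mul]

/-- Commuting derivations `∂_z`, `∂_z̄` of a ring with involution that are exchanged by it; the
involution is proper. -/
structure Wirtinger (R : Type*) [CommRing R] [StarRing R] [Algebra ℂ R] where
  /-- `∂_z` -/
  D : Derivation ℂ R R
  /-- `∂_z̄` -/
  D' : Derivation ℂ R R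
  comm : ∀ x, D (D' x) = D' (D x)
  star_D : ∀ x, star (D x) = D' (star x)
  eq_zero_of_mul_star : ∀ x : R, x * star x = 0 → x = 0

namespace Wirtinger

variable {R : Type*} [CommRing R] [StarRing R] [Algebra ℂ R] (W : Wirtinger R)

lemma star_D' (x : R) : star (W.D' x) = W.D (star x) := by
  rw [← star_star (W.D (star x)), W.star_D, star_star]

lemma D_mul (a b : R) : W.D (a * b) = W.D a * b + a * W.D b := by
  rw [Derivation.leibniz, smul_eq_mul, smul_eq_mul]; ring

lemma D'_mul (a b : R) : W.D' (a * b) = W.D' a * b + a * W.D' b := by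
  rw [Derivation.leibniz, smul_eq_mul, smul_eq_mul]; ring

lemma D_two : W.D 2 = 0 := W.D.map_natCast 2

lemma D'_two : W.D' 2 = 0 := W.D'.map_natCast 2

/-- `∂_z` of a vector. -/
def vD (v : Fin 5 → R) : Fin 5 → R := fun i => W.D (v i)

/-- `∂_z̄` of a vector. -/
def vD' (v : Fin 5 → R) : Fin 5 → R := fun i => W.D' (v i)

lemma D_bform (v w : Fin 5 → R) : W.D (bform v w) = bform (W.vD v) w + bform v (W.vD w) := by
  simp only [bform_eq, map_add, map_neg, W.D_mul, vD]; ring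

lemma D'_bform (v w : Fin 5 → R) :
    W.D' (bform v w) = bform (W.vD' v) w + bform v (W.vD' w) := by
  simp only [bform_eq, map_add, map_neg, W.D'_mul, vD']; ring

lemma vD_comm (v : Fin 5 → R) : W.vD (W.vD' v) = W.vD' (W.vD v) := by
  ext i; exact W.comm _

lemma star_vD (v : Fin 5 → R) : star (W.vD v) = W.vD' (star v) := by
  ext i; exact W.star_D _

lemma star_vD' (v : Fin 5 → R) : star (W.vD' v) = W.vD (star v) := by
  ext i; exact W.star_D' _

lemma vD_add (v w : Fin 5 → R) : W.vD (v + w) = W.vD v + W.vD w := by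
  ext i; simp [vD]

lemma vD'_add (v w : Fin 5 → R) : W.vD' (v + w) = W.vD' v + W.vD' w := by
  ext i; simp [vD']

lemma vD_sub (v w : Fin 5 → R) : W.vD (v - w) = W.vD v - W.vD w := by
  ext i; simp [vD]

lemma vD_smul (a : R) (v : Fin 5 → R) : W.vD (a • v) = W.D a • v + a • W.vD v := by
  ext i; simp [vD, W.D_mul]

lemma vD'_smul (a : R) (v : Fin 5 → R) : W.vD' (a • v) = W.D' a • v + a • W.vD' v := by
  ext i; simp [vD', W.D'_mul]

/-! ### Moving frames -/

/-- `Y` is a canonical lift: real, light-like, with `|dY|² = |dz|²`. -/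
structure IsLift (Y : Fin 5 → R) : Prop where
  star_Y : star Y = Y
  YY : bform Y Y = 0
  zz : bform (W.vD Y) (W.vD Y) = 0
  zzb : 2 * bform (W.vD Y) (W.vD' Y) = 1

/-- `Y` is a canonical lift and `n` a real unit normal of `span {Y, Y_z, Y_z̄, Y_{z z̄}}`. -/
structure IsFrame (Y n : Fin 5 → R) : Prop extends W.IsLift Y where
  star_n : star n = n
  nn : bform n n = 1
  nY : bform n Y = 0
  nz : bform n (W.vD Y) = 0
  nzzb : bform n (W.vD (W.vD' Y)) = 0

/-- The second light-like vector of the mean curvature sphere. -/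
def conj_lift (Y : Fin 5 → R) : Fin 5 → R :=
  (2 : R) • W.vD (W.vD' Y) + (2 * bform (W.vD (W.vD' Y)) (W.vD (W.vD' Y))) • Y

/-- The component of `v` orthogonal to the mean curvature sphere. -/
def normalProj (Y v : Fin 5 → R) : Fin 5 → R :=
  v + bform v (W.conj_lift Y) • Y + bform v Y • W.conj_lift Y
    - (2 * bform v (W.vD' Y)) • W.vD Y - (2 * bform v (W.vD Y)) • W.vD' Y

/-- The coefficient of the Hopfian. -/
def hopfCoeff (Y n : Fin 5 → R) : R := bform (W.vD (W.vD Y)) n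

/-- The Schwarzian. -/
def schw (Y : Fin 5 → R) : R := 2 * bform (W.vD (W.vD Y)) (W.conj_lift Y)

namespace IsLift

variable {W} {Y : Fin 5 → R} (h : W.IsLift Y)
include h

/-- All products of `Y`, its derivatives and `N` follow from the normalisation by differentiating a
known product or conjugating it. -/
lemma zbzb : bform (W.vD' Y) (W.vD' Y) = 0 := by
  have := congrArg star h.zz
  rwa [star_bform, W.star_vD, h.star_Y, star_zero] at this

lemma Yz : bform Y (W.vD Y) = 0 := by
  have := congrArg W.D h.YY
  rw [W.D_bform, bform_comm (W.vD Y), map_zero] at this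
  exact two_cancel (by linear_combination this)

lemma Yzb : bform Y (W.vD' Y) = 0 := by
  have := congrArg star h.Yz
  rwa [star_bform, W.star_vD, h.star_Y, star_zero] at this

lemma Y_zzb : 2 * bform Y (W.vD (W.vD' Y)) = -1 := by
  have := congrArg W.D h.Yzb
  rw [W.D_bform, map_zero] at this
  linear_combination 2 * this - h.zzb

lemma zb_zzb : bform (W.vD' Y) (W.vD (W.vD' Y)) = 0 := by
  have := congrArg W.D h.zbzb
  rw [W.D_bform, bform_comm (W.vD (W.vD' Y)), map_zero] at this
  exact two_cancel (by linear_combination this)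

lemma z_zzb : bform (W.vD Y) (W.vD (W.vD' Y)) = 0 := by
  have := congrArg star h.zb_zzb
  rwa [star_bform, W.star_vD', W.star_vD, W.star_vD', h.star_Y, star_zero, ← W.vD_comm] at this

lemma star_zzb : star (W.vD (W.vD' Y)) = W.vD (W.vD' Y) := by
  rw [W.star_vD, W.star_vD', h.star_Y, W.vD_comm]

lemma star_N : star (W.conj_lift Y) = W.conj_lift Y := by
  have h1 := h.star_zzb
  rw [conj_lift, star_add, star_smul, star_smul, h1, h.star_Y, star_mul', star_bform, h1]
  simp

lemma YN : bform Y (W.conj_lift Y) = -1 := by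
  rw [conj_lift, bform_add_right, bform_smul_right, bform_smul_right, h.YY, h.Y_zzb]; ring

lemma zN : bform (W.vD Y) (W.conj_lift Y) = 0 := by
  rw [conj_lift, bform_add_right, bform_smul_right, bform_smul_right, bform_comm _ Y, h.Yz,
    h.z_zzb]; ring

lemma zbN : bform (W.vD' Y) (W.conj_lift Y) = 0 := by
  rw [conj_lift, bform_add_right, bform_smul_right, bform_smul_right, bform_comm _ Y, h.Yzb,
    h.zb_zzb]; ring

lemma NN : bform (W.conj_lift Y) (W.conj_lift Y) = 0 := by
  have h1 := h.YN
  have h2 := h.Y_zzb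
  have h3 := h.YY
  rw [conj_lift] at *
  simp only [bform_add_right, bform_add_left, bform_smul_left, bform_smul_right,
    bform_comm _ Y] at *
  linear_combination
    4 * bform (W.vD (W.vD' Y)) (W.vD (W.vD' Y)) * h2
    + 4 * bform (W.vD (W.vD' Y)) (W.vD (W.vD' Y)) ^ 2 * h3

lemma Y_DDY : bform Y (W.vD (W.vD Y)) = 0 := by
  have := congrArg W.D h.Yz
  rw [W.D_bform, h.zz, map_zero] at this
  linear_combination this

lemma z_DDY : bform (W.vD Y) (W.vD (W.vD Y)) = 0 := by
  have := congrArg W.D h.zz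
  rw [W.D_bform, bform_comm (W.vD (W.vD Y)), map_zero] at this
  exact two_cancel (by linear_combination this)

lemma zb_DDY : bform (W.vD' Y) (W.vD (W.vD Y)) = 0 := by
  have := congrArg W.D h.zzb
  rw [W.D_mul, W.D_bform, W.D_two, h.z_zzb, Derivation.map_one_eq_zero, bform_comm (W.vD (W.vD Y))] at this
  exact two_cancel (by linear_combination this)

omit h in
lemma two_zzb : (2 : R) • W.vD (W.vD' Y)
    = W.conj_lift Y - (2 * bform (W.vD (W.vD' Y)) (W.vD (W.vD' Y))) • Y := by
  rw [conj_lift]; abel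

lemma normalProj_Y (v : Fin 5 → R) : bform (W.normalProj Y v) Y = 0 := by
  rw [bform_comm]
  simp only [normalProj, bform_add_right, bform_sub_right, bform_smul_right, h.YY, h.YN, h.Yz,
    h.Yzb]
  rw [bform_comm v Y]; ring

lemma normalProj_z (v : Fin 5 → R) : bform (W.normalProj Y v) (W.vD Y) = 0 := by
  rw [bform_comm]
  simp only [normalProj, bform_add_right, bform_sub_right, bform_smul_right, h.zz, h.zN]
  rw [bform_comm (W.vD Y) Y, h.Yz, bform_comm v (W.vD Y)]
  linear_combination (-bform (W.vD Y) v) * h.zzb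

lemma normalProj_zb (v : Fin 5 → R) : bform (W.normalProj Y v) (W.vD' Y) = 0 := by
  simp only [normalProj, bform_add_left, bform_sub_left, bform_smul_left,
    bform_comm (W.conj_lift Y), h.zbzb, h.zbN, h.Yzb]
  linear_combination (-bform v (W.vD' Y)) * h.zzb

lemma normalProj_N (v : Fin 5 → R) : bform (W.normalProj Y v) (W.conj_lift Y) = 0 := by
  simp only [normalProj, bform_add_left, bform_sub_left, bform_smul_left,
    h.NN, h.zbN, h.zN, h.YN]
  ring

lemma normalProj_zzb (v : Fin 5 → R) : bform (W.normalProj Y v) (W.vD (W.vD' Y)) = 0 := by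
  have := congrArg (bform (W.normalProj Y v)) (two_zzb (W := W) (Y := Y))
  rw [bform_smul_right, bform_sub_right, bform_smul_right, h.normalProj_N, h.normalProj_Y] at this
  exact two_cancel (by linear_combination this)

lemma isFrame_smul {ν : Fin 5 → R} {x : R} (hν : star ν = ν) (hY : bform ν Y = 0)
    (hz : bform ν (W.vD Y) = 0) (hN : bform ν (W.vD (W.vD' Y)) = 0) (hx : star x = x)
    (hxx : x * x * bform ν ν = 1) : W.IsFrame Y (x • ν) := by
  refine ⟨h, by rw [star_smul, hx, hν], ?_, ?_, ?_, ?_⟩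
  · rw [bform_smul_left, bform_smul_right]; linear_combination hxx
  · rw [bform_smul_left, hY, mul_zero]
  · rw [bform_smul_left, hz, mul_zero]
  · rw [bform_smul_left, hN, mul_zero]

/-- The real part of a multiple of the normal component of a vector. -/
lemma exists_real_normal (c : R) (v : Fin 5 → R) :
    ∃ ν, ν = c • W.normalProj Y v + star (c • W.normalProj Y v) ∧ star ν = ν ∧ bform ν Y = 0 ∧
      bform ν (W.vD Y) = 0 ∧ bform ν (W.vD (W.vD' Y)) = 0 := by
  have e : ∀ w w' : Fin 5 → R, star w = w' → bform (W.normalProj Y v) w = 0 →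
      bform (star (c • W.normalProj Y v)) w' = 0 := by
    rintro w _ rfl h0
    rw [← star_bform, bform_smul_left, h0, mul_zero, star_zero]
  refine ⟨_, rfl, by rw [star_add, star_star, add_comm], ?_, ?_, ?_⟩
  · rw [bform_add_left, bform_smul_left, h.normalProj_Y, e _ _ h.star_Y (h.normalProj_Y v)]; ring
  · rw [bform_add_left, bform_smul_left, h.normalProj_z,
      e _ _ (by rw [W.star_vD', h.star_Y]) (h.normalProj_zb v)]; ring
  · rw [bform_add_left, bform_smul_left, h.normalProj_zzb,
      e _ _ h.star_zzb (h.normalProj_zzb v)]; ring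

end IsLift

namespace IsFrame

variable {W} {Y n : Fin 5 → R} (h : W.IsFrame Y n)
include h

lemma nzb : bform n (W.vD' Y) = 0 := by
  have := congrArg star h.nz
  rwa [star_bform, W.star_vD, h.star_Y, h.star_n, star_zero] at this

lemma nN : bform n (W.conj_lift Y) = 0 := by
  rw [conj_lift, bform_add_right, bform_smul_right, bform_smul_right, h.nY, h.nzzb]; ring

lemma expand (v : Fin 5 → R) :
    v = -(bform v (W.conj_lift Y) • Y) - bform v Y • W.conj_lift Y
      + (2 * bform v (W.vD' Y)) • W.vD Y + (2 * bform v (W.vD Y)) • W.vD' Y + bform v n • n :=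
  expand_in_frame h.YY h.NN h.YN h.Yz h.Yzb (by rw [bform_comm, h.zN]) (by rw [bform_comm, h.zbN])
    h.zz h.zzb h.zbzb h.nn h.nY h.nN h.nz h.nzb v

lemma two_DDY :
    (2 : R) • W.vD (W.vD Y) = -(W.schw Y • Y) + (2 * W.hopfCoeff Y n) • n := by
  have := h.expand (W.vD (W.vD Y))
  rw [bform_comm _ Y, bform_comm _ (W.vD Y), bform_comm _ (W.vD' Y), h.Y_DDY, h.z_DDY,
    h.zb_DDY] at this
  rw [this]
  ext i
  rw [schw, hopfCoeff]
  simp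
  ring

lemma n_Dn : bform (W.vD' n) n = 0 := by
  have := congrArg W.D' h.nn
  rw [W.D'_bform, bform_comm n, Derivation.map_one_eq_zero] at this
  exact two_cancel (by linear_combination this)

lemma star_hopfCoeff : star (W.hopfCoeff Y n) = bform (W.vD' (W.vD' Y)) n := by
  rw [hopfCoeff, star_bform, W.star_vD, W.star_vD, h.star_Y, h.star_n]

/-- The components of `n_z̄` are read off by differentiating the orthogonality relations of `n`.
Only the one along `Y` stays open until the Codazzi equation. -/
lemma Dbn : W.vD' n = -(bform (W.vD' n) (W.conj_lift Y) • Y)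
    - (2 * star (W.hopfCoeff Y n)) • W.vD Y := by
  have e1 : bform (W.vD' n) Y = 0 := by
    have := congrArg W.D' h.nY
    rw [W.D'_bform, h.nzb, map_zero] at this
    linear_combination this
  have e2 : bform (W.vD' n) (W.vD Y) = 0 := by
    have := congrArg W.D' h.nz
    rw [W.D'_bform, ← W.vD_comm, h.nzzb, map_zero] at this
    linear_combination this
  have e3 : bform (W.vD' n) (W.vD' Y) = -star (W.hopfCoeff Y n) := by
    have := congrArg W.D' h.nzb
    rw [W.D'_bform, map_zero] at this
    rw [h.star_hopfCoeff, bform_comm _ n]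
    linear_combination this
  have := h.expand (W.vD' n)
  rw [e1, e2, e3, h.n_Dn] at this
  conv_lhs => rw [this]
  ext i; simp; ring

-- The vector `2 Y_{zzz̄}` is computed here from `Y_{zz̄}`, and in `two_DDbY_D'` from `Y_{zz}`.
-- Pairing the two expressions with `Y_z̄`, `n` and `N` gives the Gauss, Codazzi and conformal Gauss
-- equations.
omit h in
lemma two_DDbY_D :
    (2 : R) • W.vD (W.vD (W.vD' Y)) = W.vD (W.conj_lift Y)
      - (2 * W.D (bform (W.vD (W.vD' Y)) (W.vD (W.vD' Y)))) • Y
      - (2 * bform (W.vD (W.vD' Y)) (W.vD (W.vD' Y))) • W.vD Y := by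
  have := congrArg W.vD (IsLift.two_zzb (W := W) (Y := Y))
  rw [W.vD_smul, W.D_two, W.vD_sub, W.vD_smul, W.D_mul, W.D_two] at this
  simp only [zero_smul, zero_add, zero_mul] at this
  rw [this]; abel

lemma two_DDbY_D' :
    (2 : R) • W.vD (W.vD (W.vD' Y)) = -(W.D' (W.schw Y) • Y) - W.schw Y • W.vD' Y
      + (2 * W.D' (W.hopfCoeff Y n)) • n + (2 * W.hopfCoeff Y n) • W.vD' n := by
  have := congrArg W.vD' h.two_DDY
  have hn : ∀ v : Fin 5 → R, W.vD' (-v) = -W.vD' v := fun v => by ext i; simp [vD']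
  rw [W.vD'_smul, W.D'_two, W.vD'_add, hn, W.vD'_smul, W.vD'_smul, W.D'_mul, W.D'_two,
    ← W.vD_comm, ← W.vD_comm] at this
  simp only [zero_smul, zero_add, zero_mul] at this
  rw [this]; abel

/-- The Gauss equation `⟨Y_{z z̄}, Y_{z z̄}⟩ = ⟨κ, κ̄⟩`. -/
lemma gauss : bform (W.vD (W.vD' Y)) (W.vD (W.vD' Y))
    = W.hopfCoeff Y n * star (W.hopfCoeff Y n) := by
  have e := congrArg (fun v => bform v (W.vD' Y)) ((two_DDbY_D (W := W) (Y := Y)).symm.trans h.two_DDbY_D')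
  have e4 : 2 * bform (W.vD (W.conj_lift Y)) (W.vD' Y)
      = -2 * bform (W.vD (W.vD' Y)) (W.vD (W.vD' Y)) := by
    have := congrArg W.D h.zbN
    rw [W.D_bform, map_zero] at this
    have e5 : bform (W.vD (W.vD' Y)) (W.conj_lift Y)
        = bform (W.vD (W.vD' Y)) (W.vD (W.vD' Y)) := by
      rw [conj_lift, bform_add_right, bform_smul_right, bform_smul_right, bform_comm _ Y]
      linear_combination bform (W.vD (W.vD' Y)) (W.vD (W.vD' Y)) * h.Y_zzb
    rw [bform_comm]
    linear_combination 2 * this - 2 * e5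
  have e6 : bform (W.vD' n) (W.vD' Y) = -star (W.hopfCoeff Y n) := by
    have := congrArg W.D' h.nzb
    rw [W.D'_bform, map_zero] at this
    rw [h.star_hopfCoeff, bform_comm _ n]
    linear_combination this
  simp only [bform_add_left, bform_sub_left, bform_neg_left, bform_smul_left, h.Yzb, h.zbzb, h.nzb,
    e6] at e
  apply two_cancel
  apply two_cancel
  linear_combination e4 - 2 * e - 2 * bform (W.vD (W.vD' Y)) (W.vD (W.vD' Y)) * h.zzb

/-- The Codazzi equation. -/
lemma codazzi : bform (W.vD (W.conj_lift Y)) n = 2 * W.D' (W.hopfCoeff Y n) := by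
  have e := congrArg (fun v => bform v n) ((two_DDbY_D (W := W) (Y := Y)).symm.trans h.two_DDbY_D')
  simp only [bform_add_left, bform_sub_left, bform_neg_left, bform_smul_left, bform_comm Y n,
    bform_comm (W.vD Y) n, bform_comm (W.vD' Y) n, h.nY, h.nz, h.nzb, h.nn, h.n_Dn] at e
  linear_combination e

lemma vDb_n : W.vD' n = (2 * W.D (star (W.hopfCoeff Y n))) • Y
    - (2 * star (W.hopfCoeff Y n)) • W.vD Y := by
  have e := h.Dbn
  have e1 : bform (W.vD' n) (W.conj_lift Y) = -(2 * W.D (star (W.hopfCoeff Y n))) := by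
    have := congrArg W.D' h.nN
    rw [W.D'_bform, map_zero] at this
    have e2 := congrArg star h.codazzi
    rw [star_bform, W.star_vD, h.star_N, h.star_n, star_mul', W.star_D', bform_comm] at e2
    simp only [star_ofNat] at e2
    linear_combination this - e2
  rw [e1] at e
  rw [e]; ext i; simp

/-- The conformal Gauss equation. -/
lemma conformalGauss : W.D' (W.schw Y)
    = 6 * W.hopfCoeff Y n * W.D (star (W.hopfCoeff Y n))
      + 2 * W.D (W.hopfCoeff Y n) * star (W.hopfCoeff Y n) := by
  have e := congrArg (fun v => bform v (W.conj_lift Y))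
    ((two_DDbY_D (W := W) (Y := Y)).symm.trans h.two_DDbY_D')
  have e1 : bform (W.vD (W.conj_lift Y)) (W.conj_lift Y) = 0 := by
    have := congrArg W.D h.NN
    rw [W.D_bform, bform_comm (W.conj_lift Y), map_zero] at this
    exact two_cancel (by linear_combination this)
  rw [h.vDb_n, h.gauss, W.D_mul] at e
  simp only [bform_add_left, bform_sub_left, bform_neg_left, bform_smul_left, h.YN, h.zN, h.zbN,
    h.nN, e1] at e
  linear_combination -e

end IsFrame

end Wirtinger

end

/-! ### Consequences of the Willmore equation for the Hopf coefficient -/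

section

namespace Wirtinger

variable {R : Type*} [CommRing R] [StarRing R] [Algebra ℂ R] (W : Wirtinger R)

include W in
-- If `x² = 0`, then `x x*` is annihilated by its own conjugate, so properness of the involution
-- applies twice.
lemma isReduced : IsReduced R := by
  rw [isReduced_iff_pow_one_lt 2 (by norm_num)]
  intro x hx
  apply W.eq_zero_of_mul_star
  apply W.eq_zero_of_mul_star
  rw [star_mul', star_star]
  linear_combination star x ^ 2 * hx

/-! ### Logarithmic derivatives of the Hopfian -/

/-- `k` is a unit with `k_z = χ k` and `k_z̄ = θ k`. -/
structure LogDeriv (k χ θ : R) : Prop where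
  unit : IsUnit k
  D : W.D k = χ * k
  D' : W.D' k = θ * k

namespace LogDeriv

variable {W} {k χ θ : R} (h : W.LogDeriv k χ θ)
include h

lemma D_star : W.D (star k) = star θ * star k := by
  rw [← W.star_D', h.D', star_mul']

lemma D'_star : W.D' (star k) = star χ * star k := by
  rw [← W.star_D, h.D, star_mul']

/-- Both sides are `(log k)_{zz̄}`; no logarithm is needed because `k` is a unit. -/
lemma D_theta : W.D θ = W.D' χ := by
  have := W.comm k
  rw [h.D, h.D', W.D_mul, W.D'_mul, h.D, h.D'] at this
  exact h.unit.mul_right_cancel (by linear_combination this)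

omit h in
lemma D'_star_theta : W.D' (star θ) = star (W.D θ) := (W.star_D θ).symm

lemma D_star_chi : W.D (star χ) = star (W.D θ) := by
  rw [h.D_theta, W.star_D']

/-- `ρ_z̄ = μ̄ ρ`, from the Willmore and the conformal Gauss equations. -/
lemma D'_rho {s : R} (hW : 2 * W.D' (W.D' k) + star s * k = 0)
    (hG : W.D' s = 6 * k * W.D (star k) + 2 * W.D k * star k) :
    W.D' (2 * W.D θ + 2 * (k * star k)) = -2 * θ * (2 * W.D θ + 2 * (k * star k)) := by
  -- The Willmore equation divided by `k`. Its `z`-derivative, compared with the conjugate of the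
  -- conformal Gauss equation, is the claim.
  have e1 : star s = -2 * (W.D' θ + θ * θ) := by
    rw [h.D', W.D'_mul, h.D'] at hW
    exact h.unit.mul_right_cancel (by linear_combination hW)
  have e2 := congrArg W.D e1
  have e3 : W.D (star s) = 6 * star k * W.D' k + 2 * W.D' (star k) * k := by
    have := congrArg star hG
    simp only [star_add, star_mul', W.star_D', W.star_D, star_star, star_ofNat] at this
    exact this
  rw [e3, h.D'_star, h.D'] at e2
  have hm : W.D (-2 : R) = 0 := by rw [map_neg, W.D_two, neg_zero]
  rw [W.D_mul, hm, map_add, W.D_mul, W.comm] at e2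
  rw [map_add, W.D'_mul, W.D'_mul, W.D'_mul, W.D'_two, h.D', h.D'_star]
  linear_combination e2

/-- If `|ρ|² = c |κ|⁴` with `c ≠ 0` constant then `(log |k|²)_{z z̄} = 0`. -/
lemma re_D_theta_eq_zero {ρ c : R} (hρ : IsUnit ρ) (hc : W.D c = 0)
    (hD : W.D' ρ = -2 * θ * ρ) (habs : ρ * star ρ = c * (k * star k) * (k * star k)) :
    W.D θ + star (W.D θ) = 0 := by
  have hD2 : W.D (star ρ) = -2 * star θ * star ρ := by
    rw [← W.star_D', hD, star_mul', star_mul', star_neg, star_ofNat]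
  -- The logarithmic `z`-derivative of `|ρ|² = c |k|⁴`, in which that of `ρ̄` is already known to be
  -- `-2 θ̄`.
  have e1 : W.D ρ = (4 * star θ + 2 * χ) * ρ := by
    have := congrArg W.D habs
    simp only [W.D_mul, hc, hD2, h.D, h.D_star] at this
    exact hρ.star.mul_right_cancel (by linear_combination this - 2 * (χ + star θ) * habs)
  -- Comparing `(log ρ)_{zz̄}` both ways: `-2 θ_z = 4 (θ_z)* + 2 θ_z`.
  have e2 := W.comm ρ
  have h4 : W.D' (4 : R) = 0 := W.D'.map_natCast 4
  have hm : W.D (-2 : R) = 0 := by rw [map_neg, W.D_two, neg_zero]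
  rw [hD, e1] at e2
  simp only [W.D_mul, W.D'_mul, map_add, hm, e1, hD, h4, W.D'_two, ← h.D_theta,
    D'_star_theta (W := W)] at e2
  have e3 : (2 * (W.D θ + star (W.D θ))) * ρ = (2 * 0) * ρ := by
    apply two_cancel
    linear_combination -e2
  exact two_cancel (hρ.mul_right_cancel e3)

/-- If `(log |k|²)_{z z̄} = 0` then `(log k)_{z z̄} = 0` and `|k| k` is holomorphic. -/
lemma flat (hD : W.D' (2 * W.D θ + 2 * (k * star k)) =
      -2 * θ * (2 * W.D θ + 2 * (k * star k)))
    (hflat : W.D θ + star (W.D θ) = 0) :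
    W.D θ = 0 ∧ χ = -3 * star θ := by
  obtain ⟨t, ht⟩ : ∃ t, t = W.D θ := ⟨_, rfl⟩
  obtain ⟨b, hb⟩ : ∃ b, b = star θ := ⟨_, rfl⟩
  obtain ⟨x, hx⟩ : ∃ x, x = star χ := ⟨_, rfl⟩
  obtain ⟨l, hl⟩ : ∃ l, l = k * star k := ⟨_, rfl⟩
  have sl : star l = l := by rw [hl, star_mul', star_star, mul_comm]
  have st : star t = -t := by rw [ht]; linear_combination hflat
  have sb : star b = θ := by rw [hb, star_star]
  have sx : star x = χ := by rw [hx, star_star]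
  have ul : IsUnit l := hl ▸ h.unit.mul h.unit.star
  -- This is `ρ_z̄ = μ̄ ρ` solved for `t_z̄`. Since `t` is imaginary, conjugation then gives `t_z`,
  -- and the system for `t` is overdetermined.
  have D't : W.D' t = -l * (3 * θ + x) - 2 * θ * t := by
    rw [← ht, ← hl, map_add, W.D'_mul, W.D'_mul, W.D'_two, hl, W.D'_mul, h.D', h.D'_star,
      ← hx] at hD
    apply two_cancel
    rw [hl]
    linear_combination hD
  have Dt : W.D t = l * (3 * b + χ) - 2 * b * t := by
    have := congrArg star D't
    simp only [W.star_D', star_sub, star_mul', star_neg, star_add, star_ofNat, st, sl, sx, map_neg,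
      ← hb] at this
    linear_combination -this
  have Dl : W.D l = (χ + b) * l := by
    rw [hl, W.D_mul, h.D, h.D_star, ← hb]; ring
  have D'l : W.D' l = (x + θ) * l := by
    rw [hl, W.D'_mul, h.D', h.D'_star, ← hx]; ring
  have D'b : W.D' b = -t := by rw [hb, D'_star_theta (W := W), ← ht, st]
  have Dx : W.D x = -t := by rw [hx, h.D_star_chi, ← ht, st]
  have D'χ : W.D' χ = t := by rw [← h.D_theta, ht]
  have h3 : W.D (3 : R) = 0 := W.D.map_natCast 3
  have h3' : W.D' (3 : R) = 0 := W.D'.map_natCast 3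
  -- The compatibility condition `t_{z̄z} = t_{zz̄}`. With `e = 3 θ̄ + χ` it reads `|e|² |k|² = 2
  -- |t|²`, so it remains to show that `t` vanishes.
  have hE : (3 * b + χ) * (3 * θ + x) * l = -2 * t * t := by
    have := W.comm t
    rw [D't, Dt] at this
    simp only [map_sub, map_add, map_neg, W.D_mul, W.D'_mul, h3, h3', W.D_two, W.D'_two, Dl, D'l,
      D'b, Dx, D'χ, Dt, D't, ← ht] at this
    apply two_cancel
    linear_combination -this
  obtain ⟨e, he⟩ : ∃ e, e = 3 * b + χ := ⟨_, rfl⟩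
  obtain ⟨f, hf⟩ : ∃ f, f = 3 * θ + x := ⟨_, rfl⟩
  have se : star e = f := by
    rw [he, hf, star_add, star_mul', star_ofNat, sb, hx]
  have D'e : W.D' e = -2 * t := by
    rw [he, map_add, W.D'_mul, h3', D'b, D'χ]; ring
  have Df : W.D f = 2 * t := by
    rw [hf, map_add, W.D_mul, h3, ← ht, Dx]; ring
  rw [← he, ← hf] at hE
  rw [← he] at Dt
  rw [← hf] at D't
  -- The `z`-derivative of `hE`, multiplied by `e` so that `hE` itself eliminates `f = ē`. It
  -- expresses `t² e_z` without new unknowns.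
  have hH : t * t * W.D e = 3 * t * l * e * e - t * t * e * (χ + 5 * b) := by
    have := congrArg W.D hE
    simp only [map_neg, W.D_mul, W.D_two, Dl, Df, Dt] at this
    apply two_cancel
    linear_combination (-e) * this + (W.D e + e * (χ + b)) * hE
  have h5 : W.D' (5 : R) = 0 := W.D'.map_natCast 5
  have hK := congrArg W.D' hH
  simp only [map_sub, map_add, W.D'_mul, h3', h5, D't, D'e, D'χ, D'b, D'l, ← W.comm, map_neg,
    W.D_two, Dt, W.D_mul] at hK
  -- In the `z̄`-derivative of `hH`, the term `e_{zz̄}` is known from `e_z̄ = -2t`. Eliminating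
  -- `e_z` by `hH` and `f` by `hE` leaves a single monomial.
  have h16 : (16 : R) * (t * t * t * e * l) = 16 * 0 := by
    linear_combination t * hK - 2 * (-l * f - 2 * θ * t) * hH
      + (3 * t * l * e + 3 * t * t * e) * hE - 2 * t ^ 4 * he - 3 * t ^ 2 * l * e ^ 2 * hf
  have hte : t * t * t * e * l = 0 := by
    refine two_cancel (two_cancel (two_cancel (two_cancel ?_)))
    linear_combination h16
  have ht5 : t ^ 5 = 0 := by
    refine two_cancel ?_
    linear_combination t ^ 3 * hE - f * hte
  have := W.isReduced
  have ht0 : t = 0 := pow_eq_zero_iff (by norm_num) |>.mp ht5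
  refine ⟨by rw [← ht, ht0], ?_⟩
  have he0 : e = 0 := by
    apply W.eq_zero_of_mul_star
    rw [se]
    apply ul.mul_right_cancel
    rw [hE, ht0]; ring
  linear_combination he0 - he - 3 * hb

end LogDeriv
end Wirtinger

end

/-! ### Flat frames, the Clifford torus, and change of coordinate -/

section

namespace Wirtinger

variable {R : Type*} [CommRing R] [StarRing R] [Algebra ℂ R] (W : Wirtinger R)

/-! ### Flat frames -/

/-- The structure equations of the Clifford torus in the coordinate `w` with `dw = q dz`, where
`A = Y_w` and `L = Y_{w w̄}`. -/
structure FlatFrame (q : R) (Y n A L : Fin 5 → R) : Prop where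
  star_Y : star Y = Y
  star_n : star n = n
  star_L : star L = L
  D_Y : W.vD Y = q • A
  D_A : W.vD A = q • n
  D_n : W.vD n = -(2 * q) • star A
  D_star_A : W.vD (star A) = q • L
  D_L : W.vD L = -(2 * q) • A
  YY : bform Y Y = 0
  YA : bform Y A = 0
  AA : bform A A = 0
  AA' : 2 * bform A (star A) = 1
  nn : bform n n = 1
  nY : bform n Y = 0
  nA : bform n A = 0
  nL : bform n L = 0
  LL : bform L L = 1
  LA : bform L A = 0
  LY : 2 * bform L Y = -1

namespace FlatFrame

variable {W} {q : R} {Y n A L : Fin 5 → R} (h : W.FlatFrame q Y n A L)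
include h

/-- With `X = ⟨v, n + L⟩` and `Z = ⟨v, A + Ā⟩` the system gives `X_w = -2Z` and `Z_w = X`, so `X² +
2Z²` is conserved. In `D_second` the differences obey `X_w = 2Z`, `Z_w = X`, which conserves `X² -
2Z²`. -/
lemma D_first {v : Fin 5 → R} (hv : W.vD v = 0) :
    W.D (bform v (n + L) * bform v (n + L) + 2 * (bform v (A + star A) * bform v (A + star A)))
      = 0 := by
  have h0 : ∀ w : Fin 5 → R, bform 0 w = 0 := fun w => by simp [bform_eq]
  simp only [map_add, W.D_mul, W.D_bform, hv, h.D_n, h.D_L, h.D_A, h.D_star_A, W.D_two,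
    bform_add_right, bform_smul_right, h0]
  ring

lemma D_second {v : Fin 5 → R} (hv : W.vD v = 0) :
    W.D (bform v (n - L) * bform v (n - L) - 2 * (bform v (A - star A) * bform v (A - star A)))
      = 0 := by
  have h0 : ∀ w : Fin 5 → R, bform 0 w = 0 := fun w => by simp [bform_eq]
  simp only [map_sub, W.D_mul, W.D_bform, hv, h.D_n, h.D_L, h.D_A, h.D_star_A, W.D_two,
    bform_sub_right, bform_smul_right, h0]
  ring

end FlatFrame

/-- A Willmore surface with `𝒫 = -2` carries a flat frame. -/
lemma IsFrame.exists_flatFrame {W : Wirtinger R} {Y n : Fin 5 → R} (h : W.IsFrame Y n)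
    {χ θ r q : R} (hk : W.LogDeriv (W.hopfCoeff Y n) χ θ)
    (hW : 2 * W.D' (W.D' (W.hopfCoeff Y n)) + star (W.schw Y) * W.hopfCoeff Y n = 0)
    (hθ : W.D θ = 0) (hχ : χ = -3 * star θ) (hr : star r = r)
    (hrr : r * r = W.hopfCoeff Y n * star (W.hopfCoeff Y n))
    (hqq : q * q = r * W.hopfCoeff Y n) (hq : q * star q = r * r) :
    ∃ A L, W.FlatFrame q (r • Y) n A L := by
  have hbn := h.vDb_n
  have hDDY := h.two_DDY
  generalize W.hopfCoeff Y n = k at *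
  generalize W.schw Y = s at *
  -- `p` is `r_z / r`, because `2 r_z / r = χ + θ̄ = -2 θ̄`.
  obtain ⟨p, hp⟩ : ∃ p, p = -star θ := ⟨_, rfl⟩
  have sp : star p = -θ := by rw [hp, star_neg, star_star]
  have urr : IsUnit (r * r) := hrr ▸ hk.unit.mul hk.unit.star
  have ur : IsUnit r := isUnit_of_mul_isUnit_left urr
  have uq : IsUnit q := isUnit_of_mul_isUnit_left (hq ▸ urr)
  have usq : IsUnit (star q) := uq.star
  have Dr : W.D r = p * r := by
    have := congrArg W.D hrr
    rw [W.D_mul, W.D_mul, hk.D, hk.D_star, hχ] at this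
    refine two_cancel (ur.mul_right_cancel ?_)
    linear_combination this + 2 * star θ * hrr - 2 * r * r * hp
  have D'r : W.D' r = star p * r := by rw [← hr, ← W.star_D, Dr, star_mul', hr]
  have Dq : W.D q = 2 * p * q := by
    have := congrArg W.D hqq
    rw [W.D_mul, W.D_mul, hk.D, Dr, hχ] at this
    refine two_cancel (uq.mul_right_cancel ?_)
    linear_combination this - 4 * p * hqq - 3 * r * k * hp
  have D'q : W.D' q = 0 := by
    have := congrArg W.D' hqq
    rw [W.D'_mul, W.D'_mul, hk.D', D'r, sp] at this
    refine two_cancel (uq.mul_right_cancel ?_)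
    linear_combination this
  have D'p : W.D' p = 0 := by rw [hp, map_neg, ← W.star_D, hθ]; simp
  -- The Willmore equation determines the Schwarzian. This value is exactly what cancels the
  -- `Y`-component of `A_w`.
  have hs : s = 2 * W.D p - 2 * p * p := by
    have e1 : star s = -2 * (W.D' θ + θ * θ) := by
      rw [hk.D', W.D'_mul, hk.D'] at hW
      exact hk.unit.mul_right_cancel (by linear_combination hW)
    have := congrArg star e1
    rw [star_star, star_mul', star_neg, star_ofNat, star_add, star_mul', W.star_D'] at this
    rw [this, hp, map_neg]; ring
  obtain ⟨qi, hqi⟩ : ∃ qi, q * qi = 1 := uq.exists_right_inv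
  have sqi : star q * star qi = 1 := by rw [← star_mul', hqi, star_one]
  have D'qi : W.D' qi = 0 := by
    have := congrArg W.D' hqi
    rw [W.D'_mul, D'q, Derivation.map_one_eq_zero] at this
    exact uq.mul_left_cancel (by linear_combination this)
  have Dqi : W.D qi = -2 * p * qi := by
    have := congrArg W.D hqi
    rw [W.D_mul, Dq, Derivation.map_one_eq_zero] at this
    exact uq.mul_left_cancel (by linear_combination this)
  have Dsqi : W.D (star qi) = 0 := by rw [← W.star_D', D'qi, star_zero]
  -- `A = q⁻¹ (rY)_z`, the `w`-derivative of the rescaled lift `rY`.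
  obtain ⟨A, hA⟩ : ∃ A : Fin 5 → R, A = (qi * r) • (W.vD Y + p • Y) := ⟨_, rfl⟩
  have DY : W.vD (r • Y) = q • A := by
    rw [hA, W.vD_smul, Dr]
    ext i; simp; linear_combination (-(r * (W.vD Y i + p * Y i))) * hqi
  have DA : W.vD A = q • n := by
    have e : W.vD (W.vD Y) = -((W.D p - p * p) • Y) + k • n := by
      ext i
      have := congrFun hDDY i
      simp [hs] at this ⊢
      exact two_cancel (by linear_combination this)
    rw [hA, W.vD_smul, W.D_mul, Dqi, Dr, W.vD_add, e, W.vD_smul]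
    ext i; simp; linear_combination (-(qi * n i)) * hqq + (q * n i) * hqi
  have D'n : W.vD' n = -(2 * star q) • A := by
    have e1 : star q * star q = r * star k := by
      rw [← star_mul', hqq, star_mul', hr]
    have e2 : star k * q = star q * r := by
      refine ur.mul_right_cancel ?_
      linear_combination -q * e1 + star q * hq
    have e3 : star k = star q * qi * r := by linear_combination qi * e2 - star k * hqi
    rw [hbn, hk.D_star, hA]
    ext i; simp
    linear_combination (-2 * (p * Y i + W.vD Y i)) * e3 + 2 * Y i * star k * hp
  have DnS : W.vD n = -(2 * q) • star A := by
    have := congrArg star D'n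
    rw [W.star_vD', h.star_n] at this
    rw [this]; ext i; simp
  obtain ⟨L, hL⟩ : ∃ L : Fin 5 → R, L = star qi • W.vD' A := ⟨_, rfl⟩
  have D'A : W.vD' A = star q • L := by
    rw [hL]; ext i; simp; linear_combination (-(W.vD' A i)) * sqi
  have sY : star (r • Y) = r • Y := by rw [star_smul, hr, h.star_Y]
  have D'Y : W.vD' (r • Y) = star q • star A := by
    have := congrArg star DY
    rwa [W.star_vD, sY, star_smul] at this
  -- Since `q` is holomorphic, `L = |q|⁻² (rY)_{zz̄}`, which is visibly real.
  have sL : star L = L := by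
    have e : W.vD' A = qi • W.vD' (W.vD (r • Y)) := by
      rw [DY, W.vD'_smul, D'q]; ext i; simp; linear_combination (-(W.vD' A i)) * hqi
    rw [hL, e, star_smul, star_star, star_smul, W.star_vD', W.star_vD, sY, ← W.vD_comm]
    ext i; simp; ring
  have DL : W.vD L = -(2 * q) • A := by
    rw [hL, W.vD_smul, Dsqi, W.vD_comm, DA, W.vD'_smul, D'q, D'n]
    ext i; simp; linear_combination (2 * q * A i) * sqi
  have DsA : W.vD (star A) = q • L := by
    have := congrArg star D'A
    rwa [W.star_vD', star_smul, star_star, sL] at this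
  have YY : bform (r • Y) (r • Y) = 0 := by rw [bform_smul_left, bform_smul_right, h.YY]; ring
  have YA : bform (r • Y) A = 0 := by
    rw [hA, bform_smul_left, bform_smul_right, bform_add_right, bform_smul_right, h.YY, h.Yz]; ring
  have AA : bform A A = 0 := by
    simp only [hA, bform_smul_left, bform_smul_right, bform_add_right, bform_add_left, h.YY, h.Yz,
      h.zz, bform_comm _ Y]; ring
  have AA' : 2 * bform A (star A) = 1 := by
    have e : bform A (star A) = qi * r * (star qi * r) * bform (W.vD Y) (W.vD' Y) := by
      simp only [hA, star_smul, star_add, star_mul', W.star_vD, h.star_Y, hr, bform_smul_left,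
        bform_smul_right, bform_add_right, bform_add_left, h.YY, h.Yz, h.Yzb, bform_comm _ Y]; ring
    rw [e]
    linear_combination qi * r * (star qi * r) * h.zzb - qi * star qi * hq
      + star q * star qi * hqi + sqi
  have nA : bform n A = 0 := by
    rw [hA, bform_smul_right, bform_add_right, bform_smul_right, h.nY, h.nz]; ring
  have nL : bform n L = 0 := by
    have := congrArg W.D' nA
    rw [W.D'_bform, D'n, D'A, bform_smul_left, bform_smul_right, AA, map_zero] at this
    exact usq.mul_left_cancel (by linear_combination this)
  have LA : bform L A = 0 := by
    have := congrArg W.D' AA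
    rw [W.D'_bform, D'A, bform_smul_left, bform_smul_right, bform_comm A, map_zero] at this
    exact two_cancel (usq.mul_left_cancel (by linear_combination this))
  have LY : 2 * bform L (r • Y) = -1 := by
    have := congrArg W.D' YA
    rw [W.D'_bform, D'A, D'Y, bform_smul_left, bform_smul_right, bform_comm (star A),
      bform_comm _ L, map_zero] at this
    exact usq.mul_left_cancel (by linear_combination 2 * this - star q * AA')
  have LL : bform L L = 1 := by
    have LsA : bform L (star A) = 0 := by
      have := congrArg star LA
      rwa [star_bform, sL, star_zero] at this
    have := congrArg W.D LsA
    rw [W.D_bform, DL, DsA, bform_smul_left, bform_smul_right, map_zero] at this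
    exact uq.mul_left_cancel (by linear_combination this + q * AA')
  exact ⟨A, L, sY, h.star_n, sL, DY, DA, DnS, DsA, DL, YY, YA, AA, AA', h.nn,
    by rw [bform_smul_right, h.nY, mul_zero], nA, nL, LL, LA, LY⟩

/-! ### The Clifford torus -/

/-- If `u² |α|²` is constant in `z̄` and `α` is holomorphic, then `2 u_z̄ / u = -(ᾱ)_z̄ / ᾱ`, which
is antiholomorphic. -/
lemma D_logDeriv_abs {u w α : R} (hw : u * w = 1) (hα : IsUnit α) (Dα : W.D' α = 0)
    (h : W.D' (u * u * (α * star α)) = 0) : W.D (W.D' u * w) = 0 := by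
  have hu : IsUnit u := IsUnit.of_mul_eq_one _ hw
  have Dsα : W.D (star α) = 0 := by rw [← W.star_D', Dα, star_zero]
  simp only [W.D'_mul, Dα] at h
  have e5 : 2 * (W.D' u * w) * star α = -W.D' (star α) := by
    refine (hu.mul hα).mul_left_cancel ?_
    linear_combination w * h - u * α * W.D' (star α) * hw
  have := congrArg W.D e5
  rw [map_neg, W.comm, Dsα, map_zero, W.D_mul, W.D_mul, W.D_two, Dsα] at this
  exact hα.star.mul_right_cancel (two_cancel (by linear_combination this))

/-- A canonical lift into the cone over the Clifford torus. -/
lemma exists_frame_of_clifford {Z : Fin 5 → R} (hs : star Z = Z) (hu : IsUnit (Z 0))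
    (h1 : 2 * (Z 1 * Z 1 + Z 2 * Z 2) = Z 0 * Z 0) (h2 : 2 * (Z 3 * Z 3 + Z 4 * Z 4) = Z 0 * Z 0)
    (hzz : bform (W.vD Z) (W.vD Z) = 0) (hzzb : 2 * bform (W.vD Z) (W.vD' Z) = 1) :
    ∃ n θ, W.IsFrame Z n ∧ W.D' (W.hopfCoeff Z n) = θ * W.hopfCoeff Z n ∧ W.D θ = 0 := by
  obtain ⟨w, hw⟩ := hu.exists_right_inv
  obtain ⟨u, hu'⟩ : ∃ u, u = Z 0 := ⟨_, rfl⟩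
  rw [← hu'] at hw h1 h2 hu
  have su : star u = u := by rw [hu']; exact congrFun hs 0
  have sw : star w = w := by
    have : u * star w = 1 := by rw [← su, ← star_mul', hw, star_one]
    exact hu.mul_left_cancel (this.trans hw.symm)
  have huw : ∀ a, u * (w * a) = a := fun a => by rw [← mul_assoc, hw, one_mul]
  obtain ⟨a, ha⟩ : ∃ a, a = w * Z 1 := ⟨_, rfl⟩
  obtain ⟨b, hb⟩ : ∃ b, b = w * Z 2 := ⟨_, rfl⟩
  obtain ⟨c, hc⟩ : ∃ c, c = w * Z 3 := ⟨_, rfl⟩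
  obtain ⟨d, hd⟩ : ∃ d, d = w * Z 4 := ⟨_, rfl⟩
  have e1 : Z 1 = u * a := by rw [ha, huw]
  have e2 : Z 2 = u * b := by rw [hb, huw]
  have e3 : Z 3 = u * c := by rw [hc, huw]
  have e4 : Z 4 = u * d := by rw [hd, huw]
  have sa : star a = a := by rw [ha, star_mul', sw]; exact congrArg (w * ·) (congrFun hs 1)
  have sb : star b = b := by rw [hb, star_mul', sw]; exact congrArg (w * ·) (congrFun hs 2)
  have sc : star c = c := by rw [hc, star_mul', sw]; exact congrArg (w * ·) (congrFun hs 3)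
  have sd : star d = d := by rw [hd, star_mul', sw]; exact congrArg (w * ·) (congrFun hs 4)
  have hab : 2 * (a * a + b * b) = 1 := by
    rw [e1, e2] at h1
    exact (hu.mul hu).mul_left_cancel (by linear_combination h1)
  have hcd : 2 * (c * c + d * d) = 1 := by
    rw [e3, e4] at h2
    exact (hu.mul hu).mul_left_cancel (by linear_combination h2)
  -- `α` is the `z`-derivative of the polar angle on the circle `x² + y² = 1/2`. The angle is real,
  -- so `α_z̄` is real; this is obtained from the mixed derivatives of `x` and `y`.
  have circle : ∀ x y : R, star x = x → star y = y → 2 * (x * x + y * y) = 1 →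
      ∃ α, W.D x = -α * y ∧ W.D y = α * x ∧ W.D' x = -star α * y ∧ W.D' y = star α * x ∧
        star (W.D' α) = W.D' α := by
    intro x y sx sy hxy
    have hD := congrArg W.D hxy
    simp only [W.D_mul, map_add, W.D_two, Derivation.map_one_eq_zero] at hD
    obtain ⟨α, hα⟩ : ∃ α, α = 2 * (x * W.D y - y * W.D x) := ⟨_, rfl⟩
    have Dx : W.D x = -α * y := by
      apply two_cancel; rw [hα]; linear_combination x * hD - 2 * W.D x * hxy
    have Dy : W.D y = α * x := by
      apply two_cancel; rw [hα]; linear_combination y * hD - 2 * W.D y * hxy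
    have D'x : W.D' x = -star α * y := by
      rw [← sx, ← W.star_D, Dx, star_mul', star_neg, sy]
    have D'y : W.D' y = star α * x := by
      rw [← sy, ← W.star_D, Dy, star_mul', sx]
    refine ⟨α, Dx, Dy, D'x, D'y, ?_⟩
    have c1 := W.comm x
    have c2 := W.comm y
    rw [Dx, D'x, W.D_mul, W.D'_mul, Dy, D'y, map_neg, map_neg] at c1
    rw [Dy, D'y, W.D_mul, W.D'_mul, Dx, D'x] at c2
    rw [W.star_D']
    linear_combination (-2 * y) * c1 + 2 * x * c2 + (-W.D (star α) + W.D' α) * hxy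
  obtain ⟨α, Da, Db, D'a, D'b, sα⟩ := circle a b sa sb hab
  obtain ⟨β, Dc, Dd, D'c, D'd, sβ⟩ := circle c d sc sd hcd
  have Z0 : Z 0 = u := hu'.symm
  -- Conformality: in the expansion of `⟨Z_z, Z_z⟩` the derivatives of the scale `u` cancel.
  have hq : α * α + β * β = 0 := by
    simp only [bform_eq, vD, Z0, e1, e2, e3, e4, W.D_mul, Da, Db, Dc, Dd] at hzz
    refine (hu.mul hu).mul_left_cancel ?_
    linear_combination 2 * hzz - (u * u * α * α + W.D u * W.D u) * hab
      - (u * u * β * β + W.D u * W.D u) * hcd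
  have hm : u * u * (α * star α + β * star β) = 1 := by
    simp only [bform_eq, vD, vD', Z0, e1, e2, e3, e4, W.D_mul, W.D'_mul, Da, Db, Dc, Dd, D'a, D'b,
      D'c, D'd] at hzzb
    linear_combination hzzb - (u * u * α * star α + W.D u * W.D' u) * hab
      - (u * u * β * star β + W.D u * W.D' u) * hcd
  have hm2 : α * star α = β * star β := by
    have hs2 := congrArg star hq
    rw [star_add, star_mul', star_mul', star_zero] at hs2
    have um : IsUnit (α * star α + β * star β) := by
      rw [mul_comm] at hm; exact IsUnit.of_mul_eq_one _ hm
    refine um.mul_right_cancel ?_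
    linear_combination star α * star α * hq - β * β * hs2
  have hα : 2 * (u * u * (α * star α)) = 1 := by linear_combination hm + u * u * hm2
  have uα : IsUnit α := by
    refine IsUnit.of_mul_eq_one (2 * (u * u * star α)) ?_
    linear_combination hα
  -- The choice `β = ± i α` is not available in a ring with zero divisors. Instead `(α_z̄)²` is
  -- shown to equal both `(β_z̄)²` and its negative, so the real element `α_z̄` vanishes.
  have Dα : W.D' α = 0 := by
    have hD := congrArg W.D' hq
    simp only [map_add, W.D'_mul, map_zero] at hD
    have e5 : α * W.D' α = -(β * W.D' β) := two_cancel (by linear_combination hD)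
    have e6 : star α * W.D' α = -(star β * W.D' β) := by
      have := congrArg star e5
      rwa [star_mul', star_neg, star_mul', sα, sβ] at this
    have e7 : W.D' α * W.D' α = W.D' β * W.D' β := by
      refine (uα.mul uα.star).mul_left_cancel ?_
      linear_combination star α * W.D' α * e5 - β * W.D' β * e6 - W.D' β * W.D' β * hm2
    have e8 : W.D' α * W.D' α = -(W.D' β * W.D' β) := by
      refine (uα.mul uα).mul_left_cancel ?_
      linear_combination (α * W.D' α - β * W.D' β) * e5 + W.D' β * W.D' β * hq
    apply W.eq_zero_of_mul_star
    rw [sα]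
    exact two_cancel (by linear_combination e7 + e8)
  have Dsα : W.D (star α) = 0 := by rw [← W.star_D', Dα, star_zero]
  -- The Euclidean unit normal of the torus in `S³`, with time component 0. It is also orthogonal to
  -- `Z_{zz̄}` since the torus is minimal.
  obtain ⟨n, hn⟩ : ∃ n : Fin 5 → R, n = ![0, a, b, -c, -d] := ⟨_, rfl⟩
  have n0 : n 0 = 0 := by rw [hn]; rfl
  have n1 : n 1 = a := by rw [hn]; rfl
  have n2 : n 2 = b := by rw [hn]; rfl
  have n3 : n 3 = -c := by rw [hn]; rfl
  have n4 : n 4 = -d := by rw [hn]; rfl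
  have nz : bform n (W.vD Z) = 0 := by
    simp only [bform_eq, vD, Z0, e1, e2, e3, e4, n0, n1, n2, n3, n4, W.D_mul, Da, Db, Dc, Dd]
    exact two_cancel (by linear_combination W.D u * hab - W.D u * hcd)
  have nzb : bform n (W.vD' Z) = 0 := by
    simp only [bform_eq, vD', Z0, e1, e2, e3, e4, n0, n1, n2, n3, n4, W.D'_mul, D'a, D'b, D'c, D'd]
    exact two_cancel (by linear_combination W.D' u * hab - W.D' u * hcd)
  have hk : W.hopfCoeff Z n = -(u * (α * α)) := by
    have := congrArg W.D nz
    rw [W.D_bform, map_zero] at this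
    rw [hopfCoeff, bform_comm]
    have e : bform (W.vD n) (W.vD Z) = u * (α * α) := by
      simp only [bform_eq, vD, Z0, e1, e2, e3, e4, n0, n1, n2, n3, n4, W.D_mul, Da, Db, Dc, Dd,
        map_neg, map_zero]
      refine two_cancel ?_
      linear_combination u * α * α * hab - u * β * β * hcd - u * hq
    linear_combination this - e
  have nzzb : bform n (W.vD (W.vD' Z)) = 0 := by
    have := congrArg W.D nzb
    rw [W.D_bform, map_zero] at this
    have e : bform (W.vD n) (W.vD' Z) = 0 := by
      simp only [bform_eq, vD, vD', Z0, e1, e2, e3, e4, n0, n1, n2, n3, n4, W.D'_mul, Da, Db,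
        Dc, Dd, D'a, D'b, D'c, D'd, map_neg, map_zero]
      refine two_cancel ?_
      linear_combination u * α * star α * hab - u * β * star β * hcd + u * hm2
    linear_combination this - e
  refine ⟨n, W.D' u * w, ⟨⟨hs, ?_, hzz, hzzb⟩, ?_, ?_, ?_, nz, nzzb⟩, ?_, ?_⟩
  · simp only [bform_eq, Z0, e1, e2, e3, e4]
    exact two_cancel (by linear_combination u * u * hab + u * u * hcd)
  · rw [hn]; ext i; fin_cases i <;> simp [sa, sb, sc, sd]
  · simp only [bform_eq, n0, n1, n2, n3, n4]
    exact two_cancel (by linear_combination hab + hcd)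
  · simp only [bform_eq, Z0, e1, e2, e3, e4, n0, n1, n2, n3, n4]
    exact two_cancel (by linear_combination u * hab - u * hcd)
  · rw [hk, map_neg, W.D'_mul, W.D'_mul, Dα]
    linear_combination W.D' u * α * α * hw
  · refine W.D_logDeriv_abs hw uα Dα ?_
    have := congrArg W.D' hα
    rw [W.D'_mul, W.D'_two, Derivation.map_one_eq_zero] at this
    exact two_cancel (by linear_combination this)

/-! ### Change of coordinates -/

/-- A change of coordinates with complex derivative `a`. -/
structure IsCoordChange {S : Type*} [CommRing S] [StarRing S] [Algebra ℂ S] (W : Wirtinger R)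
    (V : Wirtinger S) (c : R →+* S) (a : S) : Prop where
  star_map : ∀ x, star (c x) = c (star x)
  D_map : ∀ x, V.D (c x) = a * c (W.D x)
  unit : IsUnit a
  D' : V.D' a = 0

namespace IsCoordChange

variable {W} {S : Type*} [CommRing S] [StarRing S] [Algebra ℂ S] {V : Wirtinger S} {c : R →+* S}
  {a r : S} (h : W.IsCoordChange V c a)
include h

lemma D'_map (x : R) : V.D' (c x) = star a * c (W.D' x) := by
  rw [← star_star x, ← h.star_map, ← V.star_D, h.D_map, star_mul', h.star_map, W.star_D]

omit h [StarRing R] [Algebra ℂ R] [StarRing S] [Algebra ℂ S] in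
lemma map_bform (v w : Fin 5 → R) :
    bform (fun i => c (v i)) (fun i => c (w i)) = c (bform v w) := by
  simp only [bform_eq, map_add, map_neg, map_mul]

variable (hr : star r = r) (hra : r * r * (a * star a) = 1)
include hra

-- Here `r = |a|⁻¹` restores the normalisation of the canonical lift in the new coordinate. The Hopf
-- coefficient picks up `a²` from two `z`-derivatives and `r` from the lift.
include hr in
lemma frame {Y n : Fin 5 → R} (hf : W.IsFrame Y n) :
    V.IsFrame (r • fun i => c (Y i)) (fun i => c (n i)) ∧
      V.hopfCoeff (r • fun i => c (Y i)) (fun i => c (n i))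
        = r * (a * a) * c (W.hopfCoeff Y n) := by
  have cs : ∀ v : Fin 5 → R, star v = v → star (fun i => c (v i)) = fun i => c (v i) :=
    fun v hv => by ext i; rw [Pi.star_apply, h.star_map]; exact congrArg c (congrFun hv i)
  have cD : ∀ v : Fin 5 → R, V.vD (fun i => c (v i)) = a • fun i => c (W.vD v i) :=
    fun v => by ext i; exact h.D_map _
  have cD' : ∀ v : Fin 5 → R, V.vD' (fun i => c (v i)) = star a • fun i => c (W.vD' v i) :=
    fun v => by ext i; exact h.D'_map _
  refine ⟨⟨⟨by rw [star_smul, hr, cs _ hf.star_Y], ?_, ?_, ?_⟩, cs _ hf.star_n, ?_, ?_, ?_, ?_⟩, ?_⟩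
  · rw [bform_smul_left, bform_smul_right, map_bform, hf.YY]; simp
  · simp only [V.vD_smul, cD, bform_add_left, bform_add_right, bform_smul_left, bform_smul_right,
      map_bform, hf.YY, hf.Yz, hf.zz, bform_comm (W.vD Y) Y, map_zero]
    ring
  · have h1 := congrArg c hf.zzb
    rw [map_mul, map_ofNat, map_one] at h1
    simp only [V.vD_smul, V.vD'_smul, cD, cD', bform_add_left, bform_add_right, bform_smul_left,
      bform_smul_right, map_bform, hf.YY, hf.Yz, hf.Yzb, bform_comm (W.vD Y) Y, map_zero]
    linear_combination r * r * a * star a * h1 + hra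
  · rw [map_bform, hf.nn, map_one]
  · rw [bform_smul_right, map_bform, hf.nY, map_zero, mul_zero]
  · simp only [V.vD_smul, cD, bform_add_right, bform_smul_right, map_bform, hf.nY, hf.nz, map_zero]
    ring
  · simp only [V.vD_smul, V.vD'_smul, V.vD_add, cD, cD', bform_add_right, bform_smul_right,
      map_bform, hf.nY, hf.nz, hf.nzb, hf.nzzb, map_zero]
    ring
  · simp only [hopfCoeff, V.vD_smul, V.vD_add, cD, bform_add_left, bform_smul_left,
      map_bform, bform_comm Y n, bform_comm (W.vD Y) n, hf.nY, hf.nz, map_zero]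
    ring

/-- The factor `r a²` contributes only `r_z̄ / r` to the logarithmic derivative, and `log r = -log
|a|` is harmonic. Thus `θ_z` transforms by `|a|²`, exactly like `|k|²`. -/
lemma D_logDeriv {k θ : R} (hθ : W.D' k = θ * k) :
    ∃ θ' : S, V.D' (r * (a * a) * c k) = θ' * (r * (a * a) * c k) ∧
      V.D θ' = a * star a * c (W.D θ) := by
  have hr1 : r * (r * (a * star a)) = 1 := by rw [← mul_assoc, hra]
  have D0 : V.D (V.D' r * (r * (a * star a))) = 0 := by
    refine V.D_logDeriv_abs hr1 h.unit h.D' ?_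
    rw [hra, Derivation.map_one_eq_zero]
  refine ⟨V.D' r * (r * (a * star a)) + star a * c θ, ?_, ?_⟩
  · simp only [V.D'_mul, h.D', h.D'_map, hθ, map_mul]
    linear_combination (-V.D' r * (a * a) * c k) * hr1
  · rw [map_add, D0, V.D_mul, ← V.star_D', h.D', h.D_map, star_zero]; ring

end IsCoordChange

end Wirtinger

end

/-! ### Wirtinger calculus and the ring of smooth functions -/

section

open Topology TopologicalSpace

/-! ### Calculus of Wirtinger derivatives -/

lemma dz_congr {F : Type*} [NormedAddCommGroup F] [NormedSpace ℂ F] {g h : ℂ → F} {z : ℂ}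
    (e : g =ᶠ[𝓝 z] h) : dz g z = dz h z := by
  rw [dz, dz, e.fderiv_eq]

lemma dzbar_congr {F : Type*} [NormedAddCommGroup F] [NormedSpace ℂ F] {g h : ℂ → F} {z : ℂ}
    (e : g =ᶠ[𝓝 z] h) : dzbar g z = dzbar h z := by
  rw [dzbar, dzbar, e.fderiv_eq]

section Rules

variable {g h : ℂ → ℂ} {z : ℂ}

lemma dz_add (hg : DifferentiableAt ℝ g z) (hh : DifferentiableAt ℝ h z) :
    dz (g + h) z = dz g z + dz h z := by
  simp only [dz, fderiv_add hg hh, add_apply, smul_eq_mul]; ring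

lemma dz_mul (hg : DifferentiableAt ℝ g z) (hh : DifferentiableAt ℝ h z) :
    dz (g * h) z = dz g z * h z + g z * dz h z := by
  simp only [dz, fderiv_mul hg hh, add_apply, smul_apply,
    smul_eq_mul]; ring

lemma dz_const_mul (c : ℂ) (hg : DifferentiableAt ℝ g z) :
    dz (c • g) z = c * dz g z := by
  simp only [dz, fderiv_const_smul hg, smul_apply, smul_eq_mul]; ring

lemma dzbar_add (hg : DifferentiableAt ℝ g z) (hh : DifferentiableAt ℝ h z) :
    dzbar (g + h) z = dzbar g z + dzbar h z := by
  simp only [dzbar, fderiv_add hg hh, add_apply, smul_eq_mul]; ring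

lemma dzbar_mul (hg : DifferentiableAt ℝ g z) (hh : DifferentiableAt ℝ h z) :
    dzbar (g * h) z = dzbar g z * h z + g z * dzbar h z := by
  simp only [dzbar, fderiv_mul hg hh, add_apply,
    smul_apply, smul_eq_mul]; ring

lemma dzbar_const_mul (c : ℂ) (hg : DifferentiableAt ℝ g z) :
    dzbar (c • g) z = c * dzbar g z := by
  simp only [dzbar, fderiv_const_smul hg, smul_apply, smul_eq_mul]; ring

lemma fderiv_star_apply (g : ℂ → ℂ) (z v : ℂ) :
    fderiv ℝ (star g) z v = star (fderiv ℝ g z v) := by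
  have : (star g : ℂ → ℂ) = Complex.conjCLE ∘ g := by ext; simp
  rw [this, ContinuousLinearEquiv.comp_fderiv]; simp

lemma star_dz (g : ℂ → ℂ) (z : ℂ) : star (dz g z) = dzbar (star g) z := by
  simp [dz, dzbar, fderiv_star_apply]

lemma dz_apply {g : ℂ → Fin 5 → ℂ} (hg : DifferentiableAt ℝ g z) (i : Fin 5) :
    dz g z i = dz (fun w => g w i) z := by
  have := fderiv_apply hg i
  simp only [dz, this, Pi.smul_apply, Pi.sub_apply]; rfl

lemma dzbar_apply {g : ℂ → Fin 5 → ℂ} (hg : DifferentiableAt ℝ g z) (i : Fin 5) :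
    dzbar g z i = dzbar (fun w => g w i) z := by
  have := fderiv_apply hg i
  simp only [dzbar, this, Pi.smul_apply, Pi.add_apply]; rfl

end Rules

section Smooth

variable {F : Type*} [NormedAddCommGroup F] [NormedSpace ℂ F] {g : ℂ → F} {Ω : Set ℂ}

lemma contDiffOn_fderiv_apply (hΩ : IsOpen Ω) (hg : ContDiffOn ℝ ∞ g Ω) (v : ℂ) :
    ContDiffOn ℝ ∞ (fun z => fderiv ℝ g z v) Ω :=
  (hg.fderiv_of_isOpen hΩ (by simp)).clm_apply contDiffOn_const

lemma contDiffOn_dz (hΩ : IsOpen Ω) (hg : ContDiffOn ℝ ∞ g Ω) : ContDiffOn ℝ ∞ (dz g) Ω :=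
  ((contDiffOn_fderiv_apply hΩ hg 1).sub
    ((contDiffOn_fderiv_apply hΩ hg Complex.I).const_smul Complex.I)).const_smul (1 / 2 : ℂ)

lemma contDiffOn_dzbar (hΩ : IsOpen Ω) (hg : ContDiffOn ℝ ∞ g Ω) : ContDiffOn ℝ ∞ (dzbar g) Ω :=
  ((contDiffOn_fderiv_apply hΩ hg 1).add
    ((contDiffOn_fderiv_apply hΩ hg Complex.I).const_smul Complex.I)).const_smul (1 / 2 : ℂ)

lemma differentiableAt_of_smooth (hΩ : IsOpen Ω) (hg : ContDiffOn ℝ ∞ g Ω) {z : ℂ} (hz : z ∈ Ω) :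
    DifferentiableAt ℝ g z :=
  (hg.contDiffAt (hΩ.mem_nhds hz)).differentiableAt (by simp)

end Smooth

lemma fderiv_dz {g : ℂ → ℂ} {z : ℂ} (hg : ContDiffAt ℝ 2 g z) (v : ℂ) :
    fderiv ℝ (dz g) z v = (1 / 2 : ℂ) *
      (fderiv ℝ (fderiv ℝ g) z v 1 - Complex.I * fderiv ℝ (fderiv ℝ g) z v Complex.I) := by
  have hd : DifferentiableAt ℝ (fderiv ℝ g) z :=
    (hg.fderiv_right (m := 1) (by norm_num)).differentiableAt (by norm_num)
  have h1 : ∀ u : ℂ, DifferentiableAt ℝ (fun w => fderiv ℝ g w u) z := fun u =>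
    hd.clm_apply (differentiableAt_const u)
  have h2 : ∀ u : ℂ, fderiv ℝ (fun w => fderiv ℝ g w u) z v = fderiv ℝ (fderiv ℝ g) z v u := by
    intro u
    rw [fderiv_clm_apply hd (differentiableAt_const u)]; simp
  have e : dz g = (1 / 2 : ℂ) • ((fun w => fderiv ℝ g w 1)
      - Complex.I • fun w => fderiv ℝ g w Complex.I) := rfl
  rw [e, fderiv_const_smul ((h1 _).sub ((h1 _).const_smul _)),
    smul_apply, fderiv_sub (h1 _) ((h1 _).const_smul _),
    fderiv_const_smul (h1 _)]
  simp [h2]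

lemma fderiv_dzbar {g : ℂ → ℂ} {z : ℂ} (hg : ContDiffAt ℝ 2 g z) (v : ℂ) :
    fderiv ℝ (dzbar g) z v = (1 / 2 : ℂ) *
      (fderiv ℝ (fderiv ℝ g) z v 1 + Complex.I * fderiv ℝ (fderiv ℝ g) z v Complex.I) := by
  have hd : DifferentiableAt ℝ (fderiv ℝ g) z :=
    (hg.fderiv_right (m := 1) (by norm_num)).differentiableAt (by norm_num)
  have h1 : ∀ u : ℂ, DifferentiableAt ℝ (fun w => fderiv ℝ g w u) z := fun u =>
    hd.clm_apply (differentiableAt_const u)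
  have h2 : ∀ u : ℂ, fderiv ℝ (fun w => fderiv ℝ g w u) z v = fderiv ℝ (fderiv ℝ g) z v u := by
    intro u
    rw [fderiv_clm_apply hd (differentiableAt_const u)]; simp
  have e : dzbar g = (1 / 2 : ℂ) • ((fun w => fderiv ℝ g w 1)
      + Complex.I • fun w => fderiv ℝ g w Complex.I) := rfl
  rw [e, fderiv_const_smul ((h1 _).add ((h1 _).const_smul _)),
    smul_apply, fderiv_add (h1 _) ((h1 _).const_smul _),
    fderiv_const_smul (h1 _)]
  simp [h2]

lemma dz_dzbar_comm {g : ℂ → ℂ} {z : ℂ} (hg : ContDiffAt ℝ 2 g z) :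
    dz (dzbar g) z = dzbar (dz g) z := by
  have hs : IsSymmSndFDerivAt ℝ g z := hg.isSymmSndFDerivAt (by simp)
  rw [dz, dzbar]
  simp only [fderiv_dz hg, fderiv_dzbar hg, smul_eq_mul, hs.eq 1 Complex.I]
  ring

lemma laplacian_eq_dz_dzbar {g : ℂ → ℝ} {z : ℂ} (hg : ContDiffAt ℝ 2 g z) :
    ((Laplacian.laplacian g z : ℝ) : ℂ) = 4 * dz (dzbar fun w => (g w : ℂ)) z := by
  have hG : ContDiffAt ℝ 2 (fun w => (g w : ℂ)) z :=
    Complex.ofRealCLM.contDiff.contDiffAt.comp z hg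
  have hs : IsSymmSndFDerivAt ℝ (fun w => (g w : ℂ)) z := hG.isSymmSndFDerivAt (by simp)
  have e : ((Laplacian.laplacian g z : ℝ) : ℂ) = Laplacian.laplacian (fun w => (g w : ℂ)) z :=
    (hg.laplacian_CLM_comp_left (l := Complex.ofRealCLM)).symm
  rw [e, InnerProductSpace.laplacian_eq_iteratedFDeriv_complexPlane, dz]
  simp only [fderiv_dzbar hG, smul_eq_mul, hs.eq 1 Complex.I, iteratedFDeriv_two_apply]
  simp
  linear_combination ((fderiv ℝ (fderiv ℝ fun w => (g w : ℂ)) z) Complex.I Complex.I)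
    * Complex.I_mul_I

/-! ### The ring of smooth functions on an open set -/

/-- Smooth complex-valued functions on an open subset of `ℂ`. -/
def Smooth (Ω : Opens ℂ) : StarSubalgebra ℂ (Ω → ℂ) where
  carrier := {g | ∃ G : ℂ → ℂ, ContDiffOn ℝ ∞ G Ω ∧ ∀ z : Ω, g z = G z}
  mul_mem' := by
    rintro _ _ ⟨G, hG, hg⟩ ⟨H, hH, hh⟩
    exact ⟨G * H, hG.mul hH, fun z => by simp [hg, hh]⟩
  add_mem' := by
    rintro _ _ ⟨G, hG, hg⟩ ⟨H, hH, hh⟩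
    exact ⟨G + H, hG.add hH, fun z => by simp [hg, hh]⟩
  algebraMap_mem' c := ⟨fun _ => c, contDiffOn_const, fun _ => rfl⟩
  star_mem' := by
    rintro _ ⟨G, hG, hg⟩
    exact ⟨star G, Complex.conjCLE.contDiff.comp_contDiffOn hG, fun z => by simp [hg]⟩

namespace Smooth

variable {Ω : Opens ℂ}

/-- The restriction of a smooth function. -/
def mk (G : ℂ → ℂ) (hG : ContDiffOn ℝ ∞ G Ω) : Smooth Ω := ⟨fun z => G z, G, hG, fun _ => rfl⟩

/-- Extension by zero. -/
def fn (g : Smooth Ω) (z : ℂ) : ℂ := by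
  classical exact if h : z ∈ Ω then g.1 ⟨z, h⟩ else 0

lemma fn_apply (g : Smooth Ω) {z : ℂ} (h : z ∈ Ω) : (fn g) z = g.1 ⟨z, h⟩ := by
  simp [fn, h]

lemma fn_mk (G : ℂ → ℂ) (hG : ContDiffOn ℝ ∞ G Ω) {z : ℂ} (h : z ∈ Ω) : fn (mk G hG) z = G z :=
  fn_apply _ h

lemma smooth_fn (g : Smooth Ω) : ContDiffOn ℝ ∞ (fn g) Ω := by
  obtain ⟨G, hG, hg⟩ := g.2
  exact hG.congr fun z hz => by rw [fn_apply g hz, hg]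

lemma ext_fn {g h : Smooth Ω} (e : ∀ z ∈ Ω, (fn g) z = (fn h) z) : g = h := by
  apply Subtype.ext; funext z
  have := e z z.2
  rwa [fn_apply g z.2, fn_apply h z.2] at this

lemma eventuallyEq {G H : ℂ → ℂ} (e : ∀ z ∈ Ω, G z = H z) {z : ℂ} (hz : z ∈ Ω) :
    G =ᶠ[𝓝 z] H :=
  Filter.eventuallyEq_of_mem (Ω.isOpen.mem_nhds hz) e

lemma differentiableAt_fn (g : Smooth Ω) {z : ℂ} (hz : z ∈ Ω) : DifferentiableAt ℝ (fn g) z :=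
  differentiableAt_of_smooth Ω.isOpen (smooth_fn g) hz

lemma fn_mul (g h : Smooth Ω) (z : ℂ) : fn (g * h) z = (fn g) z * (fn h) z := by
  by_cases hz : z ∈ Ω <;> simp [fn, hz]

lemma fn_add (g h : Smooth Ω) (z : ℂ) : fn (g + h) z = (fn g) z + (fn h) z := by
  by_cases hz : z ∈ Ω <;> simp [fn, hz]

lemma fn_neg (g : Smooth Ω) (z : ℂ) : fn (-g) z = -(fn g) z := by
  by_cases hz : z ∈ Ω <;> simp [fn, hz]

lemma fn_sub (g h : Smooth Ω) (z : ℂ) : fn (g - h) z = (fn g) z - (fn h) z := by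
  by_cases hz : z ∈ Ω <;> simp [fn, hz]

lemma fn_smul (c : ℂ) (g : Smooth Ω) (z : ℂ) : fn (c • g) z = c * (fn g) z := by
  by_cases hz : z ∈ Ω <;> simp [fn, hz]

lemma fn_star (g : Smooth Ω) (z : ℂ) : fn (star g) z = star ((fn g) z) := by
  by_cases hz : z ∈ Ω <;> simp [fn, hz]

lemma fn_zero (z : ℂ) : fn (0 : Smooth Ω) z = 0 := by
  by_cases hz : z ∈ Ω <;> simp [fn, hz]

lemma fn_one {z : ℂ} (hz : z ∈ Ω) : fn (1 : Smooth Ω) z = 1 := by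
  simp [fn, hz]

lemma fn_ofNat (k : ℕ) [k.AtLeastTwo] {z : ℂ} (hz : z ∈ Ω) :
    fn (OfNat.ofNat k : Smooth Ω) z = OfNat.ofNat k := by
  rw [fn_apply _ hz]; rfl

variable (Ω) in
/-- The Wirtinger derivations of smooth functions. -/
def wirtinger : Wirtinger (Smooth Ω) where
  D := Derivation.mk'
    { toFun := fun g => mk (dz (fn g)) (contDiffOn_dz Ω.isOpen (smooth_fn g))
      map_add' := fun g h => ext_fn fun z hz => by
        rw [fn_add, fn_mk _ _ hz, fn_mk _ _ hz, fn_mk _ _ hz,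
          ← dz_add (differentiableAt_fn g hz) (differentiableAt_fn h hz)]
        exact congrArg (fun G => dz G z) (funext fun w => fn_add g h w)
      map_smul' := fun c g => ext_fn fun z hz => by
        rw [RingHom.id_apply, fn_smul, fn_mk _ _ hz, fn_mk _ _ hz,
          ← dz_const_mul c (differentiableAt_fn g hz)]
        exact congrArg (fun G => dz G z) (funext fun w => fn_smul c g w) }
    (fun g h => ext_fn fun z hz => by
      simp only [LinearMap.coe_mk, AddHom.coe_mk, smul_eq_mul, fn_add, fn_mul]
      rw [fn_mk _ _ hz, fn_mk _ _ hz, fn_mk _ _ hz]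
      have : fn (g * h) = (fn g) * (fn h) := funext fun w => fn_mul g h w
      rw [this, dz_mul (differentiableAt_fn g hz) (differentiableAt_fn h hz)]; ring)
  D' := Derivation.mk'
    { toFun := fun g => mk (dzbar (fn g)) (contDiffOn_dzbar Ω.isOpen (smooth_fn g))
      map_add' := fun g h => ext_fn fun z hz => by
        rw [fn_add, fn_mk _ _ hz, fn_mk _ _ hz, fn_mk _ _ hz,
          ← dzbar_add (differentiableAt_fn g hz) (differentiableAt_fn h hz)]
        exact congrArg (fun G => dzbar G z) (funext fun w => fn_add g h w)
      map_smul' := fun c g => ext_fn fun z hz => by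
        rw [RingHom.id_apply, fn_smul, fn_mk _ _ hz, fn_mk _ _ hz,
          ← dzbar_const_mul c (differentiableAt_fn g hz)]
        exact congrArg (fun G => dzbar G z) (funext fun w => fn_smul c g w) }
    (fun g h => ext_fn fun z hz => by
      simp only [LinearMap.coe_mk, AddHom.coe_mk, smul_eq_mul, fn_add, fn_mul]
      rw [fn_mk _ _ hz, fn_mk _ _ hz, fn_mk _ _ hz]
      have : fn (g * h) = (fn g) * (fn h) := funext fun w => fn_mul g h w
      rw [this, dzbar_mul (differentiableAt_fn g hz) (differentiableAt_fn h hz)]; ring)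
  comm g := ext_fn fun z hz => by
    simp only [Derivation.coe_mk', LinearMap.coe_mk, AddHom.coe_mk]
    rw [fn_mk _ _ hz, fn_mk _ _ hz,
      dz_congr (eventuallyEq (fun w hw => fn_mk _ _ hw) hz),
      dzbar_congr (eventuallyEq (fun w hw => fn_mk _ _ hw) hz)]
    exact dz_dzbar_comm
      (contDiffAt_infty.mp ((smooth_fn g).contDiffAt (Ω.isOpen.mem_nhds hz)) 2)
  star_D g := ext_fn fun z hz => by
    simp only [Derivation.coe_mk', LinearMap.coe_mk, AddHom.coe_mk]
    have : fn (star g) = star (fn g) := funext fun w => fn_star g w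
    rw [fn_star, fn_mk _ _ hz, fn_mk _ _ hz, star_dz, this]
  eq_zero_of_mul_star g hg := ext_fn fun z hz => by
    have := congrArg (fun x => fn x z) hg
    simp only [fn_mul, fn_star, fn_zero] at this
    rw [fn_zero]
    simpa using this

lemma fn_D (g : Smooth Ω) {z : ℂ} (hz : z ∈ Ω) : fn ((wirtinger Ω).D g) z = dz (fn g) z :=
  fn_mk _ (contDiffOn_dz Ω.isOpen (smooth_fn g)) hz

lemma fn_D' (g : Smooth Ω) {z : ℂ} (hz : z ∈ Ω) : fn ((wirtinger Ω).D' g) z = dzbar (fn g) z :=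
  fn_mk _ (contDiffOn_dzbar Ω.isOpen (smooth_fn g)) hz

lemma isUnit_iff {g : Smooth Ω} : IsUnit g ↔ ∀ z ∈ Ω, (fn g) z ≠ 0 := by
  constructor
  · rintro hg z hz h0
    obtain ⟨h, hh⟩ := hg.exists_right_inv
    have := congrArg (fun x => fn x z) hh
    simp [fn_mul, h0, fn_one hz] at this
  · intro hg
    have hs : ContDiffOn ℝ ∞ (fun z => ((fn g) z)⁻¹) Ω := (smooth_fn g).inv hg
    refine IsUnit.of_mul_eq_one (mk _ hs) (ext_fn fun z hz => ?_)
    rw [fn_mul, fn_mk _ _ hz, fn_one hz, mul_inv_cancel₀ (hg z hz)]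

end Smooth

end

/-! ### Translation between the invariants of a map and the algebra of its frame -/

section

open Topology TopologicalSpace Smooth

variable {Ω : Opens ℂ}

lemma dzbar_cexp {g : ℂ → ℂ} {z : ℂ} (hg : DifferentiableAt ℝ g z) :
    dzbar (fun w => Complex.exp (g w)) z = Complex.exp (g z) * dzbar g z := by
  have h := hg.hasFDerivAt.cexp
  simp only [dzbar, h.fderiv, smul_apply, smul_eq_mul]; ring

/-! ### The invariants of a surface in terms of a frame -/

/-- The smooth function `a` is the restriction of `G`. -/
def Repr (a : Smooth Ω) (G : ℂ → ℂ) : Prop := ∀ z ∈ Ω, G z = fn a z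

/-- The smooth vector-valued function `v` is the restriction of `g`. -/
def VRepr (v : Fin 5 → Smooth Ω) (g : ℂ → Fin 5 → ℂ) : Prop := ∀ z ∈ Ω, g z = fun i => fn (v i) z

lemma Repr.dz {a : Smooth Ω} {G : ℂ → ℂ} (h : Repr a G) :
    Repr ((wirtinger Ω).D a) (dz G) := fun z hz => by
  rw [dz_congr (eventuallyEq h hz), fn_D a hz]

lemma Repr.dzbar {a : Smooth Ω} {G : ℂ → ℂ} (h : Repr a G) :
    Repr ((wirtinger Ω).D' a) (dzbar G) := fun z hz => by
  rw [dzbar_congr (eventuallyEq h hz), fn_D' a hz]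

lemma differentiableAt_vfn (v : Fin 5 → Smooth Ω) {z : ℂ} (hz : z ∈ Ω) :
    DifferentiableAt ℝ (fun w i => fn (v i) w) z :=
  differentiableAt_pi.mpr fun i => differentiableAt_fn (v i) hz

lemma VRepr.eventuallyEq {v : Fin 5 → Smooth Ω} {g : ℂ → Fin 5 → ℂ} (h : VRepr v g) {z : ℂ}
    (hz : z ∈ Ω) : g =ᶠ[𝓝 z] fun w i => fn (v i) w :=
  Filter.eventuallyEq_of_mem (Ω.isOpen.mem_nhds hz) h

lemma VRepr.dz {v : Fin 5 → Smooth Ω} {g : ℂ → Fin 5 → ℂ} (h : VRepr v g) :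
    VRepr ((wirtinger Ω).vD v) (dz g) := fun z hz => by
  rw [dz_congr (h.eventuallyEq hz)]
  ext i
  rw [dz_apply (differentiableAt_vfn v hz), Wirtinger.vD, fn_D _ hz]

lemma VRepr.dzbar {v : Fin 5 → Smooth Ω} {g : ℂ → Fin 5 → ℂ} (h : VRepr v g) :
    VRepr ((wirtinger Ω).vD' v) (dzbar g) := fun z hz => by
  rw [dzbar_congr (h.eventuallyEq hz)]
  ext i
  rw [dzbar_apply (differentiableAt_vfn v hz), Wirtinger.vD', fn_D' _ hz]

lemma VRepr.star {v : Fin 5 → Smooth Ω} {g : ℂ → Fin 5 → ℂ} (h : VRepr v g) :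
    VRepr (star v) (fun z => star (g z)) := fun z hz => by
  ext i
  simp [h z hz, fn_star]

lemma fn_bform (v w : Fin 5 → Smooth Ω) (z : ℂ) :
    fn (bform v w) z = bform (fun i => fn (v i) z) (fun i => fn (w i) z) := by
  simp only [bform_eq, fn_add, fn_neg, fn_mul]

lemma VRepr.form {v w : Fin 5 → Smooth Ω} {g h : ℂ → Fin 5 → ℂ} (hv : VRepr v g)
    (hw : VRepr w h) : Repr (bform v w) (fun z => form (g z) (h z)) := fun z hz => by
  simp only [hv z hz, hw z hz, fn_bform]; rfl

namespace Frame

variable {f : ℂ → E4} {Y n : Fin 5 → Smooth Ω}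

lemma repr_zzb (hY : VRepr Y (lift f)) :
    VRepr ((wirtinger Ω).vD ((wirtinger Ω).vD' Y)) (liftZZbar f) := hY.dzbar.dz

lemma repr_frameN (hY : VRepr Y (lift f)) :
    VRepr ((wirtinger Ω).conj_lift Y) (frameN f) := fun z hz => by
  have h1 := (repr_zzb hY).form (repr_zzb hY) z hz
  simp only at h1
  rw [frameN, h1, repr_zzb hY z hz, hY z hz, Wirtinger.conj_lift]
  ext i
  simp [fn_add, fn_mul, fn_ofNat 2 hz]

lemma repr_normalProj (hY : VRepr Y (lift f)) {v : Fin 5 → Smooth Ω} {g : ℂ → Fin 5 → ℂ}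
    (hv : VRepr v g) :
    VRepr ((wirtinger Ω).normalProj Y v) (fun z => normalPart f z (g z)) := fun z hz => by
  have f1 := hv.form (repr_frameN hY) z hz
  have f2 := hv.form hY z hz
  have f3 := hv.form hY.dzbar z hz
  have f4 := hv.form hY.dz z hz
  simp only at f1 f2 f3 f4
  simp only [normalPart, Wirtinger.normalProj]
  rw [f1, f2, f3, f4, hv z hz, hY z hz, repr_frameN hY z hz, hY.dz z hz, hY.dzbar z hz]
  ext i
  simp [fn_add, fn_mul, fn_sub, fn_ofNat 2 hz]

variable (h : (wirtinger Ω).IsFrame Y n) (hY : VRepr Y (lift f))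
include h hY

/-- Expanding `v` in the full frame shows that removing the `Y, N, Y_z, Y_z̄` components leaves only
the component along `n`. -/
lemma repr_normalPart {v : Fin 5 → Smooth Ω} {g : ℂ → Fin 5 → ℂ} (hv : VRepr v g) :
    VRepr (bform v n • n) (fun z => normalPart f z (g z)) := by
  have e' : bform v n • n = (wirtinger Ω).normalProj Y v := by
    rw [eq_comm, Wirtinger.normalProj]
    nth_rewrite 1 [h.expand v]
    abel
  rw [e']
  exact repr_normalProj hY hv

lemma repr_hopf : VRepr ((wirtinger Ω).hopfCoeff Y n • n) (hopf f) :=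
  repr_normalPart h hY hY.dz.dz

lemma repr_hopfSq : Repr ((wirtinger Ω).hopfCoeff Y n * star ((wirtinger Ω).hopfCoeff Y n))
    (hopfSq f) := fun z hz => by
  have := (repr_hopf h hY).form (repr_hopf h hY).star z hz
  simp only at this
  rw [hopfSq, this, star_smul, h.star_n, bform_smul_left, bform_smul_right, h.nn, mul_one]

omit h in
lemma repr_schwarzian : Repr ((wirtinger Ω).schw Y) (schwarzian f) := fun z hz => by
  have := hY.dz.dz.form (repr_frameN hY) z hz
  simp only at this
  rw [schwarzian, this, Wirtinger.schw, fn_mul, fn_ofNat 2 hz]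

lemma repr_normalDzbar {a : Smooth Ω} {ξ : ℂ → Fin 5 → ℂ} (hξ : VRepr (a • n) ξ) :
    VRepr ((wirtinger Ω).D' a • n) (normalDzbar f ξ) := by
  have e : bform ((wirtinger Ω).vD' (a • n)) n = (wirtinger Ω).D' a := by
    rw [Wirtinger.vD'_smul, bform_add_left, bform_smul_left, bform_smul_left, h.nn, h.n_Dn]; ring
  have := repr_normalPart h hY hξ.dzbar
  rwa [e] at this

lemma willmore_eq (hW : ∀ z ∈ Ω, normalDzbar f (normalDzbar f (hopf f)) z
      + (star (schwarzian f z) / 2) • hopf f z = 0) :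
    2 * (wirtinger Ω).D' ((wirtinger Ω).D' ((wirtinger Ω).hopfCoeff Y n))
      + star ((wirtinger Ω).schw Y) * (wirtinger Ω).hopfCoeff Y n = 0 := ext_fn fun z hz => by
  have e := hW z hz
  rw [repr_normalDzbar h hY (repr_normalDzbar h hY (repr_hopf h hY)) z hz,
    repr_schwarzian hY z hz, repr_hopf h hY z hz] at e
  have e1 := congrArg (fun v => bform v fun i => fn (n i) z) e
  have hnn : bform (fun i => fn (n i) z) (fun i => fn (n i) z) = 1 := by
    rw [← fn_bform, h.nn, fn_one hz]
  have e2 : ∀ a : Smooth Ω, (fun i => fn ((a • n) i) z) = fn a z • fun i => fn (n i) z :=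
    fun a => by ext i; simp [fn_mul]
  have e0 : bform (0 : Fin 5 → ℂ) (fun i => fn (n i) z) = 0 := by simp [bform_eq]
  simp only [e2, bform_add_left, bform_smul_left, hnn, e0] at e1
  simp only [fn_add, fn_mul, fn_star, fn_ofNat 2 hz, fn_zero]
  linear_combination 2 * e1

variable {θ : Smooth Ω} (hk : IsUnit ((wirtinger Ω).hopfCoeff Y n))
  (hθ : (wirtinger Ω).D' ((wirtinger Ω).hopfCoeff Y n) = θ * (wirtinger Ω).hopfCoeff Y n)
include hk hθ

lemma repr_muBar : Repr (-2 * θ) (muBar f) := fun z hz => by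
  have h1 := repr_normalDzbar h hY (repr_hopf h hY)
  have h2 := h1.form (repr_hopf h hY).star z hz
  have hne := isUnit_iff.mp hk z hz
  have hne' : star (fn ((wirtinger Ω).hopfCoeff Y n) z) ≠ 0 := star_ne_zero.mpr hne
  simp only at h2
  rw [muBar, h2, repr_hopfSq h hY z hz, star_smul, h.star_n, bform_smul_left, bform_smul_right,
    h.nn, hθ]
  simp only [fn_mul, fn_star, fn_neg, fn_ofNat 2 hz, fn_one hz]
  field_simp

lemma repr_rho : Repr (-(2 * (wirtinger Ω).D θ
      + 2 * ((wirtinger Ω).hopfCoeff Y n * star ((wirtinger Ω).hopfCoeff Y n))))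
    (rho f) := fun z hz => by
  rw [rho, (repr_muBar h hY hk hθ).dz z hz, repr_hopfSq h hY z hz]
  have hm : (wirtinger Ω).D (-2 : Smooth Ω) = 0 := by
    rw [map_neg, Wirtinger.D_two, neg_zero]
  simp only [Wirtinger.D_mul, fn_mul, fn_star, fn_neg, fn_add, fn_ofNat 2 hz, hm, fn_zero]
  ring

lemma localP_eq {z : ℂ} (hz : z ∈ Ω) :
    localP f z = -2 * fn ((wirtinger Ω).D θ) z / hopfSq f z - 2 := by
  have hne : hopfSq f z ≠ 0 := by
    rw [repr_hopfSq h hY z hz]; exact isUnit_iff.mp (hk.mul hk.star) z hz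
  rw [localP, repr_rho h hY hk hθ z hz, div_sub' hne, repr_hopfSq h hY z hz]
  simp only [fn_mul, fn_star, fn_neg, fn_add, fn_ofNat 2 hz]
  ring

omit hk hθ in
lemma hopfSq_eq {z : ℂ} (hz : z ∈ Ω) :
    hopfSq f z = ((Complex.normSq (fn ((wirtinger Ω).hopfCoeff Y n) z) : ℝ) : ℂ) := by
  rw [repr_hopfSq h hY z hz, fn_mul, fn_star, ← Complex.mul_conj]; rfl

/-- With `e^{2ω} = 4 |k|²` one has `2 ω_{zz̄} = θ_z + (θ_z)*`, and the factors 4 in the metric and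
in `Δ = 4 ∂_z ∂_z̄` cancel. -/
lemma localK_eq {z : ℂ} (hz : z ∈ Ω) :
    localK f z = -(fn ((wirtinger Ω).D θ) z).re / (hopfSq f z).re := by
  obtain ⟨k, hk0⟩ : ∃ k, k = (wirtinger Ω).hopfCoeff Y n := ⟨_, rfl⟩
  have hsq : ∀ w ∈ Ω, hopfSq f w = ((Complex.normSq (fn k w) : ℝ) : ℂ) := fun w hw => by
    rw [hk0, hopfSq_eq h hY hw]
  rw [← hk0] at hk hθ
  have hpos : ∀ w ∈ Ω, 0 < Complex.normSq (fn k w) := fun w hw =>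
    Complex.normSq_pos.mpr (isUnit_iff.mp hk w hw)
  have hmob : ∀ w ∈ Ω, mobiusFactor f w = 4 * Complex.normSq (fn k w) := fun w hw => by
    rw [mobiusFactor, hsq w hw, Complex.ofReal_re]
  have hnsq : ContDiffOn ℝ ∞ (fun w => Complex.normSq (fn k w)) Ω := by
    have e : ∀ w, Complex.normSq (fn k w) = (fn k w * star (fn k w)).re := fun w => by
      have := Complex.mul_conj (fn k w)
      rw [← Complex.ofReal_re (Complex.normSq (fn k w)), ← this]; rfl
    have hs : ContDiffOn ℝ ∞ (fun w => fn (k * star k) w) Ω := smooth_fn _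
    refine (Complex.reCLM.contDiff.comp_contDiffOn hs).congr fun w hw => ?_
    simp only [Function.comp, fn_mul, fn_star, e]; rfl
  have hg : ContDiffOn ℝ ∞ (fun w => Real.log (mobiusFactor f w) / 2) Ω := by
    have h1 : ContDiffOn ℝ ∞ (mobiusFactor f) Ω :=
      (contDiffOn_const.mul hnsq).congr hmob
    exact (h1.log fun w hw => by rw [hmob w hw]; have := hpos w hw; positivity).div_const 2
  have hG : ContDiffOn ℝ ∞ (fun w => ((Real.log (mobiusFactor f w) / 2 : ℝ) : ℂ)) Ω :=
    Complex.ofRealCLM.contDiff.comp_contDiffOn hg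
  obtain ⟨x, hx⟩ := hk.exists_right_inv
  obtain ⟨G, hgr⟩ : ∃ G : Smooth Ω,
      Repr G (fun w => ((Real.log (mobiusFactor f w) / 2 : ℝ) : ℂ)) :=
    ⟨Smooth.mk _ hG, fun w hw => (fn_mk _ hG hw).symm⟩
  obtain ⟨χ, hχ⟩ : ∃ χ, (wirtinger Ω).D k = χ * k :=
    ⟨(wirtinger Ω).D k * x, by linear_combination (-(wirtinger Ω).D k) * hx⟩
  have hl : (wirtinger Ω).LogDeriv k χ θ := ⟨hk, hχ, hθ⟩
  -- `G` is `ω`. Differentiating `e^{2G} = 4 |k|²` gives `G_z̄` without differentiating the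
  -- logarithm.
  have hexp : ∀ w ∈ Ω, fn (4 * (k * star k)) w = Complex.exp (fn (2 * G) w) := fun w hw => by
    have hm : 0 < mobiusFactor f w := by rw [hmob w hw]; have := hpos w hw; positivity
    rw [fn_mul 2, fn_ofNat 2 hw, ← hgr w hw]
    push_cast
    rw [mul_div_cancel₀ _ (two_ne_zero), ← Complex.ofReal_exp, Real.exp_log hm, hmob w hw,
      fn_mul, fn_mul, fn_star, fn_ofNat 4 hw]
    push_cast
    rw [← Complex.mul_conj]; rfl
  have key : (wirtinger Ω).D' (2 * G) = θ + star χ := by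
    refine (hk.mul hk.star).mul_left_cancel (two_cancel (two_cancel ?_))
    have e1 : (wirtinger Ω).D' (4 * (k * star k)) = 4 * (k * star k) * (wirtinger Ω).D' (2 * G) :=
      ext_fn fun w hw => by
        rw [fn_mul _ ((wirtinger Ω).D' _), fn_D' _ hw, fn_D' _ hw, hexp w hw,
          dzbar_congr (eventuallyEq hexp hw), dzbar_cexp (differentiableAt_fn _ hw)]
    have h4 : (wirtinger Ω).D' (4 : Smooth Ω) = 0 := (wirtinger Ω).D'.map_natCast 4
    rw [Wirtinger.D'_mul, Wirtinger.D'_mul, h4, hl.D', hl.D'_star] at e1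
    linear_combination -e1
  have key2 : 2 * (wirtinger Ω).D ((wirtinger Ω).D' G)
      = (wirtinger Ω).D θ + star ((wirtinger Ω).D θ) := by
    have := congrArg (wirtinger Ω).D key
    rw [Wirtinger.D'_mul, Wirtinger.D'_two, map_add, map_add, hl.D_star_chi, Wirtinger.D_mul,
      Wirtinger.D_mul, Wirtinger.D_two, map_zero] at this
    linear_combination this
  have hlap := laplacian_eq_dz_dzbar
    (contDiffAt_infty.mp (hg.contDiffAt (Ω.isOpen.mem_nhds hz)) 2)
  rw [hgr.dzbar.dz z hz] at hlap
  have e := congrArg (fun a => fn a z) key2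
  simp only [fn_mul, fn_add, fn_star, fn_ofNat 2 hz] at e
  have e3 : Laplacian.laplacian (fun w : ℂ => Real.log (mobiusFactor f w) / 2) z
      = 4 * (fn ((wirtinger Ω).D θ) z).re := by
    apply Complex.ofReal_injective
    rw [hlap]
    have : fn ((wirtinger Ω).D θ) z + star (fn ((wirtinger Ω).D θ) z)
        = 2 * ((fn ((wirtinger Ω).D θ) z).re : ℂ) := by
      have := Complex.add_conj (fn ((wirtinger Ω).D θ) z)
      rw [Complex.star_def, this]; push_cast; ring
    rw [this] at e
    push_cast
    linear_combination 2 * e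
  rw [localK, e3, mobiusFactor]
  have hne : (hopfSq f z).re ≠ 0 := by
    rw [hsq z hz, Complex.ofReal_re]; exact (hpos z hz).ne'
  field_simp

end Frame

end

/-! ### Canonical lifts, holomorphic substitutions and existence of frames -/

section

open Topology TopologicalSpace Smooth

variable {Ω : Opens ℂ}

/-! ### The canonical lift of a conformal map -/

/-- A smooth conformal map from an open subset of `ℂ` to `S³`. -/
structure IsConformalOn (f : ℂ → E4) (Ω : Opens ℂ) : Prop where
  smooth : ContDiffOn ℝ ∞ f Ω
  conformal : ∀ z ∈ Ω, ConformalAt f z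
  norm_eq : ∀ z ∈ Ω, ‖f z‖ = 1

lemma _root_.ConformalAt.exists_factor {f : ℂ → E4} {z : ℂ} (h : ConformalAt f z) :
    ∃ c : ℝ, 0 < c ∧ (∀ v, ‖fderiv ℝ f z v‖ = c * ‖v‖) ∧
      inner ℝ (fderiv ℝ f z 1) (fderiv ℝ f z Complex.I) = 0 := by
  obtain ⟨c, hc, h⟩ := conformalAt_iff'.mp h
  refine ⟨√c, Real.sqrt_pos.mpr hc, fun v => ?_, ?_⟩
  · have := h v v
    rw [real_inner_self_eq_norm_sq, real_inner_self_eq_norm_sq] at this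
    rw [← Real.sqrt_sq (norm_nonneg (fderiv ℝ f z v)), this, Real.sqrt_mul hc.le,
      Real.sqrt_sq (norm_nonneg v)]
  · rw [h]; simp

lemma sum_sq_eq {x : E4} : ∑ i, x i * x i = ‖x‖ ^ 2 := by
  rw [EuclideanSpace.norm_sq_eq]
  exact Finset.sum_congr rfl fun i _ => by rw [Real.norm_eq_abs, sq_abs, sq]

namespace IsConformalOn

variable {f : ℂ → E4} (h : IsConformalOn f Ω)
include h

lemma differentiableAt {z : ℂ} (hz : z ∈ Ω) : DifferentiableAt ℝ f z :=
  (h.conformal z hz).differentiableAt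

lemma mono {Ω' : Opens ℂ} (hΩ : Ω' ≤ Ω) : IsConformalOn f Ω' :=
  ⟨h.smooth.mono hΩ, fun z hz => h.conformal z (hΩ hz), fun z hz => h.norm_eq z (hΩ hz)⟩

lemma smooth_coord (i : Fin 4) : ContDiffOn ℝ ∞ (fun z => ((f z i : ℝ) : ℂ)) Ω :=
  Complex.ofRealCLM.contDiff.comp_contDiffOn ((contDiffOn_euclidean (𝕜 := ℝ)).mp h.smooth i)

lemma fderiv_coord {z : ℂ} (hz : z ∈ Ω) (i : Fin 4) (v : ℂ) :
    fderiv ℝ (fun w => ((f w i : ℝ) : ℂ)) z v = ((fderiv ℝ f z v i : ℝ) : ℂ) := by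
  have h1 := (EuclideanSpace.proj (𝕜 := ℝ) i : E4 →L[ℝ] ℝ).hasFDerivAt.comp z
    (h.differentiableAt hz).hasFDerivAt
  have h2 := Complex.ofRealCLM.hasFDerivAt.comp z h1
  have h3 : fderiv ℝ (fun w => ((f w i : ℝ) : ℂ)) z = _ := h2.fderiv
  rw [h3]; rfl

lemma smooth_lightVec (i : Fin 5) : ContDiffOn ℝ ∞ (fun z => ((lightVec (f z) i : ℝ) : ℂ)) Ω := by
  obtain rfl | ⟨j, rfl⟩ := Fin.eq_zero_or_eq_succ i
  · simpa [lightVec] using contDiffOn_const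
  · exact h.smooth_coord j

lemma fderiv_ne_zero {z : ℂ} (hz : z ∈ Ω) : fderiv ℝ f z 1 ≠ 0 := by
  obtain ⟨c, hc, h1, -⟩ := (h.conformal z hz).exists_factor
  rw [← norm_ne_zero_iff, h1]; simpa using hc.ne'

lemma smooth_factor : ContDiffOn ℝ ∞ (fun z => ((‖fderiv ℝ f z 1‖⁻¹ : ℝ) : ℂ)) Ω := by
  have h1 : ContDiffOn ℝ ∞ (fun z => fderiv ℝ f z 1) Ω :=
    (h.smooth.fderiv_of_isOpen Ω.isOpen (by simp)).clm_apply contDiffOn_const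
  exact Complex.ofRealCLM.contDiff.comp_contDiffOn
    ((h1.norm ℝ fun z hz => h.fderiv_ne_zero hz).inv
      fun z hz => norm_ne_zero_iff.mpr (h.fderiv_ne_zero hz))

/-- The lift is `r F` with `F = (1, f)`. Since `⟨F, F⟩ = ⟨F, F_z⟩ = 0`, derivatives of `r` drop out,
and what remains is `|f_x| = |f_y|`, `f_x ⊥ f_y` and the choice `r = |f_x|⁻¹`. -/
lemma exists_lift : ∃ Y : Fin 5 → Smooth Ω, VRepr Y (lift f) ∧ (wirtinger Ω).IsLift Y := by
  obtain ⟨r, hr⟩ : ∃ r : Smooth Ω, ∀ z ∈ Ω, fn r z = ((‖fderiv ℝ f z 1‖⁻¹ : ℝ) : ℂ) :=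
    ⟨Smooth.mk _ h.smooth_factor, fun z hz => fn_mk _ h.smooth_factor hz⟩
  obtain ⟨F, hF⟩ : ∃ F : Fin 5 → Smooth Ω, ∀ i, ∀ z ∈ Ω, fn (F i) z = (lightVec (f z) i : ℂ) :=
    ⟨fun i => Smooth.mk _ (h.smooth_lightVec i), fun i z hz => fn_mk _ (h.smooth_lightVec i) hz⟩
  have hFs : ∀ (i : Fin 4), ∀ z ∈ Ω, fn (F i.succ) z = ((f z i : ℝ) : ℂ) := fun i => hF i.succ
  have D0 : (wirtinger Ω).D (F 0) = 0 ∧ (wirtinger Ω).D' (F 0) = 0 := by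
    have : F 0 = 1 := ext_fn fun z hz => by rw [hF 0 z hz, fn_one hz]; simp [lightVec]
    rw [this, Derivation.map_one_eq_zero, Derivation.map_one_eq_zero]; simp
  have DF : ∀ (i : Fin 4), ∀ z ∈ Ω, fn ((wirtinger Ω).D (F i.succ)) z
      = 1 / 2 * (fderiv ℝ f z 1 i - Complex.I * fderiv ℝ f z Complex.I i) := fun i z hz => by
    rw [fn_D _ hz, dz_congr (eventuallyEq (hFs i) hz), dz, h.fderiv_coord hz, h.fderiv_coord hz]
    rfl
  have D'F : ∀ (i : Fin 4), ∀ z ∈ Ω, fn ((wirtinger Ω).D' (F i.succ)) z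
      = 1 / 2 * (fderiv ℝ f z 1 i + Complex.I * fderiv ℝ f z Complex.I i) := fun i z hz => by
    rw [fn_D' _ hz, dzbar_congr (eventuallyEq (hFs i) hz), dzbar, h.fderiv_coord hz,
      h.fderiv_coord hz]
    rfl
  have sF : star F = F := by
    ext i : 1
    refine ext_fn fun z hz => ?_
    rw [Pi.star_apply, fn_star, hF i z hz]; exact Complex.conj_ofReal _
  have sr : star r = r := ext_fn fun z hz => by
    rw [fn_star, hr z hz]; exact Complex.conj_ofReal _
  have FF : bform F F = 0 := ext_fn fun z hz => by
    rw [fn_bform, fn_zero]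
    simp only [hF _ z hz, bform]
    have e := sum_sq_eq (x := f z)
    rw [h.norm_eq z hz] at e
    have : ((∑ i, f z i * f z i : ℝ) : ℂ) = 1 := by rw [e]; norm_num
    push_cast at this
    simp [lightVec, this]
  have nrm : ∀ z ∈ Ω, (∑ i, fderiv ℝ f z 1 i * fderiv ℝ f z 1 i
        = ‖fderiv ℝ f z 1‖ ^ 2) ∧ (∑ i, fderiv ℝ f z Complex.I i * fderiv ℝ f z Complex.I i
        = ‖fderiv ℝ f z 1‖ ^ 2) ∧ (∑ i, fderiv ℝ f z 1 i * fderiv ℝ f z Complex.I i = 0) := by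
    intro z hz
    obtain ⟨c, hc, h1, h2⟩ := (h.conformal z hz).exists_factor
    refine ⟨sum_sq_eq, by rw [sum_sq_eq, h1, h1]; simp, ?_⟩
    rw [← h2, PiLp.inner_apply]
    exact Finset.sum_congr rfl fun i _ => by simp [mul_comm]
  have FDF : bform F ((wirtinger Ω).vD F) = 0 := by
    have := congrArg (wirtinger Ω).D FF
    rw [Wirtinger.D_bform, bform_comm _ F, map_zero] at this
    exact two_cancel (by linear_combination this)
  have FD'F : bform F ((wirtinger Ω).vD' F) = 0 := by
    have := congrArg star FDF
    rwa [star_bform, Wirtinger.star_vD, sF, star_zero] at this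
  have DFDF : bform ((wirtinger Ω).vD F) ((wirtinger Ω).vD F) = 0 := ext_fn fun z hz => by
    obtain ⟨n1, n2, n3⟩ := nrm z hz
    rw [fn_bform, fn_zero]
    simp only [bform, Wirtinger.vD, D0, fn_zero, DF _ z hz]
    have n1' := congrArg (fun x : ℝ => (x : ℂ)) n1
    have n2' := congrArg (fun x : ℝ => (x : ℂ)) n2
    have n3' := congrArg (fun x : ℝ => (x : ℂ)) n3
    push_cast [Fin.sum_univ_four] at n1' n2' n3' ⊢
    linear_combination (1 / 4 : ℂ) * n1' + (Complex.I ^ 2 / 4) * n2' - (Complex.I / 2) * n3'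
      + (1 / 4 : ℂ) * ‖fderiv ℝ f z 1‖ ^ 2 * Complex.I_mul_I
  have DFD'F : ∀ z ∈ Ω, fn (bform ((wirtinger Ω).vD F) ((wirtinger Ω).vD' F)) z
      = ((‖fderiv ℝ f z 1‖ ^ 2 / 2 : ℝ) : ℂ) := fun z hz => by
    obtain ⟨n1, n2, n3⟩ := nrm z hz
    rw [fn_bform]
    simp only [bform, Wirtinger.vD, Wirtinger.vD', D0, fn_zero, DF _ z hz, D'F _ z hz]
    have n1' := congrArg (fun x : ℝ => (x : ℂ)) n1
    have n2' := congrArg (fun x : ℝ => (x : ℂ)) n2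
    push_cast [Fin.sum_univ_four] at n1' n2' ⊢
    linear_combination (1 / 4 : ℂ) * n1' - (Complex.I ^ 2 / 4) * n2'
      - (1 / 4 : ℂ) * ‖fderiv ℝ f z 1‖ ^ 2 * Complex.I_mul_I
  refine ⟨r • F, fun z hz => ?_, by rw [star_smul, sr, sF], ?_, ?_, ?_⟩
  · ext i
    simp [lift, fn_mul, hr z hz, hF i z hz]
  · rw [bform_smul_left, bform_smul_right, FF]; ring
  · simp only [Wirtinger.vD_smul, bform_add_left, bform_add_right, bform_smul_left,
      bform_smul_right, FF, FDF, bform_comm _ F, DFDF]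
    ring
  · simp only [Wirtinger.vD_smul, Wirtinger.vD'_smul, bform_add_left, bform_add_right,
      bform_smul_left, bform_smul_right, FF, FDF, FD'F, bform_comm _ F]
    refine ext_fn fun z hz => ?_
    simp only [fn_add, fn_mul, fn_zero, fn_ofNat 2 hz, fn_one hz, DFD'F z hz, hr z hz]
    have := norm_ne_zero_iff.mpr (h.fderiv_ne_zero hz)
    push_cast
    have : (‖fderiv ℝ f z 1‖ : ℂ) ≠ 0 := by exact_mod_cast this
    field_simp
    ring

end IsConformalOn

/-! ### Composition with holomorphic maps -/

section Comp

variable {Ω' : Opens ℂ}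

/-- Composition with a smooth map. -/
def Smooth.comp (τ : ℂ → ℂ) (hτ : ContDiffOn ℝ ∞ τ Ω') (hm : ∀ z ∈ Ω', τ z ∈ Ω) :
    Smooth Ω →+* Smooth Ω' where
  toFun g := Smooth.mk (fun z => fn g (τ z)) ((smooth_fn g).comp hτ hm)
  map_one' := ext_fn fun z hz => by rw [fn_mk _ _ hz, fn_one hz, fn_one (hm z hz)]
  map_zero' := ext_fn fun z hz => by rw [fn_mk _ _ hz, fn_zero, fn_zero]
  map_mul' g h := ext_fn fun z hz => by
    rw [fn_mul, fn_mk _ _ hz, fn_mk _ _ hz, fn_mk _ _ hz, fn_mul]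
  map_add' g h := ext_fn fun z hz => by
    rw [fn_add, fn_mk _ _ hz, fn_mk _ _ hz, fn_mk _ _ hz, fn_add]

lemma Smooth.fn_comp {τ : ℂ → ℂ} (hτ : ContDiffOn ℝ ∞ τ Ω') (hm : ∀ z ∈ Ω', τ z ∈ Ω)
    (g : Smooth Ω) {z : ℂ} (hz : z ∈ Ω') : fn (Smooth.comp τ hτ hm g) z = fn g (τ z) :=
  fn_mk _ ((smooth_fn g).comp hτ hm) hz

lemma fderiv_eq_dz_dzbar (g : ℂ → ℂ) (z v : ℂ) :
    fderiv ℝ g z v = dz g z * v + dzbar g z * star v := by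
  have hv : v = v.re • (1 : ℂ) + v.im • Complex.I := by simp [Complex.re_add_im]
  have h1 : fderiv ℝ g z v = v.re * fderiv ℝ g z 1 + v.im * fderiv ℝ g z Complex.I := by
    conv_lhs => rw [hv]
    rw [map_add, map_smul, map_smul]; simp
  have h2 : star v = v.re - v.im * Complex.I := by
    rw [Complex.star_def]; apply Complex.ext <;> simp
  have h3 : v = v.re + v.im * Complex.I := (Complex.re_add_im v).symm
  rw [h1, h2]
  nth_rewrite 3 [h3]
  simp only [dz, dzbar, smul_eq_mul]
  linear_combination ((v.im : ℂ) * fderiv ℝ g z Complex.I) * Complex.I_mul_I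

lemma contDiffOn_of_holomorphic {τ : ℂ → ℂ} (hτ : DifferentiableOn ℂ τ Ω') :
    ContDiffOn ℝ ∞ τ Ω' :=
  ((hτ.contDiffOn Ω'.isOpen).restrict_scalars ℝ)

lemma dz_comp_holomorphic {τ g : ℂ → ℂ} {z : ℂ} (hτ : DifferentiableAt ℂ τ z)
    (hg : DifferentiableAt ℝ g (τ z)) :
    dz (fun w => g (τ w)) z = deriv τ z * dz g (τ z) := by
  have h1 : HasFDerivAt τ (((1 : ℂ →L[ℂ] ℂ).smulRight (deriv τ z)).restrictScalars ℝ) z :=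
    hτ.hasDerivAt.hasFDerivAt.restrictScalars ℝ
  have h2 := (hg.hasFDerivAt.comp z h1).fderiv
  have h3 : fderiv ℝ (fun w => g (τ w)) z = _ := h2
  rw [dz, h3]
  simp only [ContinuousLinearMap.comp_apply, fderiv_eq_dz_dzbar g]
  simp
  linear_combination (-(1 / 2) * dz g (τ z) * deriv τ z
    + 1 / 2 * dzbar g (τ z) * (starRingEnd ℂ) (deriv τ z)) * Complex.I_mul_I

lemma isCoordChange_comp {τ : ℂ → ℂ} (hτ : DifferentiableOn ℂ τ Ω') (hm : ∀ z ∈ Ω', τ z ∈ Ω)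
    {a : Smooth Ω'} (ha : ∀ z ∈ Ω', fn a z = deriv τ z) (hne : ∀ z ∈ Ω', deriv τ z ≠ 0) :
    (wirtinger Ω).IsCoordChange (wirtinger Ω')
      (Smooth.comp τ (contDiffOn_of_holomorphic hτ) hm) a where
  star_map g := ext_fn fun z hz => by
    rw [fn_star, fn_comp _ _ _ hz, fn_comp _ _ _ hz, fn_star]
  D_map g := ext_fn fun z hz => by
    rw [fn_mul, fn_D _ hz, ha z hz, fn_comp _ _ _ hz, fn_D _ (hm z hz),
      dz_congr (eventuallyEq (fun w hw => fn_comp _ hm g hw) hz),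
      dz_comp_holomorphic (hτ.differentiableAt (Ω'.isOpen.mem_nhds hz))
        (differentiableAt_fn g (hm z hz))]
  unit := isUnit_iff.mpr fun z hz => by rw [ha z hz]; exact hne z hz
  D' := ext_fn fun z hz => by
    have h1 : DifferentiableAt ℂ (deriv τ) z :=
      (hτ.deriv Ω'.isOpen).differentiableAt (Ω'.isOpen.mem_nhds hz)
    have h2 : fderiv ℝ (deriv τ) z
        = ((1 : ℂ →L[ℂ] ℂ).smulRight (deriv (deriv τ) z)).restrictScalars ℝ :=
      (h1.hasDerivAt.hasFDerivAt.restrictScalars ℝ).fderiv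
    rw [fn_D' _ hz, dzbar_congr (eventuallyEq ha hz), fn_zero, dzbar, h2]
    simp
    linear_combination deriv (deriv τ) z * Complex.I_mul_I

end Comp

/-! ### Existence of frames -/

/-- For a real vector orthogonal to `(1, x)` the Lorentz square is `∑ (m_i - m_0 x_i)²`: the
orthogonal complement of a null line is semidefinite with that line as kernel. -/
lemma normal_pos {x : E4} (hx : ‖x‖ = 1) {m : Fin 5 → ℂ} (hm : star m = m)
    (h : bform m (fun i => ((lightVec x i : ℝ) : ℂ)) = 0) :
    0 ≤ (bform m m).re ∧
      ((bform m m).re = 0 → m = m 0 • fun i => ((lightVec x i : ℝ) : ℂ)) := by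
  obtain ⟨a, rfl⟩ : ∃ a : Fin 5 → ℝ, m = fun i => (a i : ℂ) :=
    ⟨fun i => (m i).re, by ext i; exact (Complex.conj_eq_iff_re.mp (congrFun hm i)).symm⟩
  have e1 : bform (fun i => (a i : ℂ)) (fun i => (a i : ℂ)) = ((bform a a : ℝ) : ℂ) := by
    simp [bform]
  have e2 : bform a (lightVec x) = 0 := by
    have : bform (fun i => (a i : ℂ)) (fun i => ((lightVec x i : ℝ) : ℂ))
        = ((bform a (lightVec x) : ℝ) : ℂ) := by simp [bform]
    rw [this] at h; exact_mod_cast h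
  have e3 := sum_sq_eq (x := x)
  rw [hx] at e3
  have e4 : bform a a = ∑ i : Fin 4, (a i.succ - a 0 * x i) ^ 2 := by
    simp only [bform, lightVec, Fin.cons_zero, Fin.cons_succ, Fin.sum_univ_four] at e2 e3 ⊢
    linear_combination (2 * a 0) * e2 - (a 0) ^ 2 * e3
  rw [e1, Complex.ofReal_re, e4]
  refine ⟨Finset.sum_nonneg fun i _ => sq_nonneg _, fun h0 => ?_⟩
  rw [Finset.sum_eq_zero_iff_of_nonneg fun i _ => sq_nonneg _] at h0
  ext i
  obtain rfl | ⟨j, rfl⟩ := Fin.eq_zero_or_eq_succ i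
  · simp [lightVec]
  · have := h0 j (Finset.mem_univ _)
    have h5 : a j.succ = a 0 * x j := by rw [sq_eq_zero_iff] at this; linarith
    simp [lightVec, h5]

/-- A real normal section is taken as the real part of a multiple of `κ`, which is possible because
`κ ≠ 0` at the point. It is then normalised on the neighbourhood where its square is positive. -/
lemma IsConformalOn.exists_frame {f : ℂ → E4} (h : IsConformalOn f Ω) {z₀ : ℂ} (hz₀ : z₀ ∈ Ω)
    (hκ : hopf f z₀ ≠ 0) : ∃ Ω' ≤ Ω, z₀ ∈ Ω' ∧ ∃ Y n : Fin 5 → Smooth Ω', VRepr Y (lift f) ∧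
      (wirtinger Ω').IsFrame Y n := by
  obtain ⟨Y, hY, hL⟩ := h.exists_lift
  obtain ⟨i, hi⟩ : ∃ i, hopf f z₀ i ≠ 0 := by
    by_contra! h0; exact hκ (funext h0)
  have hκr := Frame.repr_normalProj hY hY.dz.dz z₀ hz₀
  -- With this constant the `i`-th component of `cκ` plus its conjugate is `2 |κ_i|² ≠ 0` at `z₀`.
  obtain ⟨c, hc⟩ : ∃ c : Smooth Ω, fn c z₀ = star (hopf f z₀ i) :=
    ⟨Smooth.mk (fun _ => star (hopf f z₀ i)) contDiffOn_const, fn_mk _ contDiffOn_const hz₀⟩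
  obtain ⟨ν, hν, sν, νY, νz, νzzb⟩ :=
    hL.exists_real_normal c ((wirtinger Ω).vD ((wirtinger Ω).vD Y))
  have νne : fn (ν i) z₀ ≠ 0 := by
    have e : fn ((wirtinger Ω).normalProj Y ((wirtinger Ω).vD ((wirtinger Ω).vD Y)) i) z₀
        = hopf f z₀ i := (congrFun hκr i).symm
    rw [hν]
    simp only [Pi.add_apply, Pi.smul_apply, Pi.star_apply, smul_eq_mul, fn_add, fn_mul, fn_star,
      e, hc]
    have : star (hopf f z₀ i) * hopf f z₀ i + star (star (hopf f z₀ i) * hopf f z₀ i)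
        = 2 * (Complex.normSq (hopf f z₀ i) : ℂ) := by
      rw [star_mul', star_star, ← Complex.mul_conj, Complex.star_def]; ring
    rw [this]
    exact mul_ne_zero two_ne_zero (by exact_mod_cast (Complex.normSq_pos.mpr hi).ne')
  obtain ⟨b, hb⟩ : ∃ b, b = bform ν ν := ⟨_, rfl⟩
  have sb : star b = b := by rw [hb, star_bform, sν]
  have breal : ∀ z, fn b z = ((fn b z).re : ℂ) := fun z => by
    have := fn_star b z
    rw [sb] at this
    exact (Complex.conj_eq_iff_re.mp this.symm).symm
  have bpos : 0 < (fn b z₀).re := by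
    have hs : star (fun i => fn (ν i) z₀) = fun i => fn (ν i) z₀ := by
      ext i; rw [Pi.star_apply, ← fn_star]; exact congrArg (fn · z₀) (congrFun sν i)
    have hr : (((‖fderiv ℝ f z₀ 1‖⁻¹ : ℝ)) : ℂ) ≠ 0 := by
      exact_mod_cast inv_ne_zero (norm_ne_zero_iff.mpr (h.fderiv_ne_zero hz₀))
    have hYz : (fun i => fn (Y i) z₀)
        = (((‖fderiv ℝ f z₀ 1‖⁻¹ : ℝ)) : ℂ) • fun i => ((lightVec (f z₀) i : ℝ) : ℂ) := by
      rw [← hY z₀ hz₀]; ext i; simp [lift]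
    have h0 : bform (fun i => fn (ν i) z₀) (fun i => ((lightVec (f z₀) i : ℝ) : ℂ)) = 0 := by
      have := congrArg (fn · z₀) νY
      simp only [fn_bform, hYz, bform_smul_right, fn_zero] at this
      exact (mul_eq_zero.mp this).resolve_left hr
    obtain ⟨p1, p2⟩ := normal_pos (h.norm_eq z₀ hz₀) hs h0
    rw [hb, fn_bform]
    refine lt_of_le_of_ne p1 fun e => ?_
    have e1 := p2 e.symm
    -- A null `ν` would be a multiple of `Y` at `z₀`. Then `⟨ν, Y_{zz̄}⟩ = 0` and `⟨Y, Y_{zz̄}⟩ =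
    -- -1/2` make the multiple zero.
    have e2 := congrArg (fn · z₀) νzzb
    have e3 := congrArg (fn · z₀) hL.Y_zzb
    simp only [fn_bform, fn_mul, fn_neg, fn_one hz₀, fn_zero, hYz, fn_ofNat 2 hz₀] at e2 e3
    rw [e1, bform_smul_left] at e2
    rw [bform_smul_left] at e3
    have e4 : fn (ν 0) z₀ = 0 := by
      refine (mul_eq_zero.mp e2).resolve_right fun e5 => ?_
      rw [e5] at e3; simp at e3
    exact νne (by have := congrFun e1 i; simpa [e4] using this)
  have hcont : ContinuousOn (fun z => (fn b z).re) Ω :=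
    Complex.continuous_re.comp_continuousOn (smooth_fn b).continuousOn
  obtain ⟨Ω', hΩ'⟩ : ∃ Ω' : Opens ℂ, ∀ z, z ∈ Ω' ↔ z ∈ Ω ∧ 0 < (fn b z).re :=
    ⟨⟨_, hcont.isOpen_inter_preimage Ω.isOpen isOpen_Ioi⟩, fun z => Iff.rfl⟩
  have hle : Ω' ≤ Ω := fun z hz => ((hΩ' z).mp hz).1
  refine ⟨Ω', hle, (hΩ' z₀).mpr ⟨hz₀, bpos⟩, ?_⟩
  obtain ⟨Y', hY', hL'⟩ := (h.mono hle).exists_lift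
  have hx : ContDiffOn ℝ ∞ (fun z => (((√(fn b z).re)⁻¹ : ℝ) : ℂ)) Ω' := by
    have h1 : ContDiffOn ℝ ∞ (fun z => (fn b z).re) Ω' :=
      Complex.reCLM.contDiff.comp_contDiffOn ((smooth_fn b).mono hle)
    exact Complex.ofRealCLM.contDiff.comp_contDiffOn
      ((h1.sqrt fun z hz => ((hΩ' z).mp hz).2.ne').inv
        fun z hz => (Real.sqrt_pos.mpr ((hΩ' z).mp hz).2).ne')
  obtain ⟨x, hx⟩ : ∃ x : Smooth Ω', ∀ z ∈ Ω', fn x z = (((√(fn b z).re)⁻¹ : ℝ) : ℂ) :=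
    ⟨Smooth.mk _ hx, fun z hz => fn_mk _ hx hz⟩
  -- Restriction to `Ω'` is treated as the coordinate change `id`, so it commutes with the
  -- derivations.
  have hid : DifferentiableOn ℂ (id : ℂ → ℂ) Ω' := differentiableOn_id
  have hc := isCoordChange_comp (Ω := Ω) hid hle (a := 1)
    (fun z hz => by rw [fn_one hz]; simp) (fun z _ => by simp)
  have fnc : ∀ (g : Smooth Ω), ∀ z ∈ Ω',
      fn (Smooth.comp id (contDiffOn_of_holomorphic hid) hle g) z = fn g z :=
    fun g z hz => fn_comp _ _ g hz
  generalize Smooth.comp id (contDiffOn_of_holomorphic hid) hle = C at hc fnc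
  have eY : Y' = fun i => C (Y i) := by
    ext i : 1
    refine ext_fn fun z hz => ?_
    rw [fnc _ z hz]
    exact congrFun ((hY' z hz).symm.trans (hY z (hle hz))) i
  have cD : ∀ v : Fin 5 → Smooth Ω, (wirtinger Ω').vD (fun i => C (v i))
      = fun i => C ((wirtinger Ω).vD v i) := fun v => by
    ext i : 1; exact (hc.D_map _).trans (one_mul _)
  have cD' : ∀ v : Fin 5 → Smooth Ω, (wirtinger Ω').vD' (fun i => C (v i))
      = fun i => C ((wirtinger Ω).vD' v i) := fun v => by
    ext i : 1; exact (hc.D'_map _).trans (by rw [star_one, one_mul]; rfl)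
  refine ⟨Y', x • fun i => C (ν i), hY', hL'.isFrame_smul ?_ ?_ ?_ ?_ ?_ ?_⟩
  · ext i : 1; rw [Pi.star_apply, hc.star_map]; exact congrArg C (congrFun sν i)
  · rw [eY, Wirtinger.IsCoordChange.map_bform, νY, map_zero]
  · rw [eY, cD, Wirtinger.IsCoordChange.map_bform, νz, map_zero]
  · rw [eY, cD', cD, Wirtinger.IsCoordChange.map_bform, νzzb, map_zero]
  · exact ext_fn fun z hz => by rw [fn_star, hx z hz]; exact Complex.conj_ofReal _
  · rw [Wirtinger.IsCoordChange.map_bform, ← hb]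
    refine ext_fn fun z hz => ?_
    rw [fn_mul, fn_mul, hx z hz, fnc _ z hz, fn_one hz, breal z]
    have := ((hΩ' z).mp hz).2
    rw [Complex.ofReal_re]
    norm_cast
    rw [← mul_inv, Real.mul_self_sqrt this.le, inv_mul_cancel₀ this.ne']

end

/-! ### Constant Lorentz matrices and a Lorentz basis from a flat frame -/

section

open Topology TopologicalSpace Smooth

/-! ### Constant Lorentz transformations -/

namespace Wirtinger

variable {R : Type*} [CommRing R] [StarRing R] [Algebra ℂ R] (W : Wirtinger R)

lemma vD_mulVec {M : Matrix (Fin 5) (Fin 5) R} (hM : ∀ i j, W.D (M i j) = 0) (v : Fin 5 → R) :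
    W.vD (M.mulVec v) = M.mulVec (W.vD v) := by
  ext i
  simp [vD, Matrix.mulVec, dotProduct, map_sum, W.D_mul, hM]

lemma vD'_mulVec {M : Matrix (Fin 5) (Fin 5) R} (hM : ∀ i j, W.D' (M i j) = 0) (v : Fin 5 → R) :
    W.vD' (M.mulVec v) = M.mulVec (W.vD' v) := by
  ext i
  simp [vD', Matrix.mulVec, dotProduct, map_sum, W.D'_mul, hM]

/-- A real constant matrix preserving the Lorentz form. -/
structure IsLorentz (M : Matrix (Fin 5) (Fin 5) R) : Prop where
  D : ∀ i j, W.D (M i j) = 0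
  star : ∀ i j, star (M i j) = M i j
  bform_eq : ∀ v w, bform (M.mulVec v) (M.mulVec w) = bform v w

variable {W} {M : Matrix (Fin 5) (Fin 5) R}

lemma IsLorentz.D' (h : W.IsLorentz M) (i j : Fin 5) : W.D' (M i j) = 0 := by
  rw [← h.star, ← W.star_D, h.D, star_zero]

lemma IsLorentz.star_mulVec (h : W.IsLorentz M) (v : Fin 5 → R) :
    Star.star (M.mulVec v) = M.mulVec (Star.star v) := by
  ext i
  simp [Matrix.mulVec, dotProduct, h.star]

lemma IsLift.mulVec {Y : Fin 5 → R} (h : W.IsLift Y) (hM : W.IsLorentz M) :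
    W.IsLift (M.mulVec Y) := by
  refine ⟨by rw [hM.star_mulVec, h.star_Y], ?_, ?_, ?_⟩
  · rw [hM.bform_eq, h.YY]
  · rw [W.vD_mulVec hM.D, hM.bform_eq, h.zz]
  · rw [W.vD_mulVec hM.D, W.vD'_mulVec hM.D', hM.bform_eq, h.zzb]

lemma IsFrame.of_mulVec {Y n : Fin 5 → R} (h : W.IsFrame (M.mulVec Y) (M.mulVec n))
    (hY : W.IsLift Y) (hM : W.IsLorentz M) (hn : Star.star n = n) :
    W.IsFrame Y n ∧ W.hopfCoeff (M.mulVec Y) (M.mulVec n) = W.hopfCoeff Y n := by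
  have h1 := h.nn
  have h2 := h.nY
  have h3 := h.nz
  have h4 := h.nzzb
  rw [hM.bform_eq] at h1 h2
  rw [W.vD_mulVec hM.D, hM.bform_eq] at h3
  rw [W.vD'_mulVec hM.D', W.vD_mulVec hM.D, hM.bform_eq] at h4
  exact ⟨⟨hY, hn, h1, h2, h3, h4⟩, by
    rw [hopfCoeff, W.vD_mulVec hM.D, W.vD_mulVec hM.D, hM.bform_eq, hopfCoeff]⟩

end Wirtinger

lemma lorentzMatrix_eq : lorentzMatrix = Matrix.diagonal ![-1, 1, 1, 1, 1] := by
  rw [lorentzMatrix]; congr 1; ext i; fin_cases i <;> rfl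

/-- The basis is `L + 2Y`, `(n + L)/√2`, `A + Ā`, `(n - L)/√2`, `i(A - Ā)`: the conserved vector,
then one pair for each quadratic first integral. Each first integral is twice the sum of squares of
the coordinates in its pair. -/
lemma lorentz_basis {Y n A L : Fin 5 → ℂ} (sY : star Y = Y) (sn : star n = n) (sL : star L = L)
    (YY : bform Y Y = 0) (YA : bform Y A = 0) (AA : bform A A = 0)
    (AA' : 2 * bform A (star A) = 1) (nn : bform n n = 1) (nY : bform n Y = 0)
    (nA : bform n A = 0) (nL : bform n L = 0) (LL : bform L L = 1) (LA : bform L A = 0)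
    (LY : 2 * bform L Y = -1) :
    ∃ E : Fin 5 → Fin 5 → ℝ, (∀ i j, bform (E i) (E j) = lorentzMatrix i j) ∧
      ∀ v : Fin 5 → ℝ,
        ((bform (E 0) v : ℝ) : ℂ) = bform (fun i => (v i : ℂ)) (L + (2 : ℂ) • Y) ∧
        ((2 * (bform (E 1) v * bform (E 1) v + bform (E 2) v * bform (E 2) v) : ℝ) : ℂ)
          = bform (fun i => (v i : ℂ)) (n + L) * bform (fun i => (v i : ℂ)) (n + L)
            + 2 * (bform (fun i => (v i : ℂ)) (A + star A)
              * bform (fun i => (v i : ℂ)) (A + star A)) ∧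
        ((2 * (bform (E 3) v * bform (E 3) v + bform (E 4) v * bform (E 4) v) : ℝ) : ℂ)
          = bform (fun i => (v i : ℂ)) (n - L) * bform (fun i => (v i : ℂ)) (n - L)
            - 2 * (bform (fun i => (v i : ℂ)) (A - star A)
              * bform (fun i => (v i : ℂ)) (A - star A)) := by
  have st : ∀ {v w : Fin 5 → ℂ} {c : ℂ}, bform v w = c → bform (star v) (star w) = star c :=
    fun h => by rw [← h, star_bform]
  have AA2 : bform A (star A) = 1 / 2 := by linear_combination AA' / 2
  have LY2 : bform L Y = -1 / 2 := by linear_combination LY / 2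
  have YA' : bform Y (star A) = 0 := by have := st YA; rwa [sY, star_zero] at this
  have nA' : bform n (star A) = 0 := by have := st nA; rwa [sn, star_zero] at this
  have LA' : bform L (star A) = 0 := by have := st LA; rwa [sL, star_zero] at this
  have A'A' : bform (star A) (star A) = 0 := by have := st AA; rwa [star_zero] at this
  have c1 : bform A Y = 0 := by rw [bform_comm, YA]
  have c2 : bform (star A) Y = 0 := by rw [bform_comm, YA']
  have c3 : bform A n = 0 := by rw [bform_comm, nA]
  have c4 : bform (star A) n = 0 := by rw [bform_comm, nA']
  have c5 : bform A L = 0 := by rw [bform_comm, LA]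
  have c6 : bform (star A) L = 0 := by rw [bform_comm, LA']
  have c7 : bform Y n = 0 := by rw [bform_comm, nY]
  have c8 : bform L n = 0 := by rw [bform_comm, nL]
  have c9 : bform Y L = -1 / 2 := by rw [bform_comm, LY2]
  have c10 : bform (star A) A = 1 / 2 := by rw [bform_comm, AA2]
  obtain ⟨s, hs, ss⟩ : ∃ s : ℂ, s * s = 1 / 2 ∧ star s = s := by
    refine ⟨((√(1 / 2) : ℝ) : ℂ), ?_, Complex.conj_ofReal _⟩
    rw [← Complex.ofReal_mul, Real.mul_self_sqrt (by norm_num)]; norm_num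
  let e : Fin 5 → Fin 5 → ℂ := ![L + (2 : ℂ) • Y, s • (n + L), A + star A, s • (n - L),
    Complex.I • (A - star A)]
  have he : ∀ i, star (e i) = e i := by
    intro i
    fin_cases i
    · simp [e, sL, sY]
    · simp [e, sn, sL, ss]
    · simp [e, add_comm]
    · simp [e, sn, sL, ss]
    · ext j; simp [e]; ring
  have hE : ∀ i, (fun j => ((e i j).re : ℂ)) = e i := fun i => by
    ext j; exact Complex.conj_eq_iff_re.mp (congrFun (he i) j)
  have cast : ∀ v w : Fin 5 → ℝ, ((bform v w : ℝ) : ℂ)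
      = bform (fun i => (v i : ℂ)) (fun i => (w i : ℂ)) := fun v w => by simp [bform]
  refine ⟨fun i j => (e i j).re, fun i j => ?_, fun v => ⟨?_, ?_, ?_⟩⟩
  · apply Complex.ofReal_injective
    rw [cast]
    simp only [hE]
    have hl : ((lorentzMatrix i j : ℝ) : ℂ)
        = if i = j then (![-1, 1, 1, 1, 1] : Fin 5 → ℂ) i else 0 := by
      rw [lorentzMatrix_eq, Matrix.diagonal_apply]
      split_ifs
      · fin_cases i <;> simp
      · simp
    rw [hl]
    fin_cases i <;> fin_cases j <;>
      simp only [e, Fin.zero_eta, Fin.mk_one, Fin.reduceFinMk, Matrix.cons_val, bform_add_left,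
        bform_add_right, bform_sub_left, bform_sub_right, bform_smul_left, bform_smul_right, YY, YA,
        AA, nn, nY, nA, nL, LL, LA, AA2, LY2, YA', nA', LA', A'A', c1, c2, c3, c4, c5, c6, c7, c8,
        c9, c10, Fin.reduceEq, if_true, if_false] <;>
      first
      | ring1
      | linear_combination (2 : ℂ) * hs
      | linear_combination (-1 : ℂ) * Complex.I_mul_I
  · rw [cast]; simp only [hE]; exact bform_comm _ _
  · push_cast
    rw [cast, cast]; simp only [hE]
    simp only [e, Matrix.cons_val]
    rw [bform_comm (s • (n + L)), bform_comm (A + star A), bform_smul_right]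
    linear_combination 2 * bform (fun i => (v i : ℂ)) (n + L)
      * bform (fun i => (v i : ℂ)) (n + L) * hs
  · push_cast
    rw [cast, cast]; simp only [hE]
    simp only [e, Matrix.cons_val]
    rw [bform_comm (s • (n - L)), bform_comm (Complex.I • (A - star A)), bform_smul_right,
      bform_smul_right]
    linear_combination 2 * bform (fun i => (v i : ℂ)) (n - L)
      * bform (fun i => (v i : ℂ)) (n - L) * hs + 2 * bform (fun i => (v i : ℂ)) (A - star A)
      * bform (fun i => (v i : ℂ)) (A - star A) * Complex.I_mul_I

end

/-! ### Adapted frames, coordinate independence, and constant modulus implies flat -/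

section

open Topology TopologicalSpace Smooth

variable {Ω Ω' : Opens ℂ} {f : ℂ → E4}

/-! ### Adapted frames near a point -/

lemma isUnit_hopfCoeff {Y n : Fin 5 → Smooth Ω} (hY : VRepr Y (lift f))
    (h : (wirtinger Ω).IsFrame Y n) (hκ : ∀ z ∈ Ω, hopf f z ≠ 0) :
    IsUnit ((wirtinger Ω).hopfCoeff Y n) := isUnit_iff.mpr fun z hz h0 => hκ z hz <| by
  rw [Frame.repr_hopf h hY z hz]
  ext i
  simp [fn_mul, h0]

lemma exists_logDeriv {k : Smooth Ω} (hk : IsUnit k) : ∃ θ, (wirtinger Ω).D' k = θ * k := by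
  obtain ⟨u, hu⟩ := hk.exists_left_inv
  exact ⟨(wirtinger Ω).D' k * u, by rw [mul_assoc, hu, mul_one]⟩

/-- A frame adapted to `f`, together with the logarithmic derivative of its Hopf coefficient. -/
structure Adapted (f : ℂ → E4) (Ω : Opens ℂ) (Y n : Fin 5 → Smooth Ω) (θ : Smooth Ω) : Prop where
  repr : VRepr Y (lift f)
  frame : (wirtinger Ω).IsFrame Y n
  unit : IsUnit ((wirtinger Ω).hopfCoeff Y n)
  D' : (wirtinger Ω).D' ((wirtinger Ω).hopfCoeff Y n) = θ * (wirtinger Ω).hopfCoeff Y n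

lemma IsConformalOn.exists_adapted (h : IsConformalOn f Ω) (hκ : ∀ z ∈ Ω, hopf f z ≠ 0) {z₀ : ℂ}
    (hz₀ : z₀ ∈ Ω) : ∃ Ω' ≤ Ω, z₀ ∈ Ω' ∧ ∃ Y n θ, Adapted f Ω' Y n θ := by
  obtain ⟨Ω', hle, hz, Y, n, hY, hf⟩ := h.exists_frame hz₀ (hκ z₀ hz₀)
  have hu := isUnit_hopfCoeff hY hf fun z hz => hκ z (hle hz)
  obtain ⟨θ, hθ⟩ := exists_logDeriv hu
  exact ⟨Ω', hle, hz, Y, n, θ, hY, hf, hu, hθ⟩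

namespace Adapted

variable {Y n : Fin 5 → Smooth Ω} {θ : Smooth Ω} (h : Adapted f Ω Y n θ)
include h

lemma localP_eq {z : ℂ} (hz : z ∈ Ω) :
    localP f z = -2 * fn ((wirtinger Ω).D θ) z / hopfSq f z - 2 :=
  Frame.localP_eq h.frame h.repr h.unit h.D' hz

lemma localK_eq {z : ℂ} (hz : z ∈ Ω) :
    localK f z = -(fn ((wirtinger Ω).D θ) z).re / (hopfSq f z).re :=
  Frame.localK_eq h.frame h.repr h.unit h.D' hz

lemma hopfSq_eq {z : ℂ} (hz : z ∈ Ω) :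
    hopfSq f z = ((Complex.normSq (fn ((wirtinger Ω).hopfCoeff Y n) z) : ℝ) : ℂ) :=
  Frame.hopfSq_eq h.frame h.repr hz

lemma hopfSq_pos {z : ℂ} (hz : z ∈ Ω) :
    0 < Complex.normSq (fn ((wirtinger Ω).hopfCoeff Y n) z) :=
  Complex.normSq_pos.mpr (isUnit_iff.mp h.unit z hz)

end Adapted

/-! ### Independence of the coordinate -/

/-- A conformal differential scales all directions equally, so `|(f ∘ τ)_x|` is `|τ'|` times the
factor of `f`. -/
lemma lift_comp (h : IsConformalOn f Ω) {g : ℂ → E4} {τ : ℂ → ℂ} (hτ : DifferentiableOn ℂ τ Ω')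
    (hm : ∀ z ∈ Ω', τ z ∈ Ω) (hg : ∀ z ∈ Ω', g z = f (τ z)) {z : ℂ} (hz : z ∈ Ω') (i : Fin 5) :
    lift g z i = ((‖deriv τ z‖⁻¹ : ℝ) : ℂ) * lift f (τ z) i := by
  have h1 : HasFDerivAt τ (((1 : ℂ →L[ℂ] ℂ).smulRight (deriv τ z)).restrictScalars ℝ) z :=
    (hτ.differentiableAt (Ω'.isOpen.mem_nhds hz)).hasDerivAt.hasFDerivAt.restrictScalars ℝ
  have h2 := (h.differentiableAt (hm z hz)).hasFDerivAt.comp z h1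
  have e : g =ᶠ[𝓝 z] f ∘ τ := by
    filter_upwards [Ω'.isOpen.mem_nhds hz] with w hw using hg w hw
  have h3 : fderiv ℝ g z 1 = fderiv ℝ f (τ z) (deriv τ z) := by
    rw [e.fderiv_eq, h2.fderiv]; simp
  obtain ⟨c, hc, hn, -⟩ := (h.conformal _ (hm z hz)).exists_factor
  simp only [lift, h3, hn, hg z hz]
  push_cast
  simp
  ring

/-- Both invariants are quotients of expressions in `θ_z` and `|k|²`, each of which is multiplied by
`|τ'|²`. -/
lemma localP_localK_comp (h : IsConformalOn f Ω) (hκ : ∀ z ∈ Ω, hopf f z ≠ 0) {g : ℂ → E4}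
    {τ : ℂ → ℂ} (hτ : DifferentiableOn ℂ τ Ω') (hne : ∀ z ∈ Ω', deriv τ z ≠ 0)
    (hm : ∀ z ∈ Ω', τ z ∈ Ω) (hg : ∀ z ∈ Ω', g z = f (τ z)) {z₀ : ℂ} (hz₀ : z₀ ∈ Ω') :
    localP g z₀ = localP f (τ z₀) ∧ localK g z₀ = localK f (τ z₀) := by
  obtain ⟨Ω₁, hle, hz₁, Y, n, θ, ad⟩ := h.exists_adapted hκ (hm z₀ hz₀)
  obtain ⟨Ω₂, hΩ₂⟩ : ∃ Ω₂ : Opens ℂ, ∀ z, z ∈ Ω₂ ↔ z ∈ Ω' ∧ τ z ∈ Ω₁ :=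
    ⟨⟨_, hτ.continuousOn.isOpen_inter_preimage Ω'.isOpen Ω₁.isOpen⟩, fun z => Iff.rfl⟩
  have hle₂ : Ω₂ ≤ Ω' := fun z hz => ((hΩ₂ z).mp hz).1
  have hm₂ : ∀ z ∈ Ω₂, τ z ∈ Ω₁ := fun z hz => ((hΩ₂ z).mp hz).2
  have hz₂ : z₀ ∈ Ω₂ := (hΩ₂ z₀).mpr ⟨hz₀, hz₁⟩
  have hτ₂ := hτ.mono hle₂
  have hne₂ : ∀ z ∈ Ω₂, deriv τ z ≠ 0 := fun z hz => hne z (hle₂ hz)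
  have sa : ContDiffOn ℝ ∞ (deriv τ) Ω₂ := contDiffOn_of_holomorphic (hτ₂.deriv Ω₂.isOpen)
  have sr : ContDiffOn ℝ ∞ (fun z => ((‖deriv τ z‖⁻¹ : ℝ) : ℂ)) Ω₂ :=
    Complex.ofRealCLM.contDiff.comp_contDiffOn
      ((sa.norm ℝ hne₂).inv fun z hz => norm_ne_zero_iff.mpr (hne₂ z hz))
  obtain ⟨a, ha⟩ : ∃ a : Smooth Ω₂, ∀ z ∈ Ω₂, fn a z = deriv τ z :=
    ⟨Smooth.mk _ sa, fun z hz => fn_mk _ sa hz⟩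
  obtain ⟨r, hr⟩ : ∃ r : Smooth Ω₂, ∀ z ∈ Ω₂, fn r z = ((‖deriv τ z‖⁻¹ : ℝ) : ℂ) :=
    ⟨Smooth.mk _ sr, fun z hz => fn_mk _ sr hz⟩
  have nrm : ∀ z, deriv τ z * star (deriv τ z) = (‖deriv τ z‖ : ℂ) * ‖deriv τ z‖ := fun z => by
    rw [Complex.star_def, Complex.mul_conj, Complex.normSq_eq_norm_sq]; push_cast; ring
  have ne0 : ∀ z ∈ Ω₂, (‖deriv τ z‖ : ℂ) ≠ 0 := fun z hz => by
    exact_mod_cast norm_ne_zero_iff.mpr (hne₂ z hz)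
  have hrs : star r = r := ext_fn fun z hz => by
    rw [fn_star, hr z hz]; exact Complex.conj_ofReal _
  have hra : r * r * (a * star a) = 1 := ext_fn fun z hz => by
    simp only [fn_mul, fn_star, fn_one hz, hr z hz, ha z hz, nrm]
    have := ne0 z hz
    push_cast
    field_simp
  have hc := isCoordChange_comp hτ₂ hm₂ ha hne₂
  obtain ⟨fr, ek⟩ := hc.frame hrs hra ad.frame
  obtain ⟨θ', hθ', Dθ'⟩ := hc.D_logDeriv hra ad.D'
  rw [← ek] at hθ'
  have ur : IsUnit r := IsUnit.of_mul_eq_one (r * (a * star a)) (by rw [← mul_assoc, hra])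
  have hY : VRepr (r • fun i => Smooth.comp τ (contDiffOn_of_holomorphic hτ₂) hm₂ (Y i))
      (lift g) := fun z hz => by
    ext i
    rw [lift_comp h hτ hm hg (hle₂ hz), ad.repr _ (hm₂ z hz), Pi.smul_apply, smul_eq_mul, fn_mul,
      hr z hz, fn_comp _ _ _ hz]
  have ad' := Adapted.mk hY fr
    (by rw [ek]; exact (ur.mul (hc.unit.mul hc.unit)).mul (ad.unit.map _)) hθ'
  have hsq : hopfSq g z₀ = (‖deriv τ z₀‖ : ℂ) ^ 2 * hopfSq f (τ z₀) := by
    rw [ad'.hopfSq_eq hz₂, ad.hopfSq_eq hz₁, ek]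
    simp only [fn_mul, fn_comp _ _ _ hz₂, hr _ hz₂, ha _ hz₂, Complex.normSq_mul,
      Complex.normSq_ofReal]
    rw [Complex.normSq_eq_norm_sq (deriv τ z₀)]
    have := ne0 z₀ hz₂
    push_cast
    field_simp
  have hD : fn ((wirtinger Ω₂).D θ') z₀
      = (‖deriv τ z₀‖ : ℂ) ^ 2 * fn ((wirtinger Ω₁).D θ) (τ z₀) := by
    rw [Dθ', fn_mul, fn_mul, fn_star, ha _ hz₂, nrm, fn_comp _ _ _ hz₂]; ring
  have n0 := ne0 z₀ hz₂
  rw [ad'.localP_eq hz₂, ad'.localK_eq hz₂, ad.localP_eq hz₁, ad.localK_eq hz₁, hD, hsq]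
  refine ⟨by field_simp, ?_⟩
  have n1 : ‖deriv τ z₀‖ ^ 2 ≠ 0 := by exact_mod_cast pow_ne_zero 2 n0
  rw [← Complex.ofReal_pow, Complex.re_ofReal_mul, Complex.re_ofReal_mul, ← mul_neg,
    mul_div_mul_left _ _ n1]

/-! ### Constant modulus of the invariant implies flatness -/

/-- The Willmore equation in a coordinate. -/
def IsWillmoreOn (f : ℂ → E4) (Ω : Opens ℂ) : Prop :=
  ∀ z ∈ Ω, normalDzbar f (normalDzbar f (hopf f)) z + (star (schwarzian f z) / 2) • hopf f z = 0

lemma Adapted.D'_rho {Y n : Fin 5 → Smooth Ω} {θ : Smooth Ω} (h : Adapted f Ω Y n θ)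
    (hW : IsWillmoreOn f Ω) : ∃ χ, (wirtinger Ω).LogDeriv ((wirtinger Ω).hopfCoeff Y n) χ θ ∧
      (wirtinger Ω).D' (2 * (wirtinger Ω).D θ
        + 2 * ((wirtinger Ω).hopfCoeff Y n * star ((wirtinger Ω).hopfCoeff Y n)))
        = -2 * θ * (2 * (wirtinger Ω).D θ
        + 2 * ((wirtinger Ω).hopfCoeff Y n * star ((wirtinger Ω).hopfCoeff Y n))) := by
  obtain ⟨u, hu⟩ := h.unit.exists_left_inv
  have hl : (wirtinger Ω).LogDeriv ((wirtinger Ω).hopfCoeff Y n)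
      ((wirtinger Ω).D ((wirtinger Ω).hopfCoeff Y n) * u) θ :=
    ⟨h.unit, by rw [mul_assoc, hu, mul_one], h.D'⟩
  exact ⟨_, hl, hl.D'_rho (Frame.willmore_eq h.frame h.repr hW) h.frame.conformalGauss⟩

lemma IsConformalOn.localK_eq_zero (h : IsConformalOn f Ω) (hκ : ∀ z ∈ Ω, hopf f z ≠ 0)
    (hW : IsWillmoreOn f Ω) {c : ℝ} (hc : c ≠ 0) (hP : ∀ z ∈ Ω, ‖localP f z‖ = c) {z₀ : ℂ}
    (hz₀ : z₀ ∈ Ω) : localK f z₀ = 0 := by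
  obtain ⟨Ω', hle, hz, Y, n, θ, ad⟩ := h.exists_adapted hκ hz₀
  obtain ⟨χ, hl, hD⟩ := ad.D'_rho fun z hz => hW z (hle hz)
  -- The left side is `-ρ`; the sign affects neither the linear equation for `ρ_z̄` nor `|ρ|²`.
  have hρ : ∀ z ∈ Ω', fn (2 * (wirtinger Ω').D θ
      + 2 * ((wirtinger Ω').hopfCoeff Y n * star ((wirtinger Ω').hopfCoeff Y n))) z
      = -localP f z * (Complex.normSq (fn ((wirtinger Ω').hopfCoeff Y n) z) : ℂ) := fun z hz => by
    have h0 : (Complex.normSq (fn ((wirtinger Ω').hopfCoeff Y n) z) : ℂ) ≠ 0 := by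
      exact_mod_cast (ad.hopfSq_pos hz).ne'
    rw [ad.localP_eq hz, ad.hopfSq_eq hz]
    simp only [fn_add, fn_mul, fn_star, fn_ofNat 2 hz]
    rw [Complex.star_def, Complex.mul_conj]
    field_simp
    ring
  have key := hl.re_D_theta_eq_zero (c := algebraMap ℂ (Smooth Ω') ((c : ℂ) ^ 2)) ?_
    (Derivation.map_algebraMap _ _) hD ?_
  · rw [ad.localK_eq hz]
    have := congrArg (fn · z₀) key
    simp only [fn_add, fn_star, fn_zero] at this
    have := congrArg Complex.re this
    simp at this
    rw [this]; simp
  · refine isUnit_iff.mpr fun z hz => ?_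
    rw [hρ z hz]
    refine mul_ne_zero (neg_ne_zero.mpr ?_) (by exact_mod_cast (ad.hopfSq_pos hz).ne')
    rw [← norm_ne_zero_iff, hP z (hle hz)]; exact hc
  · refine ext_fn fun z hz => ?_
    have e1 : fn (algebraMap ℂ (Smooth Ω') ((c : ℂ) ^ 2)) z = (c : ℂ) ^ 2 := by
      rw [Algebra.algebraMap_eq_smul_one, fn_smul, fn_one hz]; simp
    have e2 : localP f z * star (localP f z) = (c : ℂ) ^ 2 := by
      rw [Complex.star_def, Complex.mul_conj, Complex.normSq_eq_norm_sq, hP z (hle hz)]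
      push_cast; rfl
    have e3 : ∀ w : ℂ, w * star w = (Complex.normSq w : ℂ) := fun w => by
      rw [Complex.star_def, Complex.mul_conj]
    have e4 : ∀ x : ℝ, star (x : ℂ) = x := Complex.conj_ofReal
    rw [fn_mul, fn_star, hρ z hz]
    simp only [fn_mul, fn_star, e1, star_mul', star_neg, e3, e4]
    linear_combination (Complex.normSq (fn ((wirtinger Ω').hopfCoeff Y n) z) : ℂ) ^ 2 * e2

end

/-! ### Flat Willmore surfaces lie in a Clifford torus -/

section

open Topology TopologicalSpace Smooth

variable {Ω Ω' : Opens ℂ} {f : ℂ → E4}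

/-! ### Flat surfaces lie in a Clifford torus -/

lemma Adapted.restrict {Y n : Fin 5 → Smooth Ω} {θ : Smooth Ω} (ad : Adapted f Ω Y n θ)
    (hle : Ω' ≤ Ω) : ∃ Y' n' θ', Adapted f Ω' Y' n' θ' ∧
      ∀ z ∈ Ω', fn ((wirtinger Ω').hopfCoeff Y' n') z = fn ((wirtinger Ω).hopfCoeff Y n) z := by
  have hid : DifferentiableOn ℂ (id : ℂ → ℂ) Ω' := differentiableOn_id
  have hc := isCoordChange_comp (Ω := Ω) hid hle (a := 1)
    (fun z hz => by rw [fn_one hz]; simp) (fun z _ => by simp)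
  obtain ⟨fr, ek⟩ := hc.frame (r := 1) (star_one _) (by simp) ad.frame
  have hY : VRepr ((1 : Smooth Ω') • fun i =>
      Smooth.comp id (contDiffOn_of_holomorphic hid) hle (Y i)) (lift f) := fun z hz => by
    ext i
    rw [ad.repr z (hle hz), Pi.smul_apply, smul_eq_mul, one_mul, fn_comp _ _ _ hz]; rfl
  have hu := (ad.unit.map (Smooth.comp id (contDiffOn_of_holomorphic hid) hle))
  have ek' := ek
  rw [one_mul, one_mul, one_mul] at ek'
  rw [← ek'] at hu
  obtain ⟨θ', hθ'⟩ := exists_logDeriv hu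
  exact ⟨_, _, θ', ⟨hY, fr, hu, hθ'⟩, fun z hz => by rw [ek', fn_comp _ _ _ hz]; rfl⟩

/-- Near `z₀` the quotient `g / g z₀` stays in the slit plane, where the principal logarithm is
smooth. A ball is chosen so that the domain is also connected. -/
lemma exists_sqrt {g : ℂ → ℂ} (hg : ContDiffOn ℝ ∞ g Ω) {z₀ : ℂ} (hz₀ : z₀ ∈ Ω)
    (h0 : g z₀ ≠ 0) : ∃ Ω' ≤ Ω, z₀ ∈ Ω' ∧ IsPreconnected (Ω' : Set ℂ) ∧ ∃ q : ℂ → ℂ,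
      ContDiffOn ℝ ∞ q Ω' ∧ ∀ z ∈ Ω', q z * q z = g z := by
  have hc : ContinuousOn (fun z => g z / g z₀) Ω := hg.continuousOn.div_const _
  have ho := hc.isOpen_inter_preimage Ω.isOpen Complex.isOpen_slitPlane
  obtain ⟨ε, hε, hb⟩ := Metric.isOpen_iff.mp ho z₀ ⟨hz₀, by simp [h0]⟩
  obtain ⟨c, hc⟩ : ∃ c, g z₀ = c * c := IsAlgClosed.exists_eq_mul_self (g z₀)
  refine ⟨⟨Metric.ball z₀ ε, Metric.isOpen_ball⟩, fun z hz => (hb hz).1,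
    Metric.mem_ball_self hε, (convex_ball z₀ ε).isPreconnected,
    fun z => c * Complex.exp (Complex.log (g z / g z₀) / 2), fun z hz => ?_, fun z hz => ?_⟩
  · have h1 : ContDiffAt ℝ ∞ (fun z => g z / g z₀) z :=
      (hg.contDiffAt (Ω.isOpen.mem_nhds (hb hz).1)).div_const _
    have h2 : ContDiffAt ℝ ∞ Complex.log (g z / g z₀) :=
      (Complex.contDiffAt_log (hb hz).2).restrict_scalars ℝ
    exact (contDiffAt_const.mul ((h2.comp z h1).div_const 2).cexp).contDiffWithinAt
  · have h1 : g z / g z₀ ≠ 0 := Complex.slitPlane_ne_zero (hb hz).2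
    have h2 : Complex.exp (Complex.log (g z / g z₀) / 2)
        * Complex.exp (Complex.log (g z / g z₀) / 2) = g z / g z₀ := by
      rw [← Complex.exp_add, add_halves, Complex.exp_log h1]
    simp only
    rw [mul_mul_mul_comm, h2, ← hc]
    field_simp

/-- For real `φ` the equation `φ_z = 0` implies `φ_z̄ = 0`, so the whole differential vanishes. -/
lemma fn_const {φ : Smooth Ω} (hΩ : IsPreconnected (Ω : Set ℂ)) (hφ : (wirtinger Ω).D φ = 0)
    (hs : star φ = φ) {z w : ℂ} (hz : z ∈ Ω) (hw : w ∈ Ω) : fn φ z = fn φ w := by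
  refine Ω.isOpen.is_const_of_fderiv_eq_zero (𝕜 := ℝ) hΩ
    (fun x hx => (differentiableAt_fn φ hx).differentiableWithinAt) (fun x hx => ?_) hz hw
  have hφ' : (wirtinger Ω).D' φ = 0 := by rw [← hs, ← Wirtinger.star_D, hφ, star_zero]
  ext1 v
  rw [fderiv_eq_dz_dzbar, ← fn_D φ hx, ← fn_D' φ hx, hφ, hφ', fn_zero]
  simp

lemma mulVec_conj_lorentzMatrix (E : Fin 5 → Fin 5 → ℝ) (v : Fin 5 → ℝ) (i : Fin 5) :
    (lorentzMatrix * Matrix.of E * lorentzMatrix).mulVec v i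
      = (![-1, 1, 1, 1, 1] : Fin 5 → ℝ) i * bform (E i) v := by
  rw [lorentzMatrix_eq, ← Matrix.mulVec_mulVec, ← Matrix.mulVec_mulVec, Matrix.mulVec_diagonal,
    bform_eq]
  simp only [Matrix.mulVec, dotProduct, Fin.sum_univ_five, Matrix.diagonal_apply, Matrix.of_apply,
    Matrix.cons_val]
  simp
  ring_nf
  tauto

lemma lorentzMatrix_mul_self : lorentzMatrix * lorentzMatrix = 1 := by
  rw [lorentzMatrix_eq, Matrix.diagonal_mul_diagonal, ← Matrix.diagonal_one]
  congr 1; ext i; fin_cases i <;> simp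

/-- The Gram condition is `E J Eᵀ = J`. Passing to the other order of the inverse gives `Eᵀ J E =
J`, hence `J E J` is Lorentz. -/
lemma isLorentz_of_gram {E : Fin 5 → Fin 5 → ℝ}
    (hE : ∀ i j, bform (E i) (E j) = lorentzMatrix i j) :
    (lorentzMatrix * Matrix.of E * lorentzMatrix).transpose * lorentzMatrix
      * (lorentzMatrix * Matrix.of E * lorentzMatrix) = lorentzMatrix := by
  have hJ := lorentzMatrix_mul_self
  have hT : lorentzMatrix.transpose = lorentzMatrix := by
    rw [lorentzMatrix_eq, Matrix.diagonal_transpose]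
  have h1 : Matrix.of E * (lorentzMatrix * (Matrix.of E).transpose * lorentzMatrix) = 1 := by
    have : Matrix.of E * lorentzMatrix * (Matrix.of E).transpose = lorentzMatrix := by
      ext i j
      rw [← hE i j, lorentzMatrix_eq, bform_eq]
      simp [Matrix.mul_apply, Fin.sum_univ_five, Matrix.diagonal_apply]
      ring
    rw [← mul_assoc, ← mul_assoc, this, hJ]
  have h2 := mul_eq_one_comm.mp h1
  rw [Matrix.transpose_mul, Matrix.transpose_mul, hT]
  calc _ = lorentzMatrix * (Matrix.of E).transpose * (lorentzMatrix * lorentzMatrix)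
        * lorentzMatrix * Matrix.of E * lorentzMatrix := by simp only [mul_assoc]
    _ = lorentzMatrix := by rw [hJ, mul_one, h2, one_mul]

/-- The light-like line of `v` represents a point of the Clifford torus. -/
def OnClifford (v : Fin 5 → ℝ) : Prop :=
  2 * (v 1 * v 1 + v 2 * v 2) = v 0 * v 0 ∧ 2 * (v 3 * v 3 + v 4 * v 4) = v 0 * v 0

/-- Fix `v = Y(z)` as a constant vector and compare the first integrals at two points. At `z` they
are known from the frame relations; at `z₀` they are the coordinates of `Y(z)` in one fixed Lorentz
basis. -/
lemma Wirtinger.FlatFrame.exists_clifford {q : Smooth Ω} {Y n A L : Fin 5 → Smooth Ω}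
    (h : (wirtinger Ω).FlatFrame q Y n A L) (hΩ : IsPreconnected (Ω : Set ℂ)) {z₀ : ℂ}
    (hz₀ : z₀ ∈ Ω) : ∃ B : Matrix (Fin 5) (Fin 5) ℝ,
      B.transpose * lorentzMatrix * B = lorentzMatrix ∧
      ∀ z ∈ Ω, ∀ v : Fin 5 → ℝ, (fun i => (v i : ℂ)) = (fun i => fn (Y i) z) →
        OnClifford (B.mulVec v) := by
  have hstar : ∀ v : Fin 5 → Smooth Ω, star (fun i => fn (v i) z₀) = fun i => fn (star v i) z₀ :=
    fun v => by ext i; rw [Pi.star_apply, Pi.star_apply, fn_star]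
  have cst : ∀ v : Fin 5 → Smooth Ω, star v = v →
      star (fun i => fn (v i) z₀) = fun i => fn (v i) z₀ :=
    fun v hv => by rw [hstar, hv]
  have AA' := congrArg (fn · z₀) h.AA'
  have LY := congrArg (fn · z₀) h.LY
  simp only [fn_mul, fn_neg, fn_ofNat 2 hz₀, fn_one hz₀, fn_bform] at AA' LY
  obtain ⟨E, hE, hv⟩ := lorentz_basis (Y := fun i => fn (Y i) z₀) (n := fun i => fn (n i) z₀)
    (A := fun i => fn (A i) z₀) (L := fun i => fn (L i) z₀) (cst _ h.star_Y) (cst _ h.star_n)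
    (cst _ h.star_L) (by rw [← fn_bform, h.YY, fn_zero]) (by rw [← fn_bform, h.YA, fn_zero])
    (by rw [← fn_bform, h.AA, fn_zero]) (by rw [hstar]; exact AA')
    (by rw [← fn_bform, h.nn, fn_one hz₀]) (by rw [← fn_bform, h.nY, fn_zero])
    (by rw [← fn_bform, h.nA, fn_zero]) (by rw [← fn_bform, h.nL, fn_zero])
    (by rw [← fn_bform, h.LL, fn_one hz₀]) (by rw [← fn_bform, h.LA, fn_zero]) LY
  refine ⟨_, isLorentz_of_gram hE, fun z hz v hvz => ?_⟩
  obtain ⟨e0, e1, e3⟩ := hv v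
  obtain ⟨c, hc⟩ : ∃ c : Fin 5 → Smooth Ω, c = fun i => algebraMap ℂ (Smooth Ω) (v i) := ⟨_, rfl⟩
  have fc : ∀ i, ∀ w ∈ Ω, fn (c i) w = v i := fun i w hw => by
    rw [hc]; simp only
    rw [Algebra.algebraMap_eq_smul_one, fn_smul, fn_one hw, mul_one]
  have sc : star c = c := by
    ext i : 1
    exact ext_fn fun w hw => by
      rw [Pi.star_apply, fn_star, fc i w hw]; exact Complex.conj_ofReal _
  have hDc : (wirtinger Ω).vD c = 0 := by
    ext i : 1
    simp only [Wirtinger.vD, hc]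
    exact Derivation.map_algebraMap _ _
  have ev : ∀ w ∈ Ω, ∀ u : Fin 5 → Smooth Ω,
      bform (fun i => (v i : ℂ)) (fun i => fn (u i) w) = fn (bform c u) w := fun w hw u => by
    rw [fn_bform]; simp only [fc _ w hw]
  have real : ∀ u : Fin 5 → Smooth Ω, star (bform c u) = bform c (star u) := fun u => by
    rw [star_bform, sc]
  have s1 : ∀ a b : Fin 5 → Smooth Ω, (fun i => fn (a i) z₀) + (fun i => fn (b i) z₀)
      = fun i => fn ((a + b) i) z₀ := fun a b => by ext i; simp [fn_add]
  have s2 : ∀ a b : Fin 5 → Smooth Ω, (fun i => fn (a i) z₀) - (fun i => fn (b i) z₀)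
      = fun i => fn ((a - b) i) z₀ := fun a b => by ext i; simp [fn_sub]
  have s3 : (2 : ℂ) • (fun i => fn (Y i) z₀) = fun i => fn (((2 : Smooth Ω) • Y) i) z₀ := by
    ext i; simp [fn_mul, fn_ofNat 2 hz₀]
  -- `⟨v, L + 2Y⟩` is carried from `z₀` to `z`; the two quadratic integrals follow in the same way.
  rw [s3, s1, ev z₀ hz₀, fn_const hΩ ?_ ?_ hz₀ hz] at e0
  rotate_left
  · rw [Wirtinger.D_bform, hDc, Wirtinger.vD_add, Wirtinger.vD_smul, h.D_L, h.D_Y,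
      Wirtinger.D_two]
    simp only [bform_eq, Pi.add_apply, Pi.smul_apply, Pi.zero_apply, smul_eq_mul]
    ring
  · have : star (2 : Smooth Ω) = 2 := by simp
    rw [real, star_add, star_smul, h.star_L, h.star_Y, this]
  rw [hstar, s1, s1, ev z₀ hz₀, ev z₀ hz₀, ← fn_ofNat (Ω := Ω) 2 hz₀] at e1
  simp only [← fn_mul, ← fn_add] at e1
  rw [fn_const hΩ (h.D_first hDc) ?_ hz₀ hz] at e1
  swap
  · have : star (2 : Smooth Ω) = 2 := by simp
    simp only [star_add, star_mul', real, h.star_n, h.star_L, star_star, this, add_comm (star A)]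
  rw [hstar, s2, s2, ev z₀ hz₀, ev z₀ hz₀, ← fn_ofNat (Ω := Ω) 2 hz₀] at e3
  simp only [← fn_mul, ← fn_sub] at e3
  rw [fn_const hΩ (h.D_second hDc) ?_ hz₀ hz] at e3
  swap
  · have : star (2 : Smooth Ω) = 2 := by simp
    simp only [star_sub, star_mul', real, h.star_n, h.star_L, star_star, this]
    rw [← neg_sub A (star A), bform_neg_right]; ring
  have YA' : bform Y (star A) = 0 := by
    have := congrArg star h.YA
    rwa [star_bform, h.star_Y, star_zero] at this
  have hcY : ∀ u : Fin 5 → Smooth Ω, fn (bform c u) z = fn (bform Y u) z := fun u => by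
    rw [← ev z hz, hvz, fn_bform]
  have LY' : fn (bform Y L) z = -1 / 2 := by
    have := congrArg (fn · z) h.LY
    simp only [fn_mul, fn_neg, fn_ofNat 2 hz, fn_one hz] at this
    rw [bform_comm]; linear_combination this / 2
  have nY : bform Y n = 0 := by rw [bform_comm, h.nY]
  simp only [bform_add_right, bform_sub_right, bform_smul_right, fn_add, fn_sub, fn_mul, hcY,
    h.YY, h.YA, YA', nY, LY', fn_zero, fn_ofNat 2 hz] at e0 e1 e3
  have r0 : bform (E 0) v = -1 / 2 := by
    apply Complex.ofReal_injective; rw [e0]; push_cast; ring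
  have r1 : 2 * (bform (E 1) v * bform (E 1) v + bform (E 2) v * bform (E 2) v) = 1 / 4 := by
    apply Complex.ofReal_injective; rw [e1]; push_cast; ring
  have r3 : 2 * (bform (E 3) v * bform (E 3) v + bform (E 4) v * bform (E 4) v) = 1 / 4 := by
    apply Complex.ofReal_injective; rw [e3]; push_cast; ring
  -- The time coordinate is `1/2`, and each pair satisfies `2(x² + y²) = 1/4 = (1/2)²`.
  simp only [OnClifford, mulVec_conj_lorentzMatrix, Matrix.cons_val, r0]
  constructor
  · linear_combination r1
  · linear_combination r3

lemma OnClifford.of_smul {v : Fin 5 → ℝ} {c : ℝ} (hc : c ≠ 0) (h : OnClifford (c • v)) :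
    OnClifford v := by
  simp only [OnClifford, Pi.smul_apply, smul_eq_mul] at h ⊢
  have hc2 : c * c ≠ 0 := mul_ne_zero hc hc
  exact ⟨mul_left_cancel₀ hc2 (by linear_combination h.1),
    mul_left_cancel₀ hc2 (by linear_combination h.2)⟩

lemma IsConformalOn.exists_clifford (h : IsConformalOn f Ω) (hκ : ∀ z ∈ Ω, hopf f z ≠ 0)
    (hW : IsWillmoreOn f Ω) (hK : ∀ z ∈ Ω, localK f z = 0) {z₀ : ℂ} (hz₀ : z₀ ∈ Ω) :
    ∃ Ω' ≤ Ω, z₀ ∈ Ω' ∧ ∃ B : Matrix (Fin 5) (Fin 5) ℝ,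
      B.transpose * lorentzMatrix * B = lorentzMatrix ∧
      ∀ z ∈ Ω', OnClifford (B.mulVec (lightVec (f z))) := by
  obtain ⟨Ω₁, hle₁, hz₁, Y₁, n₁, θ₁, ad₁⟩ := h.exists_adapted hκ hz₀
  have sk := smooth_fn ((wirtinger Ω₁).hopfCoeff Y₁ n₁)
  have k0 := isUnit_iff.mp ad₁.unit
  have sr : ContDiffOn ℝ ∞ (fun z => ((‖fn ((wirtinger Ω₁).hopfCoeff Y₁ n₁) z‖ : ℝ) : ℂ)) Ω₁ :=
    Complex.ofRealCLM.contDiff.comp_contDiffOn (sk.norm ℝ k0)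
  -- `q` is a square root of `|k| k`. It is chosen merely smooth; its holomorphy comes out in
  -- `exists_flatFrame`.
  obtain ⟨Ω₂, hle₂, hz₂, hpc, q, hq, hqq⟩ := exists_sqrt (sr.mul sk) hz₁
    (mul_ne_zero (by exact_mod_cast norm_ne_zero_iff.mpr (k0 _ hz₁)) (k0 _ hz₁))
  obtain ⟨Y, n, θ, ad, ek⟩ := ad₁.restrict hle₂
  have hle := hle₂.trans hle₁
  have hW₂ : IsWillmoreOn f Ω₂ := fun z hz => hW z (hle hz)
  obtain ⟨χ, hl, hD⟩ := ad.D'_rho hW₂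
  have hflat : (wirtinger Ω₂).D θ + star ((wirtinger Ω₂).D θ) = 0 := ext_fn fun z hz => by
    have h1 := ad.localK_eq hz
    rw [hK z (hle hz), ad.hopfSq_eq hz, Complex.ofReal_re, eq_comm, div_eq_zero_iff] at h1
    have h2 := neg_eq_zero.mp (h1.resolve_right (ad.hopfSq_pos hz).ne')
    rw [fn_add, fn_star, fn_zero]
    apply Complex.ext <;> simp [h2]
  obtain ⟨hθ, hχ⟩ := hl.flat hD hflat
  obtain ⟨Q, hQ⟩ : ∃ Q : Smooth Ω₂, ∀ z ∈ Ω₂, fn Q z = q z :=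
    ⟨Smooth.mk _ hq, fun z hz => fn_mk _ hq hz⟩
  obtain ⟨r, hr⟩ : ∃ r : Smooth Ω₂, ∀ z ∈ Ω₂,
      fn r z = (‖fn ((wirtinger Ω₂).hopfCoeff Y n) z‖ : ℂ) :=
    ⟨Smooth.mk _ (sr.mono hle₂), fun z hz => by rw [ek z hz]; exact fn_mk _ (sr.mono hle₂) hz⟩
  have e3 : ∀ w : ℂ, w * star w = (‖w‖ : ℂ) * ‖w‖ := fun w => by
    rw [Complex.star_def, Complex.mul_conj, Complex.normSq_eq_norm_sq]; push_cast; ring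
  obtain ⟨A, L, hF⟩ := ad.frame.exists_flatFrame hl (Frame.willmore_eq ad.frame ad.repr hW₂) hθ hχ
    (r := r) (q := Q)
    (ext_fn fun z hz => by rw [fn_star, hr z hz]; exact Complex.conj_ofReal _)
    (ext_fn fun z hz => by simp only [fn_mul, fn_star, hr z hz, e3])
    (ext_fn fun z hz => by simp only [fn_mul, hr z hz, hQ z hz, hqq z hz, ek z hz])
    (ext_fn fun z hz => by
      have h1 := congrArg (‖·‖) (hqq z hz)
      simp only [norm_mul, Complex.norm_real, norm_norm] at h1
      simp only [fn_mul, fn_star, hr z hz, hQ z hz, e3, ek z hz]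
      exact_mod_cast h1)
  obtain ⟨B, hB, hv⟩ := hF.exists_clifford hpc hz₂
  refine ⟨Ω₂, hle, hz₂, B, hB, fun z hz => ?_⟩
  have := hv z hz ((‖fn ((wirtinger Ω₂).hopfCoeff Y n) z‖ * ‖fderiv ℝ f z 1‖⁻¹) • lightVec (f z)) ?_
  · rw [Matrix.mulVec_smul] at this
    exact this.of_smul (mul_ne_zero (norm_ne_zero_iff.mpr (isUnit_iff.mp ad.unit z hz))
      (inv_ne_zero (norm_ne_zero_iff.mpr (h.fderiv_ne_zero (hle hz)))))
  · ext i
    have := congrFun (ad.repr z hz) i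
    simp only [Pi.smul_apply, smul_eq_mul, fn_mul, ← this, hr z hz, lift]
    push_cast
    ring

end

/-! ### Action on the light cone, and the invariant of pieces of Clifford tori -/

section

open Topology TopologicalSpace Smooth

variable {Ω Ω' : Opens ℂ} {f : ℂ → E4}

/-! ### Lorentz matrices acting on the light cone -/

section Lorentz

variable {R : Type*} [CommRing R] (φ : ℝ →+* R) {B : Matrix (Fin 5) (Fin 5) ℝ}
  (hB : B.transpose * lorentzMatrix * B = lorentzMatrix)

lemma bform_eq_dotProduct (v w : Fin 5 → R) :
    bform v w = v ⬝ᵥ (lorentzMatrix.map φ).mulVec w := by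
  rw [lorentzMatrix_eq, Matrix.diagonal_map (map_zero φ)]
  simp only [bform_eq, dotProduct, Matrix.mulVec_diagonal, Fin.sum_univ_five]
  simp
  ring

include hB

lemma bform_mulVec_map (v w : Fin 5 → R) :
    bform ((B.map φ).mulVec v) ((B.map φ).mulVec w) = bform v w := by
  have h : (B.map φ).transpose * lorentzMatrix.map φ * B.map φ = lorentzMatrix.map φ := by
    rw [← Matrix.transpose_map, ← Matrix.map_mul, ← Matrix.map_mul, hB]
  rw [bform_eq_dotProduct φ, bform_eq_dotProduct φ v w]
  nth_rewrite 2 [← h]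
  rw [← Matrix.mulVec_mulVec, ← Matrix.mulVec_mulVec, Matrix.dotProduct_mulVec v,
    Matrix.vecMul_transpose]

lemma bform_mulVec (v w : Fin 5 → ℝ) : bform (B.mulVec v) (B.mulVec w) = bform v w := by
  simpa [Matrix.map_id] using bform_mulVec_map (RingHom.id ℝ) hB v w

lemma lorentz_leftInv : lorentzMatrix * B.transpose * lorentzMatrix * B = 1 := by
  rw [mul_assoc lorentzMatrix, mul_assoc lorentzMatrix, hB, lorentzMatrix_mul_self]

/-- A null vector with vanishing time component is zero, which the invertible `B` excludes. So every
image can be rescaled to the form `(1, t)` with `t ∈ S³`. -/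
lemma mulVec_lightVec_zero_ne_zero {x : E4} (hx : ‖x‖ = 1) : B.mulVec (lightVec x) 0 ≠ 0 := by
  intro h0
  have e3 := sum_sq_eq (x := x)
  rw [hx] at e3
  have h1 : bform (lightVec x) (lightVec x) = 0 := by
    simp only [bform, lightVec, Fin.cons_zero, Fin.cons_succ, e3]; norm_num
  rw [← bform_mulVec hB, bform, h0, mul_zero, neg_zero, zero_add,
    Finset.sum_eq_zero_iff_of_nonneg fun i _ => mul_self_nonneg _] at h1
  have h2 : B.mulVec (lightVec x) = 0 := by
    ext i
    obtain rfl | ⟨j, rfl⟩ := Fin.eq_zero_or_eq_succ i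
    · exact h0
    · simpa using h1 j (Finset.mem_univ _)
  have h3 := congrArg (lorentzMatrix * B.transpose * lorentzMatrix).mulVec h2
  rw [Matrix.mulVec_mulVec, lorentz_leftInv hB, Matrix.one_mulVec, Matrix.mulVec_zero] at h3
  simpa [lightVec] using congrFun h3 0

lemma exists_mobius : ∃ T : S3 → S3, IsMobiusTransformation T ∧
    ∀ x : S3, ∃ c : ℝ, c ≠ 0 ∧ B.mulVec (lightVec (x : E4)) = c • lightVec (T x : E4) := by
  have : ∀ x : S3, ∃ t : S3, ∃ c : ℝ, c ≠ 0 ∧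
      B.mulVec (lightVec (x : E4)) = c • lightVec (t : E4) := fun x => by
    have hx : ‖(x : E4)‖ = 1 := by simp
    have h0 := mulVec_lightVec_zero_ne_zero hB hx
    have e3 := sum_sq_eq (x := (x : E4))
    rw [hx] at e3
    have h1 : bform (lightVec (x : E4)) (lightVec (x : E4)) = 0 := by
      simp only [bform, lightVec, Fin.cons_zero, Fin.cons_succ, e3]; norm_num
    rw [← bform_mulVec hB] at h1
    generalize B.mulVec (lightVec (x : E4)) = w at h0 h1
    obtain ⟨t, ht⟩ : ∃ t : E4, ∀ i, t i = w i.succ / w 0 :=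
      ⟨WithLp.toLp 2 fun i => w i.succ / w 0, fun i => rfl⟩
    have hn : ‖t‖ = 1 := by
      have h2 : ‖t‖ ^ 2 = 1 := by
        rw [← sum_sq_eq]
        simp only [ht]
        have : ∑ i : Fin 4, w i.succ * w i.succ = w 0 * w 0 := by
          simp only [bform] at h1; linarith
        simp only [div_mul_div_comm, ← Finset.sum_div, this]
        exact div_self (mul_ne_zero h0 h0)
      nlinarith [norm_nonneg t]
    refine ⟨⟨t, by simpa using hn⟩, w 0, h0, ?_⟩
    ext i
    obtain rfl | ⟨j, rfl⟩ := Fin.eq_zero_or_eq_succ i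
    · simp [lightVec]
    · simp only [lightVec, Pi.smul_apply, Fin.cons_succ, ht, smul_eq_mul]
      field_simp
  choose T hT using this
  exact ⟨T, ⟨B, hB, hT⟩, hT⟩

end Lorentz

lemma onClifford_lightVec {x : S3} : OnClifford (lightVec (x : E4)) ↔ x ∈ cliffordTorus := by
  have e : ∀ i : Fin 4, lightVec (x : E4) i.succ = (x : E4) i := fun i => rfl
  have e0 : lightVec (x : E4) 0 = 1 := rfl
  have e1 := e 0
  have e2 := e 1
  have e3 := e 2
  have e4 := e 3
  simp only [Fin.succ_zero_eq_one, Fin.succ_one_eq_two, Fin.reduceSucc] at e1 e2 e3 e4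
  simp only [OnClifford, cliffordTorus, Set.mem_ofPred_eq, e0, e1, e2, e3, e4]
  constructor
  · rintro ⟨h1, h2⟩
    constructor <;> linarith
  · rintro ⟨h1, h2⟩
    constructor <;> linarith

/-! ### The invariant of pieces of Clifford tori -/

lemma IsConformalOn.localP_eq_neg_two (h : IsConformalOn f Ω) (hκ : ∀ z ∈ Ω, hopf f z ≠ 0)
    {B : Matrix (Fin 5) (Fin 5) ℝ} (hB : B.transpose * lorentzMatrix * B = lorentzMatrix)
    (hC : ∀ z ∈ Ω, OnClifford (B.mulVec (lightVec (f z)))) {z₀ : ℂ} (hz₀ : z₀ ∈ Ω) :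
    localP f z₀ = -2 := by
  obtain ⟨Y, hY, hL⟩ := h.exists_lift
  obtain ⟨φ, hφ⟩ : ∃ φ : ℝ →+* Smooth Ω, ∀ x, φ x = algebraMap ℂ (Smooth Ω) x :=
    ⟨(algebraMap ℂ (Smooth Ω)).comp Complex.ofRealHom, fun x => rfl⟩
  have fnφ : ∀ x, ∀ z ∈ Ω, fn (φ x) z = x := fun x z hz => by
    rw [hφ, Algebra.algebraMap_eq_smul_one, fn_smul, fn_one hz, mul_one]
  have sφ : ∀ x, star (φ x) = φ x := fun x => ext_fn fun z hz => by
    rw [fn_star, fnφ x z hz]; exact Complex.conj_ofReal _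
  have hM : (wirtinger Ω).IsLorentz (B.map φ) :=
    ⟨fun i j => by rw [Matrix.map_apply, hφ]; exact Derivation.map_algebraMap _ _,
      fun i j => sφ _, bform_mulVec_map φ hB⟩
  have hZ := hL.mulVec hM
  have ev : ∀ z ∈ Ω, ∀ i, fn ((B.map φ).mulVec Y i) z
      = ((‖fderiv ℝ f z 1‖⁻¹ * B.mulVec (lightVec (f z)) i : ℝ) : ℂ) := fun z hz i => by
    have hYi : ∀ j, fn (Y j) z = ((‖fderiv ℝ f z 1‖⁻¹ * lightVec (f z) j : ℝ) : ℂ) :=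
      fun j => (congrFun (hY z hz) j).symm
    simp only [Matrix.mulVec, dotProduct, Fin.sum_univ_five, fn_add, fn_mul, Matrix.map_apply,
      fnφ _ z hz, hYi]
    push_cast
    ring
  have hu : IsUnit ((B.map φ).mulVec Y 0) := isUnit_iff.mpr fun z hz => by
    rw [ev z hz]
    exact_mod_cast mul_ne_zero (inv_ne_zero (norm_ne_zero_iff.mpr (h.fderiv_ne_zero hz)))
      (mulVec_lightVec_zero_ne_zero hB (h.norm_eq z hz))
  have hcl : ∀ a b : Fin 5, (∀ z ∈ Ω, 2 * (B.mulVec (lightVec (f z)) a * B.mulVec (lightVec (f z)) a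
      + B.mulVec (lightVec (f z)) b * B.mulVec (lightVec (f z)) b)
      = B.mulVec (lightVec (f z)) 0 * B.mulVec (lightVec (f z)) 0) →
      2 * ((B.map φ).mulVec Y a * (B.map φ).mulVec Y a
        + (B.map φ).mulVec Y b * (B.map φ).mulVec Y b)
      = (B.map φ).mulVec Y 0 * (B.map φ).mulVec Y 0 := fun a b hab => ext_fn fun z hz => by
    simp only [fn_add, fn_mul, fn_ofNat 2 hz, ev z hz]
    have := congrArg (fun x : ℝ => (x : ℂ)) (hab z hz)
    push_cast at this ⊢
    linear_combination ((‖fderiv ℝ f z 1‖ : ℂ)⁻¹) ^ 2 * this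
  obtain ⟨n, θ, hf, hθ, Dθ⟩ := (wirtinger Ω).exists_frame_of_clifford hZ.star_Y hu
    (hcl 1 2 fun z hz => (hC z hz).1) (hcl 3 4 fun z hz => (hC z hz).2) hZ.zz hZ.zzb
  -- `C = B⁻¹`. The explicit normal belongs to the transformed lift and is pulled back by `C`, which
  -- leaves the Hopf coefficient unchanged.
  obtain ⟨C, hC'⟩ : ∃ C, C = lorentzMatrix * B.transpose * lorentzMatrix := ⟨_, rfl⟩
  have hBC : B.map φ * C.map φ = 1 := by
    rw [← Matrix.map_mul, mul_eq_one_comm.mp (hC' ▸ lorentz_leftInv hB)]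
    exact Matrix.map_one _ (map_zero φ) (map_one φ)
  have hn : (B.map φ).mulVec ((C.map φ).mulVec n) = n := by
    rw [Matrix.mulVec_mulVec, hBC, Matrix.one_mulVec]
  have sn : star ((C.map φ).mulVec n) = (C.map φ).mulVec n := by
    ext i : 1
    simp only [Pi.star_apply, Matrix.mulVec, dotProduct, star_sum, star_mul', Matrix.map_apply, sφ]
    exact Finset.sum_congr rfl fun j _ => by rw [← Pi.star_apply, hf.star_n]
  rw [← hn] at hf hθ
  obtain ⟨hfr, ek⟩ := hf.of_mulVec hL hM sn
  rw [ek] at hθ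
  have ad : Adapted f Ω Y _ θ := ⟨hY, hfr, isUnit_hopfCoeff hY hfr hκ, hθ⟩
  rw [ad.localP_eq hz₀, Dθ, fn_zero]
  simp

end

/-! ### From charts to the Riemann surface -/

section

open Topology TopologicalSpace Smooth

variable {M : Type*} [TopologicalSpace M] [ChartedSpace ℂ M] [IsManifold 𝓘(ℂ) ω M]

/-! ### Riemann surfaces -/

/-- The image of a coordinate. -/
def chartTarget (φ : OpenPartialHomeomorph M ℂ) : Opens ℂ := ⟨φ.target, φ.open_target⟩

lemma differentiableOn_transition {φ ψ : OpenPartialHomeomorph M ℂ} (hφ : φ ∈ atlas ℂ M)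
    (hψ : ψ ∈ atlas ℂ M) : DifferentiableOn ℂ (φ.symm ≫ₕ ψ) (φ.symm ≫ₕ ψ).source :=
  (contMDiffOn_of_mem_contDiffGroupoid (HasGroupoid.compatible (G := contDiffGroupoid ω 𝓘(ℂ))
    hφ hψ)).contDiffOn.differentiableOn (by simp)

variable (M) in
lemma isManifold_real : IsManifold 𝓘(ℝ, ℂ) ∞ M :=
  isManifold_of_contDiffOn _ _ _ fun φ ψ hφ hψ => by
    have h := ((contMDiffOn_of_mem_contDiffGroupoid (HasGroupoid.compatible
      (G := contDiffGroupoid ω 𝓘(ℂ)) hφ hψ)).contDiffOn.restrict_scalars ℝ).of_le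
        (m := ∞) le_top
    simpa using h

/-- The reverse transition map is a holomorphic local inverse, so the chain rule makes the product
of the derivatives 1. -/
lemma deriv_transition_ne_zero {φ ψ : OpenPartialHomeomorph M ℂ} (hφ : φ ∈ atlas ℂ M)
    (hψ : ψ ∈ atlas ℂ M) {z : ℂ} (hz : z ∈ (φ.symm ≫ₕ ψ).source) :
    deriv (φ.symm ≫ₕ ψ) z ≠ 0 := by
  have hz' : (φ.symm ≫ₕ ψ) z ∈ (ψ.symm ≫ₕ φ).source := by
    have := (φ.symm ≫ₕ ψ).map_source hz
    simpa using this
  have h1 := (differentiableOn_transition hφ hψ).differentiableAt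
    ((φ.symm ≫ₕ ψ).open_source.mem_nhds hz)
  have h2 := (differentiableOn_transition hψ hφ).differentiableAt
    ((ψ.symm ≫ₕ φ).open_source.mem_nhds hz')
  have h3 := h2.hasDerivAt.comp z h1.hasDerivAt
  have h4 : (ψ.symm ≫ₕ φ) ∘ (φ.symm ≫ₕ ψ) =ᶠ[𝓝 z] id := by
    filter_upwards [(φ.symm ≫ₕ ψ).open_source.mem_nhds hz] with w hw
    have := (φ.symm ≫ₕ ψ).left_inv hw
    simpa using this
  have h5 := (h3.congr_of_eventuallyEq h4.symm).unique (hasDerivAt_id z)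
  exact right_ne_zero_of_mul_eq_one h5

lemma IsConformalImmersion.isConformalOn {y : M → S3} (hy : IsConformalImmersion y)
    {φ : OpenPartialHomeomorph M ℂ} (hφ : φ ∈ atlas ℂ M) :
    IsConformalOn (inCoord y φ) (chartTarget φ) where
  smooth := by
    have := isManifold_real M
    have h1 : ContMDiffOn 𝓘(ℝ, ℂ) 𝓘(ℝ, ℂ) ∞ φ.symm φ.target :=
      contMDiffOn_symm_of_mem_maximalAtlas (IsManifold.subset_maximalAtlas hφ)
    exact (hy.smooth.comp_contMDiffOn h1).contDiffOn
  conformal := hy.conformal φ hφ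
  norm_eq z _ := by simp [inCoord]

/-- This lets a statement about all points of `M` be read in one fixed chart, where derivatives can
be taken. -/
lemma invariants_eq {y : M → S3} (hy : IsConformalImmersion y) (humb : HasNoUmbilics y)
    {φ : OpenPartialHomeomorph M ℂ} (hφ : φ ∈ atlas ℂ M) {q : M} (hq : q ∈ φ.source) :
    invP y q = localP (inCoord y φ) (φ q) ∧ mobiusCurvature y q = localK (inCoord y φ) (φ q) := by
  have hψ := chart_mem_atlas ℂ q
  have hqψ := mem_chart_source ℂ q
  rw [invP, mobiusCurvature]
  generalize chartAt ℂ q = ψ at hψ hqψ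
  have h0 : ψ q ∈ (ψ.symm ≫ₕ φ).source := by simp [hqψ, hq]
  have e := localP_localK_comp
    (Ω' := ⟨(ψ.symm ≫ₕ φ).source, (ψ.symm ≫ₕ φ).open_source⟩) (g := inCoord y ψ)
    (hy.isConformalOn hφ) (humb φ hφ) (differentiableOn_transition hψ hφ)
    (fun z hz => deriv_transition_ne_zero hψ hφ hz)
    (fun z hz => φ.map_source (by simpa using hz.2))
    (fun z hz => by
      have : ψ.symm z ∈ φ.source := by simpa using hz.2
      simp [inCoord, φ.left_inv this]) h0
  simpa [hqψ] using e

/-! ### Equivalence of the three conditions -/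

variable {y : M → S3} (hy : IsConformalImmersion y) (humb : HasNoUmbilics y)
include hy humb

lemma mobiusCurvature_eq_zero (hW : IsWillmore y) {c : ℝ} (hc : c ≠ 0)
    (h : ∀ p, ‖invP y p‖ = c) (p : M) : mobiusCurvature y p = 0 := by
  have hφ := chart_mem_atlas ℂ p
  refine (hy.isConformalOn hφ).localK_eq_zero (humb _ hφ) (hW _ hφ) hc (fun z hz => ?_)
    (mem_chart_target ℂ p)
  have hz' := (chartAt ℂ p).map_target hz
  rw [← h ((chartAt ℂ p).symm z), (invariants_eq hy humb hφ hz').1, (chartAt ℂ p).right_inv hz]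

lemma locallyMobiusEquivClifford (hW : IsWillmore y) (h : ∀ p, mobiusCurvature y p = 0) :
    LocallyMobiusEquivClifford y := fun p => by
  have hφ := chart_mem_atlas ℂ p
  obtain ⟨Ω', hle, hp, B, hB, hC⟩ := (hy.isConformalOn hφ).exists_clifford (humb _ hφ) (hW _ hφ)
    (fun z hz => by
      have hz' := (chartAt ℂ p).map_target hz
      rw [← h ((chartAt ℂ p).symm z), (invariants_eq hy humb hφ hz').2,
        (chartAt ℂ p).right_inv hz]) (mem_chart_target ℂ p)
  obtain ⟨T, hT, hT'⟩ := exists_mobius hB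
  refine ⟨_, (chartAt ℂ p).isOpen_inter_preimage Ω'.isOpen, ⟨mem_chart_source ℂ p, hp⟩, T, hT,
    fun q hq => ?_⟩
  obtain ⟨c, hc, e⟩ := hT' (y q)
  have h1 := hC _ hq.2
  rw [inCoord, (chartAt ℂ p).left_inv hq.1, e] at h1
  exact onClifford_lightVec.mp (h1.of_smul hc)

lemma invP_eq_neg_two (h : LocallyMobiusEquivClifford y) (p : M) : invP y p = -2 := by
  have hφ := chart_mem_atlas ℂ p
  have hp := mem_chart_source ℂ p
  obtain ⟨U, hU, hpU, T, ⟨B, hB, hT⟩, hC⟩ := h p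
  rw [invP]
  generalize chartAt ℂ p = φ at hφ hp
  obtain ⟨Ω', hΩ'⟩ : ∃ Ω' : Opens ℂ, ∀ z, z ∈ Ω' ↔ z ∈ φ.target ∧ φ.symm z ∈ U :=
    ⟨⟨_, φ.isOpen_inter_preimage_symm hU⟩, fun z => Iff.rfl⟩
  have hle : Ω' ≤ chartTarget φ := fun z hz => ((hΩ' z).mp hz).1
  refine ((hy.isConformalOn hφ).mono hle).localP_eq_neg_two
    (fun z hz => humb φ hφ z (hle hz)) hB (fun z hz => ?_)
    ((hΩ' _).mpr ⟨φ.map_source hp, by rwa [φ.left_inv hp]⟩)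
  obtain ⟨c, hc, e⟩ := hT (y (φ.symm z))
  obtain ⟨h1, h2⟩ := onClifford_lightVec.mpr (hC _ ((hΩ' z).mp hz).2)
  rw [inCoord, e]
  simp only [OnClifford, Pi.smul_apply, smul_eq_mul]
  exact ⟨by linear_combination c ^ 2 * h1, by linear_combination c ^ 2 * h2⟩

end

end WillmoreS3

end

theorem mainTheorem3 {M : Type*} [TopologicalSpace M] [ChartedSpace ℂ M] [IsManifold 𝓘(ℂ) ω M]
    (y : M → WillmoreS3.S3) (hy : WillmoreS3.IsConformalImmersion y)
    (humb : WillmoreS3.HasNoUmbilics y) (hW : WillmoreS3.IsWillmore y) :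
    List.TFAE
      [∃ c : ℝ, c ≠ 0 ∧ ∀ p : M, ‖WillmoreS3.invP y p‖ = c,
       ∀ p : M, WillmoreS3.mobiusCurvature y p = 0,
       WillmoreS3.LocallyMobiusEquivClifford y] ∧
    (WillmoreS3.LocallyMobiusEquivClifford y → ∀ p : M, WillmoreS3.invP y p = -2) := by
  refine ⟨?_, WillmoreS3.invP_eq_neg_two hy humb⟩
  tfae_have 1 → 2 := fun ⟨c, hc, h⟩ => WillmoreS3.mobiusCurvature_eq_zero hy humb hW hc h
  tfae_have 2 → 3 := WillmoreS3.locallyMobiusEquivClifford hy humb hW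
  tfae_have 3 → 1 := fun h => ⟨2, two_ne_zero, fun p => by
    rw [WillmoreS3.invP_eq_neg_two hy humb h p]; simp⟩
  tfae_finish
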